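/- Let $n\ge 2$ and let $S^1\cdot GL(n,\mathbb R)\subset GL(n,\mathbb C)$ be the group of matrices $e^{i\theta}A$ with $\theta\in\mathbb R$ and $A\in GL(n,\mathbb R)$. An $S^1\cdot GL(n,\mathbb R)$-structure $q:F\to Q$ on a smooth $2n$-manifold $Q$ is a smooth subbundle of the bundle of $\mathbb C^n$-valued coframes $u:T_xQ\to\mathbb C^n$ ($x\in Q$; $u$ a real-linear isomorphism) whose fibres are orbits of this group. It is torsion-free if it admits a connection without torsion, i.e. if $TQ$ has a smooth torsion-free affine connection whose connection form in every local section of $F$ has the form $i\omega_0 I_n+\phi$ with $\omega_0$ a real-valued and $\phi$ a $\mathfrak{gl}(n,\mathbb R)$-valued $1$-form. Let $R\subset \mathrm{Gr}(n,TQ)$ be the circle bundle whose fibre over $x\in Q$ consists of the $n$-planes $u^{-1}(e^{i\theta}\mathbb R^n)\subset T_xQ$ with $u\in F_x$, $\theta\in\mathbb R$. An $n$-dimensional submanifold $P\subset Q$ belongs to $R$ if all its tangent planes are elements of $R$, and $F$ is integrable if every $E\in R$ is tangent to an $n$-dimensional submanifold that belongs to $R$. (1) If $n>2$, every torsion-free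 $S^1\cdot GL(n,\mathbb R)$-structure is integrable. (2) Let $n=2$, let $F$ be torsion-free, let $\omega_0,\phi$ be the connection forms on $F$ of a connection without torsion, and let $\zeta=(\zeta^1,\zeta^2)$ be the tautological $\mathbb C^2$-valued $1$-form on $F$. There are unique functions on $F$, namely $A$ with complex values and $a$, $b_{ij}=b_{ji}$, $r^i_{jkl}=r^i_{kjl}=r^i_{jlk}$ with real values, such that (summing over repeated indices, with $\epsilon_{ij}=-\epsilon_{ji}$, $\epsilon_{12}=1$) the curvature forms $\Omega_0=d\omega_0$ and $\Phi=d\phi+\phi\wedge\phi$ satisfy $$\Omega_0=\mathrm{Im}(A\,\zeta^1\wedge\zeta^2)+3a\,(\zeta^1\wedge\overline{\zeta^2}-\zeta^2\wedge\overline{\zeta^1})-i\,b_{kl}\,\zeta^k\wedge\overline{\zeta^l},$$ $$\Phi^i_j=\delta^i_j\,\mathrm{Re}(A\,\zeta^1\wedge\zeta^2)+b_{jl}\,(\zeta^i\wedge\overline{\zeta^l}+\overline{\zeta^i}\wedge\zeta^l)+i\,\bigl(r^i_{jkl}+a(\epsilon_{jk}\delta^i_l+\epsilon_{jl}\delta^i_k)\bigr)\,\zeta^k\wedge\overline{\zeta^l}.$$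 The structure $F$ is integrable if and only if $A$ and $a$ vanish identically on $F$. -/

import Mathlib

open scoped Manifold ContDiff Topology

noncomputable section

/-- The group `S¹·GL(n,ℝ) ⊆ GL(n,ℂ)` of the matrices `e^{iθ} A` with `A` real and invertible. -/
def S1GL (n : ℕ) : Subgroup (Matrix.GeneralLinearGroup (Fin n) ℂ) where
  carrier := {g | ∃ (θ : ℝ) (A : Matrix.GeneralLinearGroup (Fin n) ℝ),
    (g : Matrix (Fin n) (Fin n) ℂ) =
      Complex.exp (θ * Complex.I) • (A : Matrix (Fin n) (Fin n) ℝ).map Complex.ofReal}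
  one_mem' := ⟨0, 1, by
    ext i j
    by_cases h : i = j <;> simp [h]⟩
  mul_mem' := by
    rintro g h ⟨θ, A, hg⟩ ⟨η, B, hh⟩
    refine ⟨θ + η, A * B, ?_⟩
    ext i j
    simp only [Units.val_mul, hg, hh, Matrix.mul_apply, Matrix.smul_apply, Matrix.map_apply,
      smul_eq_mul, Complex.ofReal_add, add_mul, Complex.exp_add, Complex.ofReal_sum,
      Complex.ofReal_mul, Finset.mul_sum]
    exact Finset.sum_congr rfl fun k _ => by ring
  inv_mem' := by
    rintro g ⟨θ, A, hg⟩
    refine ⟨-θ, A⁻¹, ?_⟩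
    have key : (g : Matrix (Fin n) (Fin n) ℂ) * (Complex.exp ((-θ : ℝ) * Complex.I) •
        ((A⁻¹ : Matrix.GeneralLinearGroup (Fin n) ℝ) : Matrix (Fin n) (Fin n) ℝ).map
          Complex.ofReal) = 1 := by
      have hA : (A : Matrix (Fin n) (Fin n) ℝ).map Complex.ofReal *
          ((A⁻¹ : Matrix.GeneralLinearGroup (Fin n) ℝ) : Matrix (Fin n) (Fin n) ℝ).map
            Complex.ofReal = 1 := by
        have h1 := congrArg (fun M : Matrix (Fin n) (Fin n) ℝ => M.map (Complex.ofRealHom))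
          (show (A : Matrix (Fin n) (Fin n) ℝ) *
            ((A⁻¹ : Matrix.GeneralLinearGroup (Fin n) ℝ) : Matrix (Fin n) (Fin n) ℝ) = 1 by
              rw [← Units.val_mul, mul_inv_cancel, Units.val_one])
        simp only [Matrix.map_mul] at h1
        refine h1.trans ?_
        ext i j
        by_cases h : i = j <;> simp [Matrix.one_apply, h]
      rw [hg, Matrix.smul_mul, Matrix.mul_smul, hA, smul_smul, ← Complex.exp_add]
      simp
    have h2 := congrArg (fun M => ((g⁻¹ : Matrix.GeneralLinearGroup (Fin n) ℂ) :
      Matrix (Fin n) (Fin n) ℂ) * M) key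
    simp only [← Matrix.mul_assoc, mul_one] at h2
    rw [← Units.val_mul, inv_mul_cancel, Units.val_one, Matrix.one_mul] at h2
    exact h2.symm

/-- The real `n`-plane `e^{iθ} ℝⁿ ⊆ ℂⁿ`. -/
def rotatedRealPlane (n : ℕ) (θ : ℝ) : Submodule ℝ (Fin n → ℂ) where
  carrier := {z | ∃ x : Fin n → ℝ, ∀ i, z i = Complex.exp (θ * Complex.I) * (x i : ℂ)}
  zero_mem' := ⟨0, by simp⟩
  add_mem' := by
    rintro z w ⟨x, hx⟩ ⟨y, hy⟩
    exact ⟨x + y, fun i => by simp [hx, hy, mul_add]⟩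
  smul_mem' := by
    rintro c z ⟨x, hx⟩
    exact ⟨c • x, fun i => by simp [hx]; ring⟩

/-- The `ℂⁿ`-valued coframes at a point `q` of a `2n`-manifold `Q`: the real linear isomorphisms
`T_qQ ≃ ℂⁿ`. -/
abbrev CoframeAt (n : ℕ) {Q : Type*} [TopologicalSpace Q]
    [ChartedSpace (EuclideanSpace ℝ (Fin (2 * n))) Q] (q : Q) : Type :=
  TangentSpace (𝓡 (2 * n)) q ≃L[ℝ] (Fin n → ℂ)

/-- A field of coframes is smooth on `U` if, regarded as a `ℂⁿ`-valued `1`-form, that is, as a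
function on the tangent bundle, it is smooth over `U`. -/
def SmoothCoframingOn (n : ℕ) {Q : Type*} [TopologicalSpace Q]
    [ChartedSpace (EuclideanSpace ℝ (Fin (2 * n))) Q] [IsManifold (𝓡 (2 * n)) ∞ Q]
    (u : (q : Q) → CoframeAt n q) (U : Set Q) : Prop :=
  ContMDiffOn (𝓡 (2 * n)).tangent 𝓘(ℝ, Fin n → ℂ) ∞
    (fun v : TangentBundle (𝓡 (2 * n)) Q => u v.1 v.2) {v | v.1 ∈ U}

/-- An `S¹·GL(n,ℝ)`-structure on a `2n`-manifold `Q`: a smooth subbundle of the bundle of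
`ℂⁿ`-valued coframes each of whose fibres is an orbit of `S¹·GL(n,ℝ)`. -/
structure S1GLStructure (n : ℕ) (Q : Type*) [TopologicalSpace Q]
    [ChartedSpace (EuclideanSpace ℝ (Fin (2 * n))) Q] [IsManifold (𝓡 (2 * n)) ∞ Q] where
  /-- the fibre over `q` -/
  fibre : (q : Q) → Set (CoframeAt n q)
  mem_fibre_iff : ∀ (q : Q) (u v : CoframeAt n q), u ∈ fibre q →
    (v ∈ fibre q ↔ ∃ g ∈ S1GL n, ∀ X : TangentSpace (𝓡 (2 * n)) q,
      v X = (g : Matrix (Fin n) (Fin n) ℂ).mulVec (u X))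
  exists_smooth_section : ∀ q : Q, ∃ (U : Set Q) (u : (p : Q) → CoframeAt n p),
    IsOpen U ∧ q ∈ U ∧ (∀ p ∈ U, u p ∈ fibre p) ∧ SmoothCoframingOn n u U

namespace S1GLStructure

variable {n : ℕ} {Q : Type*} [TopologicalSpace Q]
  [ChartedSpace (EuclideanSpace ℝ (Fin (2 * n))) Q] [IsManifold (𝓡 (2 * n)) ∞ Q]

/-- The total space of the bundle `F → Q`. -/
def Total (F : S1GLStructure n Q) : Type _ := (q : Q) × F.fibre q

/-- The fibre `R_q` of the circle bundle `R ⊆ Gr(n, TQ)`: the tangent `n`-planes that a coframe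
belonging to the structure carries to some `e^{iθ} ℝⁿ`. -/
def circle (F : S1GLStructure n Q) (q : Q) : Set (Submodule ℝ (TangentSpace (𝓡 (2 * n)) q)) :=
  {E | ∃ u ∈ F.fibre q, ∃ θ : ℝ,
    E = (rotatedRealPlane n θ).comap (u : TangentSpace (𝓡 (2 * n)) q →ₗ[ℝ] (Fin n → ℂ))}

/-- A subset `P` of `Q` carrying a manifold structure (for the subspace topology) that makes it an
`n`-dimensional embedded submanifold belongs to `R` if all its tangent planes are elements
of `R`. -/
def Belongs (F : S1GLStructure n Q) (P : Set Q)
    [ChartedSpace (EuclideanSpace ℝ (Fin n)) P] : Prop :=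
  Manifold.IsSmoothEmbedding (𝓡 n) (𝓡 (2 * n)) ∞ (Subtype.val : P → Q) ∧
    ∀ p : P, (mfderiv (𝓡 n) (𝓡 (2 * n)) (Subtype.val : P → Q) p).range ∈ F.circle (p : Q)

/-- The structure is integrable if every element of `R` is tangent to an `n`-dimensional
submanifold that belongs to `R`. -/
def Integrable (F : S1GLStructure n Q) : Prop :=
  ∀ (q : Q), ∀ E ∈ F.circle q,
    ∃ (P : Set Q) (_ : ChartedSpace (EuclideanSpace ℝ (Fin n)) P) (_ : IsManifold (𝓡 n) ∞ P)
      (hq : q ∈ P), F.Belongs P ∧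
        (mfderiv (𝓡 n) (𝓡 (2 * n)) (Subtype.val : P → Q) ⟨q, hq⟩).range = E

/-- A smooth affine connection on `Q` is a connection on `F` if, with respect to every smooth local
section `u` of `F`, its connection form takes values in the Lie algebra `iℝ ⊕ 𝔤𝔩(n,ℝ)`
of `S¹·GL(n,ℝ)`: for every tangent vector `X` at `p` there are a real number `ω₀ = ω₀(X)` and a real
matrix `φ = φ(X)` with `u(∇_X Y) = d(u(Y))(X) + (i ω₀ + φ) u(Y)` for all vector fields `Y`. -/
structure IsConnection (F : S1GLStructure n Q)
    (nabla : CovariantDerivative (𝓡 (2 * n)) (EuclideanSpace ℝ (Fin (2 * n)))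
      (TangentSpace (𝓡 (2 * n)) : Q → Type _)) : Prop where
  smooth : nabla.ContMDiffCovariantDerivative ∞
  compatible : ∀ (U : Set Q) (u : (p : Q) → CoframeAt n p), IsOpen U →
    (∀ p ∈ U, u p ∈ F.fibre p) → SmoothCoframingOn n u U →
    ∀ p ∈ U, ∀ X : TangentSpace (𝓡 (2 * n)) p,
      ∃ (ω₀ : ℝ) (φ : Matrix (Fin n) (Fin n) ℝ),
        ∀ Y : (q : Q) → TangentSpace (𝓡 (2 * n)) q,
          MDifferentiableAt (𝓡 (2 * n)) (𝓡 (2 * n)).tangent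
            (fun q => (⟨q, Y q⟩ : TangentBundle (𝓡 (2 * n)) Q)) p →
          u p (nabla Y p X) = mvfderiv (𝓡 (2 * n)) (fun q => u q (Y q)) p X +
            (((ω₀ : ℂ) * Complex.I) • (1 : Matrix (Fin n) (Fin n) ℂ) +
              φ.map Complex.ofReal).mulVec (u p (Y p))

/-- A connection on `F` without torsion. -/
structure IsTorsionFreeConnection (F : S1GLStructure n Q)
    (nabla : CovariantDerivative (𝓡 (2 * n)) (EuclideanSpace ℝ (Fin (2 * n)))
      (TangentSpace (𝓡 (2 * n)) : Q → Type _)) : Prop extends F.IsConnection nabla where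
  torsion_eq_zero : nabla.torsion = 0

/-- The structure is torsion-free if it admits a connection without torsion. -/
def TorsionFree (F : S1GLStructure n Q) : Prop :=
  ∃ nabla : CovariantDerivative (𝓡 (2 * n)) (EuclideanSpace ℝ (Fin (2 * n)))
    (TangentSpace (𝓡 (2 * n)) : Q → Type _), F.IsTorsionFreeConnection nabla

end S1GLStructure

/-- Smooth vector fields on `Q`. -/
def SmoothVectorField {m : ℕ} {Q : Type*} [TopologicalSpace Q]
    [ChartedSpace (EuclideanSpace ℝ (Fin m)) Q] [IsManifold (𝓡 m) ∞ Q]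
    (X : (q : Q) → TangentSpace (𝓡 m) q) : Prop :=
  ContMDiff (𝓡 m) (𝓡 m).tangent ∞ (fun q => (⟨q, X q⟩ : TangentBundle (𝓡 m) Q))

/-- The curvature `R(X,Y)Z = ∇_X ∇_Y Z - ∇_Y ∇_X Z - ∇_{[X,Y]} Z` of an affine connection,
for smooth vector fields `X`, `Y`, `Z`. -/
def affineCurvature {m : ℕ} {Q : Type*} [TopologicalSpace Q]
    [ChartedSpace (EuclideanSpace ℝ (Fin m)) Q] [IsManifold (𝓡 m) ∞ Q]
    (nabla : CovariantDerivative (𝓡 m) (EuclideanSpace ℝ (Fin m))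
      (TangentSpace (𝓡 m) : Q → Type _))
    (X Y Z : (q : Q) → TangentSpace (𝓡 m) q) (q : Q) : TangentSpace (𝓡 m) q :=
  nabla (fun p => nabla Z p (Y p)) q (X q) - nabla (fun p => nabla Z p (X p)) q (Y q) -
    nabla Z q (VectorField.mlieBracket (𝓡 m) X Y q)

/-- The wedge product of two complex-valued `1`-forms, evaluated on two vectors. -/
def wedge {V : Type*} (α β : V → ℂ) (X Y : V) : ℂ := α X * β Y - α Y * β X

/-- The symbol `ε` with `ε₁₂ = 1 = -ε₂₁` (the indices `1, 2` are `0, 1 : Fin 2`). -/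
def epsilonSymbol (i j : Fin 2) : ℂ := if i < j then 1 else if j < i then -1 else 0

/-- The values at one coframe of the curvature functions `A`, `a`, `b`, `r` in dimension `n = 2`;
`r i j k l` is `r^i_{jkl}`. -/
structure CurvatureCoefficients where
  A : ℂ
  a : ℝ
  b : Fin 2 → Fin 2 → ℝ
  r : Fin 2 → Fin 2 → Fin 2 → Fin 2 → ℝ
  b_symm : ∀ i j, b i j = b j i
  r_symm₁₂ : ∀ i j k l, r i j k l = r i k j l
  r_symm₂₃ : ∀ i j k l, r i j k l = r i j l k

namespace CurvatureCoefficients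

variable {V : Type*}

/-- The `2`-form
`Ω₀ = Im(A ζ¹∧ζ²) + 3a (ζ¹∧ζ̄² - ζ²∧ζ̄¹) - i b_{kl} ζᵏ∧ζ̄ˡ`. -/
def Omega0 (c : CurvatureCoefficients) (ζ : Fin 2 → V → ℂ) (X Y : V) : ℂ :=
  let ζbar : Fin 2 → V → ℂ := fun i X => (starRingEnd ℂ) (ζ i X)
  ((c.A * wedge (ζ 0) (ζ 1) X Y).im : ℂ)
    + 3 * (c.a : ℂ) * (wedge (ζ 0) (ζbar 1) X Y - wedge (ζ 1) (ζbar 0) X Y)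
    - Complex.I * ∑ k, ∑ l, (c.b k l : ℂ) * wedge (ζ k) (ζbar l) X Y

/-- The `2`-forms
`Φⁱⱼ = δⁱⱼ Re(A ζ¹∧ζ²) + b_{jl} (ζⁱ∧ζ̄ˡ + ζ̄ⁱ∧ζˡ) + i (rⁱ_{jkl} + a (ε_{jk} δⁱₗ + ε_{jl} δⁱₖ)) ζᵏ∧ζ̄ˡ`. -/
def Phi (c : CurvatureCoefficients) (ζ : Fin 2 → V → ℂ) (X Y : V) : Matrix (Fin 2) (Fin 2) ℂ :=
  let ζbar : Fin 2 → V → ℂ := fun i X => (starRingEnd ℂ) (ζ i X)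
  let δ : Matrix (Fin 2) (Fin 2) ℂ := 1
  fun i j => δ i j * ((c.A * wedge (ζ 0) (ζ 1) X Y).re : ℂ)
    + ∑ l, (c.b j l : ℂ) * (wedge (ζ i) (ζbar l) X Y + wedge (ζbar i) (ζ l) X Y)
    + Complex.I * ∑ k, ∑ l, ((c.r i j k l : ℂ) +
        (c.a : ℂ) * (epsilonSymbol j k * δ i l + epsilonSymbol j l * δ i k)) *
          wedge (ζ k) (ζbar l) X Y

end CurvatureCoefficients

/-- The functions `A`, `a`, `b`, `r` on the total space of `F` are the curvature functions
of the connection if the second structure equations hold: at every coframe `u` of `F`, the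
curvature form `u R(X,Y) u⁻¹`, whose imaginary part is `Ω₀` times the identity and whose real part
is `Φ`, is given by the expressions above with `ζ = u`. -/
def S1GLStructure.IsCurvatureFunctions {Q : Type*} [TopologicalSpace Q]
    [ChartedSpace (EuclideanSpace ℝ (Fin (2 * 2))) Q] [IsManifold (𝓡 (2 * 2)) ∞ Q]
    (F : S1GLStructure 2 Q)
    (nabla : CovariantDerivative (𝓡 (2 * 2)) (EuclideanSpace ℝ (Fin (2 * 2)))
      (TangentSpace (𝓡 (2 * 2)) : Q → Type _))
    (c : F.Total → CurvatureCoefficients) : Prop :=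
  ∀ (q : Q) (u : F.fibre q) (X Y Z : (p : Q) → TangentSpace (𝓡 (2 * 2)) p),
    SmoothVectorField X → SmoothVectorField Y → SmoothVectorField Z →
    let ζ : Fin 2 → TangentSpace (𝓡 (2 * 2)) q → ℂ := fun i V => (u : CoframeAt 2 q) V i
    (u : CoframeAt 2 q) (affineCurvature nabla X Y Z q) =
      ((Complex.I * (c ⟨q, u⟩).Omega0 ζ (X q) (Y q)) • (1 : Matrix (Fin 2) (Fin 2) ℂ) +
        (c ⟨q, u⟩).Phi ζ (X q) (Y q)).mulVec ((u : CoframeAt 2 q) (Z q))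

end

/-! Over a chart, a local section of the structure becomes a coframe `u`, and a torsion-free
connection becomes a form `iα + φ` with `du + (iα + φ) ∧ u = 0`. The planes of the circle bundle are
`u⁻¹(e^{iθ}ℝⁿ)`, so `(x, θ)` are coordinates on it.

Sufficiency. On this space consider the distribution `Im(e^{-iθ}u) = 0`, `dθ + α = 0`. On it the
structure equation reads `d(e^{-iθ}u) = -φ ∧ e^{-iθ}u`, which is real, so the first equation
contributes no obstruction; the second contributes `dα`. If `dα` vanishes on all planes
`u⁻¹(e^{iθ}ℝⁿ)`, Frobenius gives integral manifolds, and their projections belong to the circle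
bundle (`IsTorsionFreeCoframe.fderiv_annihilator_comm`,
`IsTorsionFreeCoframe.exists_integral_manifold`, `S1GLStructure.exists_submanifold`).

Necessity. On a submanifold with tangent planes `u⁻¹(e^{iθ}ℝⁿ)`, the imaginary part of the structure
equation, after division by the phase, says `(α + dθ) ∧ x = 0` for a real coframe `x`. For `n ≥ 2`
this forces `α = -dθ`, so `dα` vanishes on the tangent planes
(`IsTorsionFreeCoframe.fderiv_comm_of_immersion`, `S1GLStructure.Belongs.fderiv_comm`).

It remains to know `dα`, the imaginary part of the curvature. For `n > 2`, the first Bianchi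
identity on three independent vectors of one plane already gives `dα = 0` there
(`IsTorsionFreeCoframe.extDeriv₁_eq_zero`). For `n = 2`, the Bianchi identity is a linear system
whose solutions are exactly the stated expressions in `A`, `a`, `b`, `r`
(`CurvatureCoefficients.exists_of_bianchi`, `CurvatureCoefficients.eq_of_curvatureMatrix_eq`).
Restricted to `e^{iθ}ℝ²`, `Ω₀` is `Im(A e^{2iθ}) + 6a` times the area form, which vanishes for all
`θ` exactly when `A = 0` and `a = 0` (`CurvatureCoefficients.omega0_eq_zero_iff`).

The Frobenius theorem is obtained from the flow: solutions of `y' = X(y)ξ` depend smoothly on `ξ` by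
the inverse function theorem in `C([0,1], V)`, and the time-one map parametrizes the integral
manifold. -/

noncomputable section

/-! ### Smoothness of composition operators on spaces of continuous functions. -/

section Nemytskii

variable {K : Type*} [TopologicalSpace K] [CompactSpace K]
variable {V W : Type} [NormedAddCommGroup V] [NormedSpace ℝ V]
  [NormedAddCommGroup W] [NormedSpace ℝ W]

/-- Pointwise application `C(K, V →L W) → C(K, V) → C(K, W)` as a bounded bilinear map. -/
def ContinuousMap.clmApply :
    C(K, V →L[ℝ] W) →L[ℝ] C(K, V) →L[ℝ] C(K, W) :=
  LinearMap.mkContinuous₂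
    (LinearMap.mk₂ ℝ (fun (A : C(K, V →L[ℝ] W)) (h : C(K, V)) =>
        (⟨fun k => A k (h k), by fun_prop⟩ : C(K, W)))
      (fun _ _ _ => by ext; simp) (fun _ _ _ => by ext; simp)
      (fun _ _ _ => by ext; simp) (fun _ _ _ => by ext; simp)) 1
    (fun A h => by
      refine (ContinuousMap.norm_le _ (by positivity)).2 fun k => ?_
      rw [one_mul]
      exact (A k).le_of_opNorm_le_of_le (A.norm_coe_le_norm k) (h.norm_coe_le_norm k))

@[simp]
lemma ContinuousMap.clmApply_apply (A : C(K, V →L[ℝ] W)) (h : C(K, V)) (k : K) :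
    ContinuousMap.clmApply A h k = A k (h k) := rfl

/-- Composition with a `C¹` function is differentiable on spaces of continuous functions. -/
lemma ContinuousMap.hasFDerivAt_comp (f : C(V, W)) (f' : C(V, V →L[ℝ] W))
    (hf : ∀ x, HasFDerivAt f (f' x) x) (y : C(K, V)) :
    HasFDerivAt (fun y : C(K, V) => f.comp y) (ContinuousMap.clmApply (f'.comp y)) y := by
  rw [hasFDerivAt_iff_isLittleO_nhds_zero, Asymptotics.isLittleO_iff]
  intro ε hε
  have hc : Continuous fun y : C(K, V) => f'.comp y := ContinuousMap.continuous_postcomp f'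
  obtain ⟨δ, hδ, hδ'⟩ := (Metric.continuous_iff (α := C(K, V)) (β := C(K, V →L[ℝ] W))).1 hc y ε hε
  filter_upwards [Metric.ball_mem_nhds (0 : C(K, V)) hδ] with h hh
  rw [mem_ball_zero_iff] at hh
  refine (ContinuousMap.norm_le _ (by positivity)).2 fun k => ?_
  have hball : ∀ z ∈ Metric.ball (y k) δ, ‖f' z - f' (y k)‖ ≤ ε := by
    intro z hz
    -- Perturbing `y` by a constant function turns sup-norm continuity of `f' ∘ ·` into a modulus of
    -- continuity at `y k` that is uniform in `k`.
    have h1 := hδ' (y + ContinuousMap.const K (z - y k)) (by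
      rw [dist_eq_norm, add_sub_cancel_left]
      refine (ContinuousMap.norm_lt_iff _ hδ).2 fun _ => ?_
      simpa [dist_eq_norm] using hz)
    have h2 := ((f'.comp (y + ContinuousMap.const K (z - y k))) -
      (f'.comp y)).norm_coe_le_norm k
    have h3 := h2.trans (lt_of_eq_of_lt (dist_eq_norm _ _).symm h1).le
    simpa using h3
  have hk : ‖h k‖ < δ := (h.norm_coe_le_norm k).trans_lt hh
  have := (convex_ball (y k) δ).norm_image_sub_le_of_norm_hasFDerivWithin_le'
    (f := f) (f' := f') (φ := f' (y k)) (C := ε) (x := y k) (y := y k + h k)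
    (fun x _ => (hf x).hasFDerivWithinAt) hball (Metric.mem_ball_self hδ)
    (by simpa [dist_eq_norm] using hk)
  simp only [add_sub_cancel_left] at this
  refine le_trans ?_ (this.trans (mul_le_mul_of_nonneg_left (h.norm_coe_le_norm k) hε.le))
  simp

/-- The derivative of composition with `f` is a bounded linear map applied to composition with
`fderiv ℝ f`, so induction on the order closes up. The target `W` must vary, since `fderiv ℝ f`
takes values in `V →L[ℝ] W`. -/
lemma ContinuousMap.contDiff_comp_nat (n : ℕ) : ∀ {W : Type} [NormedAddCommGroup W]
    [NormedSpace ℝ W] (f : C(V, W)), ContDiff ℝ n f →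
    ContDiff ℝ n (fun y : C(K, V) => f.comp y) := by
  induction n with
  | zero =>
    intro W _ _ f _
    exact contDiff_zero.2 (ContinuousMap.continuous_postcomp f)
  | succ n ih =>
    intro W _ _ f hf
    have h1 : ContDiff ℝ n (fderiv ℝ f) := hf.fderiv_right (by norm_cast)
    have hd : Differentiable ℝ f := hf.differentiable (by simp)
    have h2 := ContinuousMap.hasFDerivAt_comp (K := K) f ⟨fderiv ℝ f, h1.continuous⟩
      (fun x => (hd x).hasFDerivAt)
    push_cast
    rw [contDiff_succ_iff_fderiv]
    refine ⟨fun y => (h2 y).differentiableAt, by simp, ?_⟩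
    rw [show fderiv ℝ (fun y : C(K, V) => f.comp y) = fun y => _ from
      funext fun y => (h2 y).fderiv]
    exact ContinuousMap.clmApply.contDiff.comp (ih ⟨fderiv ℝ f, h1.continuous⟩ h1)

/-- Composition with a smooth function is smooth on spaces of continuous functions. -/
lemma ContinuousMap.contDiff_comp (f : C(V, W)) (hf : ContDiff ℝ ∞ f) :
    ContDiff ℝ ∞ (fun y : C(K, V) => f.comp y) :=
  contDiff_infty.2 fun n => ContinuousMap.contDiff_comp_nat n f (hf.of_le (by exact_mod_cast le_top))

end Nemytskii

/-! ### The primitive as a bounded operator on continuous functions. -/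

section Integration

variable {V : Type} [NormedAddCommGroup V] [NormedSpace ℝ V]

/-- A continuous function on `[0, 1]`, extended by constants. -/
def ContinuousMap.unitExtend (z : C(unitInterval, V)) (t : ℝ) : V :=
  z (Set.projIcc 0 1 zero_le_one t)

omit [NormedSpace ℝ V] in
lemma ContinuousMap.continuous_unitExtend (z : C(unitInterval, V)) : Continuous z.unitExtend :=
  z.continuous.comp continuous_projIcc

omit [NormedSpace ℝ V] in
lemma ContinuousMap.unitExtend_coe (z : C(unitInterval, V)) (t : unitInterval) :
    z.unitExtend t = z t := by
  simp [ContinuousMap.unitExtend]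

variable [CompleteSpace V]

lemma ContinuousMap.hasDerivAt_integral_unitExtend (z : C(unitInterval, V)) (t : ℝ) :
    HasDerivAt (fun t => ∫ s in (0 : ℝ)..t, z.unitExtend s) (z.unitExtend t) t :=
  intervalIntegral.integral_hasDerivAt_right (z.continuous_unitExtend.intervalIntegrable _ _)
    (z.continuous_unitExtend.stronglyMeasurableAtFilter _ _) z.continuous_unitExtend.continuousAt

/-- The primitive vanishing at `0` of a continuous function on `[0, 1]`. -/
def ContinuousMap.primitive : C(unitInterval, V) →L[ℝ] C(unitInterval, V) :=
  LinearMap.mkContinuous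
    { toFun := fun z => ⟨fun t => ∫ s in (0 : ℝ)..t, z.unitExtend s, by
        have : Continuous fun t : ℝ => ∫ s in (0 : ℝ)..t, z.unitExtend s :=
          continuous_iff_continuousAt.2 fun t =>
            (z.hasDerivAt_integral_unitExtend t).continuousAt
        exact this.comp continuous_subtype_val⟩
      map_add' := fun z w => by
        ext t
        exact intervalIntegral.integral_add (z.continuous_unitExtend.intervalIntegrable _ _)
          (w.continuous_unitExtend.intervalIntegrable _ _)
      map_smul' := fun c z => by
        ext t
        exact intervalIntegral.integral_smul c _ } 1
    (fun z => by
      refine (ContinuousMap.norm_le _ (by positivity)).2 fun t => ?_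
      have := intervalIntegral.norm_integral_le_of_norm_le_const (a := (0 : ℝ)) (b := t)
        (f := z.unitExtend) (C := ‖z‖) (fun s _ => z.norm_coe_le_norm _)
      refine this.trans ?_
      rw [one_mul, sub_zero, abs_of_nonneg t.2.1]
      exact mul_le_of_le_one_right (norm_nonneg _) t.2.2)

lemma ContinuousMap.primitive_apply (z : C(unitInterval, V)) (t : unitInterval) :
    ContinuousMap.primitive z t = ∫ s in (0 : ℝ)..t, z.unitExtend s := rfl

end Integration


/-! ### The inverse function theorem with a smooth inverse on the whole target. -/

section InverseFunction

variable {E F : Type*} [NormedAddCommGroup E] [NormedSpace ℝ E] [CompleteSpace E]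
  [NormedAddCommGroup F] [NormedSpace ℝ F]

/-- The inverse function theorem for smooth functions, on a neighbourhood. -/
lemma exists_openPartialHomeomorph_of_contDiffOn {f : E → F} {s : Set E} (hs : IsOpen s)
    (hf : ContDiffOn ℝ ∞ f s) {a : E} (ha : a ∈ s) {f' : E ≃L[ℝ] F}
    (hf' : HasFDerivAt f (f' : E →L[ℝ] F) a) :
    ∃ Ψ : OpenPartialHomeomorph E F, a ∈ Ψ.source ∧ Ψ.source ⊆ s ∧ (∀ x, Ψ x = f x) ∧
      ContDiffOn ℝ ∞ Ψ.symm Ψ.target := by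
  have hfa : ContDiffAt ℝ ∞ f a := hf.contDiffAt (hs.mem_nhds ha)
  set Ψ₀ := hfa.toOpenPartialHomeomorph f hf' (by simp) with hΨ₀
  -- Invertible operators form an open set. Shrinking the source to the points with invertible
  -- derivative makes the inverse smooth everywhere on its target, not only at the image of `a`.
  set o := s ∩ fderiv ℝ f ⁻¹' Set.range ((↑) : (E ≃L[ℝ] F) → E →L[ℝ] F) with hodef
  have ho : IsOpen o :=
    (hf.continuousOn_fderiv_of_isOpen hs (by simp)).isOpen_inter_preimage hs
      ContinuousLinearEquiv.isOpen
  refine ⟨Ψ₀.restr o, ?_, ?_, fun x => rfl, ?_⟩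
  · exact ⟨hfa.mem_toOpenPartialHomeomorph_source hf' (by simp),
      by rw [ho.interior_eq]; exact ⟨ha, f', by rw [hf'.fderiv]⟩⟩
  · intro x hx
    have := hx.2
    rw [ho.interior_eq] at this
    exact this.1
  · intro y hy
    have hx := (Ψ₀.restr o).map_target hy
    have h2 := hx.2
    rw [ho.interior_eq] at h2
    obtain ⟨h2, e, he⟩ := h2
    have hd : HasFDerivAt f (e : E →L[ℝ] F) ((Ψ₀.restr o).symm y) := by
      rw [he]
      exact ((hf.differentiableOn (by simp)).differentiableAt (hs.mem_nhds h2)).hasFDerivAt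
    exact ((Ψ₀.restr o).contDiffAt_symm hy hd
      (hf.contDiffAt (hs.mem_nhds h2))).contDiffWithinAt

end InverseFunction

/-! ### Smooth dependence of solutions on the parameter. -/

section Flow

variable {V Ξ : Type} [NormedAddCommGroup V] [NormedSpace ℝ V] [CompleteSpace V]
  [NormedAddCommGroup Ξ] [NormedSpace ℝ Ξ] [CompleteSpace Ξ]

/-- The family of initial value problems `y' = X(y) ξ`, `y(0) = y₀` has solutions on `[0, 1]`
depending smoothly on `ξ` near `0`. -/
lemma exists_smooth_solutions (X : C(V, Ξ →L[ℝ] V)) (hX : ContDiff ℝ ∞ X) (y₀ : V) :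
    ∃ (Y : Ξ → C(unitInterval, V)) (B : Set Ξ), IsOpen B ∧ (0 : Ξ) ∈ B ∧ ContDiffOn ℝ ∞ Y B ∧
      Y 0 = ContinuousMap.const _ y₀ ∧ ∀ ξ ∈ B, Y ξ = ContinuousMap.const _ y₀ +
        ContinuousMap.primitive (ContinuousMap.clmApply (X.comp (Y ξ))
          (ContinuousMap.const _ ξ)) := by
  let cst : Ξ →L[ℝ] C(unitInterval, Ξ) := ContinuousLinearMap.const ℝ unitInterval
  -- The zeros of `G` are the solutions of the integral equation.
  let G : Ξ × C(unitInterval, V) → C(unitInterval, V) := fun p => p.2 -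
    ContinuousMap.const _ y₀ - ContinuousMap.primitive (ContinuousMap.clmApply (X.comp p.2)
      (cst p.1))
  have hN : ContDiff ℝ ∞ fun p : Ξ × C(unitInterval, V) => ContinuousMap.clmApply (X.comp p.2) :=
    ContDiff.comp (g := ContinuousMap.clmApply (K := unitInterval) (V := Ξ) (W := V))
      (by fun_prop) ((ContinuousMap.contDiff_comp X hX).comp contDiff_snd)
  have hG : ContDiff ℝ ∞ G := (contDiff_snd.sub contDiff_const).sub
    (ContDiff.comp (g := ContinuousMap.primitive (V := V)) (by fun_prop)
      (hN.clm_apply (cst.contDiff.comp contDiff_fst)))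
  set p₀ : Ξ × C(unitInterval, V) := (0, ContinuousMap.const _ y₀) with hp₀
  let T : Ξ →L[ℝ] C(unitInterval, V) :=
    ContinuousMap.primitive ∘L ContinuousMap.clmApply (X.comp p₀.2) ∘L cst
  -- At `ξ = 0` the term containing the derivative of `X` is multiplied by `ξ` and drops out. The
  -- derivative of `(ξ, y) ↦ (ξ, G (ξ, y))` is therefore triangular with identities on the diagonal.
  let e : (Ξ × C(unitInterval, V)) ≃L[ℝ] (Ξ × C(unitInterval, V)) :=
    (ContinuousLinearEquiv.refl ℝ Ξ).skewProd (ContinuousLinearEquiv.refl ℝ _) (-T)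
  have hd : HasFDerivAt (fun p => (p.1, G p)) (e : _ →L[ℝ] _) p₀ := by
    have h1 := ((hN.differentiable (by simp)) p₀).hasFDerivAt.clm_apply
      (cst.hasFDerivAt.comp p₀ hasFDerivAt_fst)
    have h2 := (ContinuousMap.primitive (V := V)).hasFDerivAt.comp p₀ h1
    have h3 := hasFDerivAt_fst.prodMk ((hasFDerivAt_snd.sub_const
      (ContinuousMap.const _ y₀)).sub h2)
    refine h3.congr_fderiv ?_
    refine ContinuousLinearMap.ext fun p => ?_
    simp only [Prod.ext_iff]
    refine ⟨rfl, ?_⟩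
    simp [e, T, hp₀, sub_eq_add_neg]
  have hΦ : ContDiff ℝ ∞ fun p => (p.1, G p) := contDiff_fst.prodMk hG
  obtain ⟨Ψ, hΨ₀, -, hΨ, hΨs⟩ := exists_openPartialHomeomorph_of_contDiffOn isOpen_univ
    hΦ.contDiffOn (Set.mem_univ p₀) hd
  have hG₀ : G p₀ = 0 := by simp [G, hp₀]
  have hp₀' : Ψ p₀ = (0, 0) := by rw [hΨ, hG₀]
  refine ⟨fun ξ => (Ψ.symm (ξ, 0)).2, (fun ξ => (ξ, 0)) ⁻¹' Ψ.target,
    Ψ.open_target.preimage (by fun_prop), ?_, ?_, ?_, ?_⟩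
  · rw [Set.mem_preimage, ← hp₀']
    exact Ψ.map_source hΨ₀
  · exact contDiff_snd.comp_contDiffOn (hΨs.comp (by fun_prop) fun ξ hξ => hξ)
  · show (Ψ.symm (0, 0)).2 = _
    rw [← hp₀', Ψ.left_inv hΨ₀]
  · intro ξ hξ
    have h := Ψ.right_inv hξ
    rw [hΨ, Prod.ext_iff] at h
    obtain ⟨h1, h2⟩ := h
    simp only [G] at h1 h2
    rw [sub_sub, sub_eq_zero, h1] at h2
    exact h2

end Flow

/-! ### The Frobenius theorem. -/

section Frobenius

variable {V Ξ W : Type} [NormedAddCommGroup V] [NormedSpace ℝ V]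
  [NormedAddCommGroup Ξ] [NormedSpace ℝ Ξ] [NormedAddCommGroup W] [NormedSpace ℝ W]

/-- If `L` annihilates the distribution spanned by `X` and `dL` vanishes on this distribution, then
the variation of a solution of `y' = X(y) ξ` stays in the distribution. -/
lemma annihilator_variation_eq_zero {S : Set V} (hS : IsOpen S) {X : V → Ξ →L[ℝ] V}
    {L : V → V →L[ℝ] W} {N : V → W →L[ℝ] V} (hX : ContDiffOn ℝ ∞ X S) (hL : ContDiffOn ℝ ∞ L S)
    (hN : ContinuousOn N S) (hLN : ∀ y ∈ S, ∀ u, L y (N y u) = u)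
    (hLX : ∀ y ∈ S, ∀ ξ, L y (X y ξ) = 0)
    (hd : ∀ y ∈ S, ∀ ξ w, L y w = 0 → fderiv ℝ L y (X y ξ) w = fderiv ℝ L y w (X y ξ))
    {ξ η : Ξ} {y w : ℝ → V} (hyS : ∀ t ∈ Set.Icc (0 : ℝ) 1, y t ∈ S)
    (hy : ∀ t ∈ Set.Icc (0 : ℝ) 1, HasDerivAt y (X (y t) ξ) t)
    (hw : ∀ t ∈ Set.Icc (0 : ℝ) 1, HasDerivAt w (X (y t) η + fderiv ℝ X (y t) (w t) ξ) t)
    (hw0 : w 0 = 0) : ∀ t ∈ Set.Icc (0 : ℝ) 1, L (y t) (w t) = 0 := by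
  have hLd : ∀ y ∈ S, HasFDerivAt L (fderiv ℝ L y) y := fun y hy =>
    ((hL.differentiableOn (by simp)).differentiableAt (hS.mem_nhds hy)).hasFDerivAt
  have hXd : ∀ y ∈ S, HasFDerivAt X (fderiv ℝ X y) y := fun y hy =>
    ((hX.differentiableOn (by simp)).differentiableAt (hS.mem_nhds hy)).hasFDerivAt
  -- This is the derivative of `L X = 0`; it trades the derivative of `X` for one of `L`.
  have hprod : ∀ y ∈ S, ∀ v ξ, fderiv ℝ L y v (X y ξ) + L y (fderiv ℝ X y v ξ) = 0 := by
    intro y hy v ξ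
    have h1 := (hLd y hy).clm_apply ((hXd y hy).clm_apply (hasFDerivAt_const ξ y))
    have h2 : HasFDerivAt (fun y => L y (X y ξ)) (0 : V →L[ℝ] W) y :=
      (hasFDerivAt_const (0 : W) y).congr_of_eventuallyEq
        (by filter_upwards [hS.mem_nhds hy] with z hz using hLX z hz ξ)
    have h3 := congrArg (fun l => l v) (h1.unique h2)
    simpa [add_comm] using h3
  -- The derivative of `L w` along the curve is the antisymmetrized `dL(X ξ, w)`. Replacing `w` by
  -- `w - N L w`, which lies in the kernel of `L`, shows that only `N L w` contributes. Hence `h = L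
  -- w` solves the linear equation `h' = B h` with `h 0 = 0`, and vanishes by Grönwall.
  let B : V → W →L[ℝ] W := fun y => (fderiv ℝ L y (X y ξ)) ∘L N y -
    ((fderiv ℝ L y).flip (X y ξ)) ∘L N y
  have hLc : ContinuousOn (fderiv ℝ L) S := hL.continuousOn_fderiv_of_isOpen hS (by simp)
  have hXc : ContinuousOn (fun y => X y ξ) S := hX.continuousOn.clm_apply continuousOn_const
  have hB : ContinuousOn B S := by
    refine ((hLc.clm_apply hXc).clm_comp hN).sub (ContinuousOn.clm_comp ?_ hN)
    exact (((ContinuousLinearMap.flipₗᵢ ℝ V V W).continuous.comp_continuousOn hLc).clm_apply hXc)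
  have hyc : ContinuousOn y (Set.Icc 0 1) := fun t ht =>
    (hy t ht).continuousAt.continuousWithinAt
  obtain ⟨M, hM⟩ := isCompact_Icc.exists_bound_of_continuousOn (hB.comp hyc hyS)
  have hh : ∀ t ∈ Set.Icc (0 : ℝ) 1,
      HasDerivAt (fun t => L (y t) (w t)) (B (y t) (L (y t) (w t))) t := by
    intro t ht
    have h1 := ((hLd _ (hyS t ht)).comp_hasDerivAt t (hy t ht)).clm_apply (hw t ht)
    refine h1.congr_deriv ?_
    have h2 := hprod _ (hyS t ht) (w t) ξ
    have h3 := hd _ (hyS t ht) ξ (w t - N (y t) (L (y t) (w t)))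
      (by rw [map_sub, hLN _ (hyS t ht), sub_self])
    simp only [map_sub, sub_apply] at h3
    simp only [map_add, hLX _ (hyS t ht), zero_add, B, sub_apply,
      ContinuousLinearMap.comp_apply, ContinuousLinearMap.flip_apply, Function.comp_apply]
    rw [eq_neg_of_add_eq_zero_right h2, ← sub_eq_add_neg]
    rw [sub_eq_sub_iff_add_eq_add, add_comm] at h3 ⊢
    rw [h3, add_comm]
  refine eq_zero_of_abs_deriv_le_mul_abs_self_of_eq_zero_right (K := M)
    (f' := fun t => B (y t) (L (y t) (w t)))
    (fun t ht => (hh t ht).continuousAt.continuousWithinAt)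
    (fun t ht => (hh t (Set.Ico_subset_Icc_self ht)).hasDerivWithinAt) (by simp [hw0])
    (fun t ht => (B (y t)).le_of_opNorm_le (hM t (Set.Ico_subset_Icc_self ht)) _)

/-- A smooth function on an open set agrees near a given point with a globally smooth one. -/
lemma exists_contDiff_eqOn_ball [FiniteDimensional ℝ V] {S : Set V} (hS : IsOpen S) {f : V → W}
    (hf : ContDiffOn ℝ ∞ f S) {y₀ : V} (hy₀ : y₀ ∈ S) :
    ∃ (g : V → W) (r : ℝ), 0 < r ∧ ContDiff ℝ ∞ g ∧ Metric.ball y₀ r ⊆ S ∧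
      Set.EqOn g f (Metric.ball y₀ r) := by
  obtain ⟨R, hR, hRS⟩ := Metric.isOpen_iff.1 hS y₀ hy₀
  let χ : ContDiffBump y₀ := ⟨R / 4, R / 2, by positivity, by linarith⟩
  refine ⟨fun y => χ y • f y, R / 4, by positivity, ?_, ?_, ?_⟩
  · rw [contDiff_iff_contDiffAt]
    intro y
    by_cases hy : y ∈ S
    · exact χ.contDiff.contDiffAt.smul (hf.contDiffAt (hS.mem_nhds hy))
    · have h : y ∉ tsupport χ := by
        rw [χ.tsupport_eq]
        exact fun h => hy (hRS (Metric.closedBall_subset_ball (by simp only [χ]; linarith) h))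
      refine (contDiffAt_const (c := (0 : W))).congr_of_eventuallyEq ?_
      filter_upwards [(isClosed_tsupport χ).isOpen_compl.mem_nhds h] with z hz
      rw [image_eq_zero_of_notMem_tsupport hz, zero_smul]
  · exact (Metric.ball_subset_ball (by linarith)).trans hRS
  · intro y hy
    simp only
    rw [χ.one_of_mem_closedBall (Metric.ball_subset_closedBall hy), one_smul]

/-- The Frobenius theorem: a distribution spanned by `X` and annihilated by `L` with `dL = 0` on the
distribution has integral manifolds. -/
theorem exists_integral_manifold [FiniteDimensional ℝ V] [CompleteSpace Ξ]
    {S : Set V} (hS : IsOpen S) {X : V → Ξ →L[ℝ] V}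
    {L : V → V →L[ℝ] W} {N : V → W →L[ℝ] V} (hX : ContDiffOn ℝ ∞ X S) (hL : ContDiffOn ℝ ∞ L S)
    (hN : ContinuousOn N S) (hLN : ∀ y ∈ S, ∀ u, L y (N y u) = u)
    (hLX : ∀ y ∈ S, ∀ ξ, L y (X y ξ) = 0)
    (hd : ∀ y ∈ S, ∀ ξ w, L y w = 0 → fderiv ℝ L y (X y ξ) w = fderiv ℝ L y w (X y ξ))
    {y₀ : V} (hy₀ : y₀ ∈ S) :
    ∃ (g : Ξ → V) (B : Set Ξ), IsOpen B ∧ (0 : Ξ) ∈ B ∧ ContDiffOn ℝ ∞ g B ∧ Set.MapsTo g B S ∧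
      g 0 = y₀ ∧ fderiv ℝ g 0 = X y₀ ∧ ∀ ξ ∈ B, ∀ η, L (g ξ) (fderiv ℝ g ξ η) = 0 := by
  have : CompleteSpace V := FiniteDimensional.complete ℝ V
  -- The cut-off is needed because the composition operator is defined on all of `C([0,1], V)`. The
  -- set `O` below retains the curves lying in the ball where `X'` agrees with `X`.
  obtain ⟨X', r, hr, hX', hrS, hXX'⟩ := exists_contDiff_eqOn_ball hS hX hy₀
  obtain ⟨Y, B, hBo, h0B, hY, hY0, hYeq⟩ :=
    exists_smooth_solutions ⟨X', hX'.continuous⟩ hX' y₀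
  set XC : C(V, Ξ →L[ℝ] V) := ⟨X', hX'.continuous⟩ with hXC
  have hX'1 : ContDiff ℝ ∞ (fderiv ℝ X') := hX'.fderiv_right (by simp)
  set XD : C(V, V →L[ℝ] Ξ →L[ℝ] V) := ⟨fderiv ℝ X', hX'1.continuous⟩ with hXD
  let O : Set C(unitInterval, V) := {z | Set.MapsTo z Set.univ (Metric.ball y₀ r)}
  have hO : IsOpen O := ContinuousMap.isOpen_setOfPred_mapsTo isCompact_univ Metric.isOpen_ball
  let ev : C(unitInterval, V) →L[ℝ] V := ContinuousMap.evalCLM ℝ 1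
  let B' := B ∩ Y ⁻¹' O
  have hB'o : IsOpen B' := hY.continuousOn.isOpen_inter_preimage hBo hO
  have hYd : ∀ ξ ∈ B, HasFDerivAt Y (fderiv ℝ Y ξ) ξ := fun ξ hξ =>
    ((hY.differentiableOn (by simp)).differentiableAt (hBo.mem_nhds hξ)).hasFDerivAt
  let cst : Ξ →L[ℝ] C(unitInterval, Ξ) := ContinuousLinearMap.const ℝ unitInterval
  -- The variational equation in integrated form, from differentiating the fixed-point equation for
  -- `Y` in the parameter.
  have hvar : ∀ ξ ∈ B, ∀ η, fderiv ℝ Y ξ η = ContinuousMap.primitive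
      (ContinuousMap.clmApply (XC.comp (Y ξ)) (cst η) + ContinuousMap.clmApply
        (ContinuousMap.clmApply (XD.comp (Y ξ)) (fderiv ℝ Y ξ η)) (cst ξ)) := by
    intro ξ hξ η
    have h1 : HasFDerivAt (fun y : C(unitInterval, V) => XC.comp y)
        (ContinuousMap.clmApply (XD.comp (Y ξ))) (Y ξ) :=
      ContinuousMap.hasFDerivAt_comp XC XD
        (fun x => ((hX'.differentiable (by simp)) x).hasFDerivAt) (Y ξ)
    have h2 := HasFDerivAt.comp
      (g := fun A => ContinuousMap.clmApply (K := unitInterval) (V := Ξ) (W := V) A) ξ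
      (by apply ContinuousLinearMap.hasFDerivAt) (h1.comp ξ (hYd ξ hξ))
    have h3 := (ContinuousMap.primitive (V := V)).hasFDerivAt.comp ξ
      (h2.clm_apply (cst.hasFDerivAt (x := ξ)))
    have h4 := (hYd ξ hξ).unique ((h3.const_add (ContinuousMap.const _ y₀)).congr_of_eventuallyEq
      (by filter_upwards [hBo.mem_nhds hξ] with ζ hζ using hYeq ζ hζ))
    have h5 := congrArg (fun l => l η) h4
    exact h5
  have hgd : ∀ ξ ∈ B, fderiv ℝ (fun ξ => Y ξ 1) ξ = ev ∘L fderiv ℝ Y ξ := fun ξ hξ =>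
    (ev.hasFDerivAt.comp ξ (hYd ξ hξ)).fderiv
  refine ⟨fun ξ => Y ξ 1, B', hB'o, ⟨h0B, ?_⟩, ?_, fun ξ hξ => hrS (hξ.2 (Set.mem_univ _)),
    by simp [hY0], ?_, ?_⟩
  · simp [O, hY0, Set.MapsTo, hr]
  · exact (ev.contDiff.comp_contDiffOn hY).mono Set.inter_subset_left
  · rw [hgd 0 h0B]
    ext η
    have h := congrArg (fun z : C(unitInterval, V) => z 1) (hvar 0 h0B η)
    simp only [map_zero, add_zero] at h
    refine h.trans ?_
    rw [ContinuousMap.primitive_apply]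
    simp [hY0, cst, ContinuousMap.unitExtend, hXC, hXX' (Metric.mem_ball_self hr)]
  · intro ξ hξ η
    rw [hgd ξ hξ.1]
    set z₁ := ContinuousMap.clmApply (XC.comp (Y ξ)) (cst ξ) with hz₁
    set z₂ := ContinuousMap.clmApply (XC.comp (Y ξ)) (cst η) + ContinuousMap.clmApply
        (ContinuousMap.clmApply (XD.comp (Y ξ)) (fderiv ℝ Y ξ η)) (cst ξ) with hz₂
    let y : ℝ → V := fun t => y₀ + ∫ s in (0 : ℝ)..t, z₁.unitExtend s
    let w : ℝ → V := fun t => ∫ s in (0 : ℝ)..t, z₂.unitExtend s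
    have hyY : ∀ t : unitInterval, y t = Y ξ t := fun t => by
      rw [hYeq ξ hξ.1]; rfl
    have hwY : ∀ t : unitInterval, w t = fderiv ℝ Y ξ η t := fun t => by
      rw [hvar ξ hξ.1 η]; rfl
    have hball : ∀ t : unitInterval, Y ξ t ∈ Metric.ball y₀ r := fun t => hξ.2 (Set.mem_univ t)
    have key := annihilator_variation_eq_zero hS hX hL hN hLN hLX hd (ξ := ξ) (η := η) (y := y)
      (w := w) (fun t ht => by rw [hyY ⟨t, ht⟩]; exact hrS (hball _)) ?_ ?_
      (by simp [w]) 1 (by simp)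
    · have h1 := hyY 1
      have h2 := hwY 1
      simp only [Set.Icc.coe_one] at h1 h2
      rw [h1, h2] at key
      exact key
    · intro t ht
      refine ((z₁.hasDerivAt_integral_unitExtend t).const_add y₀).congr_deriv ?_
      rw [hyY ⟨t, ht⟩, ContinuousMap.unitExtend_coe z₁ ⟨t, ht⟩, ← hXX' (hball _)]
      rfl
    · intro t ht
      refine (z₂.hasDerivAt_integral_unitExtend t).congr_deriv ?_
      rw [hyY ⟨t, ht⟩, hwY ⟨t, ht⟩, ContinuousMap.unitExtend_coe z₂ ⟨t, ht⟩, ← hXX' (hball _),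
        ← (hXX'.eventuallyEq_of_mem (Metric.isOpen_ball.mem_nhds (hball _))).fderiv_eq]
      rfl

end Frobenius

lemma ContDiffOn.clm_prod {V E F G : Type*} [NormedAddCommGroup V] [NormedSpace ℝ V]
    [NormedAddCommGroup E] [NormedSpace ℝ E] [NormedAddCommGroup F] [NormedSpace ℝ F]
    [NormedAddCommGroup G] [NormedSpace ℝ G] {s : Set V} {f : V → E →L[ℝ] F} {g : V → E →L[ℝ] G}
    (hf : ContDiffOn ℝ ∞ f s) (hg : ContDiffOn ℝ ∞ g s) :
    ContDiffOn ℝ ∞ (fun x => (f x).prod (g x)) s :=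
  (((contDiffOn_const (c := ContinuousLinearMap.inl ℝ F G)).clm_comp hf).add
    ((contDiffOn_const (c := ContinuousLinearMap.inr ℝ F G)).clm_comp hg)).congr fun x _ => by
      ext v <;> simp

/-- Derivatives of operator-valued maps are computed below by restricting to a line, evaluating on a
fixed vector, and comparing by uniqueness of the one-variable derivative. -/
lemma HasFDerivAt.hasDerivAt_line_apply {V F G : Type*} [NormedAddCommGroup V] [NormedSpace ℝ V]
    [NormedAddCommGroup F] [NormedSpace ℝ F] [NormedAddCommGroup G] [NormedSpace ℝ G]
    {f : V → F →L[ℝ] G} {f' : V →L[ℝ] F →L[ℝ] G} {y : V} (hf : HasFDerivAt f f' y) (p : V) (q : F) :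
    HasDerivAt (fun t : ℝ => f (y + t • p) q) (f' p q) 0 := by
  have hl : HasDerivAt (fun t : ℝ => y + t • p) p 0 := by
    have := ((hasDerivAt_id (0 : ℝ)).smul_const p).const_add y
    rwa [one_smul] at this
  have h1 : HasFDerivAt f f' (y + (0 : ℝ) • p) := by rwa [zero_smul, add_zero]
  have h2 : HasDerivAt (fun t : ℝ => f (y + t • p)) (f' p) 0 :=
    HasFDerivAt.comp_hasDerivAt (l := f) (0 : ℝ) h1 hl
  refine (h2.clm_apply (hasDerivAt_const 0 q)).congr_deriv ?_
  rw [map_zero, add_zero]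

/-! ### Coframes on a vector space and the distribution on the circle bundle. -/

section LocalModel

variable {n : ℕ} {E : Type} [NormedAddCommGroup E] [NormedSpace ℝ E]

/-- A coframe `u` on an open subset of a vector space, together with the connection forms `i α + φ`
of a torsion-free connection. -/
structure IsTorsionFreeCoframe (O : Set E) (u : E → E →L[ℝ] (Fin n → ℂ)) (α : E → E →L[ℝ] ℝ)
    (φ : Fin n → Fin n → E → E →L[ℝ] ℝ) : Prop where
  isOpen : IsOpen O
  contDiffOn_u : ContDiffOn ℝ ∞ u O
  contDiffOn_α : ContDiffOn ℝ ∞ α O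
  contDiffOn_φ : ∀ i j, ContDiffOn ℝ ∞ (φ i j) O
  isInvertible : ∀ x ∈ O, (u x).IsInvertible
  torsion : ∀ x ∈ O, ∀ v w i, fderiv ℝ u x v w i - fderiv ℝ u x w v i +
    ((α x v * Complex.I) * u x w i + ∑ j, (φ i j x v : ℂ) * u x w j) -
    ((α x w * Complex.I) * u x v i + ∑ j, (φ i j x w : ℂ) * u x v j) = 0

/-- The inclusion `ℝⁿ → ℂⁿ`. -/
def realInclusion (n : ℕ) : EuclideanSpace ℝ (Fin n) →L[ℝ] (Fin n → ℂ) :=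
  ContinuousLinearMap.pi fun i => Complex.ofRealCLM ∘L EuclideanSpace.proj i

@[simp]
lemma realInclusion_apply (x : EuclideanSpace ℝ (Fin n)) (i : Fin n) :
    realInclusion n x i = (x i : ℂ) := rfl

/-- The imaginary part `ℂⁿ → ℝⁿ`. -/
def imPart (n : ℕ) : (Fin n → ℂ) →L[ℝ] EuclideanSpace ℝ (Fin n) :=
  (EuclideanSpace.equiv (Fin n) ℝ).symm.toContinuousLinearMap ∘L
    ContinuousLinearMap.pi fun i => Complex.imCLM ∘L ContinuousLinearMap.proj i

@[simp]
lemma imPart_apply (z : Fin n → ℂ) (i : Fin n) : imPart n z i = (z i).im := rfl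

/-- Multiplication by a complex number as a real linear map of `ℂⁿ`. -/
def complexSMul (n : ℕ) : ℂ →L[ℝ] (Fin n → ℂ) →L[ℝ] (Fin n → ℂ) :=
  ContinuousLinearMap.lsmul ℝ ℂ

@[simp]
lemma complexSMul_apply (c : ℂ) (z : Fin n → ℂ) (i : Fin n) :
    complexSMul n c z i = c * z i := rfl

/-- Undoing the rotation makes the vector real. This presents the plane as the kernel of a real
linear map depending smoothly on `θ`, the form in which it enters `annihilator`. -/
lemma mem_rotatedRealPlane_iff {θ : ℝ} {z : Fin n → ℂ} :
    z ∈ rotatedRealPlane n θ ↔ ∀ i, (Complex.exp (-θ * Complex.I) * z i).im = 0 := by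
  have h : Complex.exp (θ * Complex.I) * Complex.exp (-θ * Complex.I) = 1 := by
    rw [← Complex.exp_add]; simp
  constructor
  · rintro ⟨x, hx⟩ i
    rw [hx, ← mul_assoc, mul_comm (Complex.exp _), h, one_mul, Complex.ofReal_im]
  · intro hz
    refine ⟨fun i => (Complex.exp (-θ * Complex.I) * z i).re, fun i => ?_⟩
    rw [show (((Complex.exp (-θ * Complex.I) * z i).re : ℝ) : ℂ) = Complex.exp (-θ * Complex.I) * z i
      from Complex.ext (by simp) (by rw [hz i]; simp), ← mul_assoc, h, one_mul]

namespace IsTorsionFreeCoframe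

variable {O : Set E} {u : E → E →L[ℝ] (Fin n → ℂ)} {α : E → E →L[ℝ] ℝ}
  {φ : Fin n → Fin n → E → E →L[ℝ] ℝ}

/-- The `1`-form on `E × ℝ` whose kernel is the distribution of the planes
`u⁻¹(e^{iθ} ℝⁿ)`, lifted horizontally. -/
def annihilator (u : E → E →L[ℝ] (Fin n → ℂ)) (α : E → E →L[ℝ] ℝ) (y : E × ℝ) :
    E × ℝ →L[ℝ] EuclideanSpace ℝ (Fin n) × ℝ :=
  (imPart n ∘L complexSMul n (Complex.exp (-(y.2 : ℂ) * Complex.I)) ∘L u y.1 ∘L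
    ContinuousLinearMap.fst ℝ E ℝ).prod
    (ContinuousLinearMap.snd ℝ E ℝ + α y.1 ∘L ContinuousLinearMap.fst ℝ E ℝ)

lemma annihilator_eq_zero_iff {y p : E × ℝ} :
    annihilator u α y p = 0 ↔ u y.1 p.1 ∈ rotatedRealPlane n y.2 ∧ p.2 = - α y.1 p.1 := by
  rw [mem_rotatedRealPlane_iff, Prod.ext_iff, PiLp.ext_iff]
  simp [annihilator, ← eq_neg_iff_add_eq_zero]

lemma contDiff_exp_mul_I (c : ℝ) :
    ContDiff ℝ ∞ fun y : E × ℝ => Complex.exp (c * (y.2 : ℂ) * Complex.I) :=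
  (((contDiff_const.mul (Complex.ofRealCLM.contDiff.comp contDiff_snd))).mul contDiff_const).cexp

lemma contDiffOn_annihilator (h : IsTorsionFreeCoframe O u α φ) :
    ContDiffOn ℝ ∞ (annihilator u α) (O ×ˢ Set.univ) := by
  have hu : ContDiffOn ℝ ∞ (fun y : E × ℝ => u y.1) (O ×ˢ Set.univ) :=
    h.contDiffOn_u.comp contDiff_fst.contDiffOn fun y hy => hy.1
  have hα : ContDiffOn ℝ ∞ (fun y : E × ℝ => α y.1) (O ×ˢ Set.univ) :=
    h.contDiffOn_α.comp contDiff_fst.contDiffOn fun y hy => hy.1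
  have he : ContDiffOn ℝ ∞ (fun y : E × ℝ => complexSMul n (Complex.exp (-(y.2 : ℂ) * Complex.I)))
      (O ×ˢ Set.univ) := by
    refine ((complexSMul n).contDiff.comp ?_).contDiffOn
    simpa using contDiff_exp_mul_I (E := E) (-1)
  have h1 := (contDiffOn_const (c := imPart n)).clm_comp (he.clm_comp (hu.clm_comp
    (contDiffOn_const (c := ContinuousLinearMap.fst ℝ E ℝ))))
  have h2 := (contDiffOn_const (c := ContinuousLinearMap.snd ℝ E ℝ)).add (hα.clm_comp
    (contDiffOn_const (c := ContinuousLinearMap.fst ℝ E ℝ)))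
  exact h1.clm_prod h2

/-- The term with `p.2 * I` comes from differentiating `e^{-iθ}` in `θ`; on the kernel, where `p.2 =
-α`, it becomes the `iα` part of the connection form. -/
lemma fderiv_annihilator_apply (h : IsTorsionFreeCoframe O u α φ) {y : E × ℝ} (hy : y.1 ∈ O)
    (p q : E × ℝ) : fderiv ℝ (annihilator u α) y p q =
      (imPart n (complexSMul n (Complex.exp (-(y.2 : ℂ) * Complex.I))
          (fderiv ℝ u y.1 p.1 q.1 - (p.2 * Complex.I : ℂ) • u y.1 q.1)),
        fderiv ℝ α y.1 p.1 q.1) := by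
  have hud : HasFDerivAt u (fderiv ℝ u y.1) y.1 := ((h.contDiffOn_u.differentiableOn
    (by simp)).differentiableAt (h.isOpen.mem_nhds hy)).hasFDerivAt
  have hαd : HasFDerivAt α (fderiv ℝ α y.1) y.1 := ((h.contDiffOn_α.differentiableOn
    (by simp)).differentiableAt (h.isOpen.mem_nhds hy)).hasFDerivAt
  have hLd : HasFDerivAt (annihilator u α) (fderiv ℝ (annihilator u α) y) y :=
    ((h.contDiffOn_annihilator.differentiableOn (by simp)).differentiableAt
      ((h.isOpen.prod isOpen_univ).mem_nhds ⟨hy, trivial⟩)).hasFDerivAt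
  have hu1 := hud.hasDerivAt_line_apply p.1 q.1
  have hα1 := hαd.hasDerivAt_line_apply p.1 q.1
  have he : HasDerivAt (fun t : ℝ => Complex.exp (-((y.2 + t * p.2 : ℝ) : ℂ) * Complex.I))
      (-(p.2 * Complex.I) * Complex.exp (-(y.2 : ℂ) * Complex.I)) 0 := by
    have h1 : HasDerivAt (fun t : ℝ => y.2 + t * p.2) p.2 0 := by
      simpa using ((hasDerivAt_id (0 : ℝ)).mul_const p.2).const_add y.2
    have h2 := ((h1.ofReal_comp.neg).mul_const Complex.I).cexp
    refine h2.congr_deriv ?_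
    simp
    ring
  have h3 := ((complexSMul n).hasFDerivAt.comp_hasDerivAt (0 : ℝ) he).clm_apply hu1
  have h4 := ((imPart n).hasFDerivAt.comp_hasDerivAt (0 : ℝ) h3).prodMk
    (hα1.const_add q.2)
  refine (hLd.hasDerivAt_line_apply p q).unique (h4.congr_deriv ?_)
  refine congrArg (fun z => (z, _)) (congrArg _ ?_)
  ext i
  simp
  ring

/-- `dL` vanishes on the kernel of the annihilator `L`. -/
lemma fderiv_annihilator_comm (h : IsTorsionFreeCoframe O u α φ)
    (hα : ∀ x ∈ O, ∀ θ v w, u x v ∈ rotatedRealPlane n θ → u x w ∈ rotatedRealPlane n θ →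
      fderiv ℝ α x v w = fderiv ℝ α x w v)
    {y : E × ℝ} (hy : y.1 ∈ O) {p q : E × ℝ} (hp : annihilator u α y p = 0)
    (hq : annihilator u α y q = 0) :
    fderiv ℝ (annihilator u α) y p q = fderiv ℝ (annihilator u α) y q p := by
  rw [annihilator_eq_zero_iff] at hp hq
  rw [h.fderiv_annihilator_apply hy, h.fderiv_annihilator_apply hy]
  refine Prod.ext ?_ (hα _ hy _ _ _ hp.1 hq.1)
  ext i
  have ht := h.torsion _ hy p.1 q.1 i
  rw [mem_rotatedRealPlane_iff] at hp hq
  have hp1 := hp.1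
  have hq1 := hq.1
  simp only [imPart_apply, complexSMul_apply, Pi.sub_apply, Pi.smul_apply, smul_eq_mul, hp.2, hq.2]
  rw [← sub_eq_zero, ← Complex.sub_im]
  set e := Complex.exp (-(y.2 : ℂ) * Complex.I)
  -- The structure equation leaves only the `φ` terms, which are real combinations of the components
  -- of `e u(p)` and `e u(q)`. These are real on the kernel, so the imaginary part vanishes.
  have key : e * (fderiv ℝ u y.1 p.1 q.1 i - (((-α y.1 p.1 : ℝ) : ℂ) * Complex.I) * u y.1 q.1 i) -
      e * (fderiv ℝ u y.1 q.1 p.1 i - (((-α y.1 q.1 : ℝ) : ℂ) * Complex.I) * u y.1 p.1 i) =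
      ∑ j, (φ i j y.1 q.1 : ℂ) * (e * u y.1 p.1 j) -
      ∑ j, (φ i j y.1 p.1 : ℂ) * (e * u y.1 q.1 j) := by
    have h5 : ∀ v w, ∑ j, (φ i j y.1 v : ℂ) * (e * u y.1 w j) =
        e * ∑ j, (φ i j y.1 v : ℂ) * u y.1 w j := fun v w => by
      rw [Finset.mul_sum]
      exact Finset.sum_congr rfl fun j _ => by ring
    rw [h5, h5]
    push_cast
    linear_combination e * ht
  rw [key, Complex.sub_im, Complex.im_sum, Complex.im_sum]
  simp only [Complex.im_ofReal_mul, hp1, hq1, mul_zero, Finset.sum_const_zero, sub_zero]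

/-- If `dα` vanishes on all planes `u⁻¹(e^{iθ} ℝⁿ)`, then the plane `u⁻¹(ℝⁿ)` at a given point is
tangent to an integral manifold. -/
theorem exists_integral_manifold [FiniteDimensional ℝ E] (h : IsTorsionFreeCoframe O u α φ)
    (hα : ∀ x ∈ O, ∀ θ v w, u x v ∈ rotatedRealPlane n θ → u x w ∈ rotatedRealPlane n θ →
      fderiv ℝ α x v w = fderiv ℝ α x w v) {x₀ : E} (hx₀ : x₀ ∈ O) :
    ∃ (g : EuclideanSpace ℝ (Fin n) → E) (B : Set (EuclideanSpace ℝ (Fin n))), IsOpen B ∧ 0 ∈ B ∧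
      ContDiffOn ℝ ∞ g B ∧ Set.MapsTo g B O ∧ g 0 = x₀ ∧
      (∀ ξ, u x₀ (fderiv ℝ g 0 ξ) = realInclusion n ξ) ∧
      ∀ ξ ∈ B, ∃ θ, ∀ η, u (g ξ) (fderiv ℝ g ξ η) ∈ rotatedRealPlane n θ := by
  have : CompleteSpace E := FiniteDimensional.complete ℝ E
  have hinv : ContDiffOn ℝ ∞ (fun y : E × ℝ => (u y.1).inverse) (O ×ˢ Set.univ) := by
    intro y hy
    obtain ⟨e, he⟩ := h.isInvertible _ hy.1
    have h1 : ContDiffAt ℝ ∞ (fun y : E × ℝ => u y.1) y :=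
      (h.contDiffOn_u.contDiffAt (h.isOpen.mem_nhds hy.1)).comp y contDiffAt_fst
    have h2 : ContDiffAt ℝ ∞ ContinuousLinearMap.inverse (u y.1) :=
      he ▸ contDiffAt_map_inverse e
    exact (h2.comp y h1).contDiffWithinAt
  have hαs : ContDiffOn ℝ ∞ (fun y : E × ℝ => α y.1) (O ×ˢ Set.univ) :=
    h.contDiffOn_α.comp contDiff_fst.contDiffOn fun y hy => hy.1
  have he : ContDiffOn ℝ ∞ (fun y : E × ℝ => complexSMul n (Complex.exp ((y.2 : ℂ) * Complex.I)))
      (O ×ˢ Set.univ) := by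
    refine ((complexSMul n).contDiff.comp ?_).contDiffOn
    simpa using contDiff_exp_mul_I (E := E) 1
  have hui : ∀ x ∈ O, ∀ z, u x ((u x).inverse z) = z := fun x hx z => by
    obtain ⟨e, he⟩ := h.isInvertible _ hx
    rw [← he]; simp
  -- The horizontal lift: the vector with coframe value `z`, completed by the component `-α` that
  -- `dθ + α = 0` prescribes.
  set P : E × ℝ → (Fin n → ℂ) →L[ℝ] E × ℝ := fun y => (u y.1).inverse.prod
    (-(α y.1 ∘L (u y.1).inverse)) with hPdef
  have hP : ContDiffOn ℝ ∞ P (O ×ˢ Set.univ) :=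
    hinv.clm_prod (hαs.clm_comp hinv).neg
  have hLP : ∀ y ∈ O ×ˢ Set.univ, ∀ c z, annihilator u α y (P y z + (0, c)) =
      (imPart n (complexSMul n (Complex.exp (-(y.2 : ℂ) * Complex.I)) z), c) := by
    intro y hy c z
    simp [annihilator, P, hui _ hy.1]
  have hexp : ∀ y : E × ℝ,
      Complex.exp (-(y.2 : ℂ) * Complex.I) * Complex.exp (y.2 * Complex.I) = 1 := fun y => by
    rw [← Complex.exp_add]; simp
  let X : E × ℝ → EuclideanSpace ℝ (Fin n) →L[ℝ] E × ℝ := fun y =>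
    P y ∘L complexSMul n (Complex.exp ((y.2 : ℂ) * Complex.I)) ∘L realInclusion n
  -- The lift of `i e^{iθ}ℝⁿ` together with the `θ` direction is complementary to the distribution
  -- and provides a right inverse of the annihilator.
  let N : E × ℝ → EuclideanSpace ℝ (Fin n) × ℝ →L[ℝ] E × ℝ := fun y =>
    P y ∘L complexSMul n (Complex.exp ((y.2 : ℂ) * Complex.I)) ∘L
      complexSMul n Complex.I ∘L realInclusion n ∘L ContinuousLinearMap.fst ℝ _ ℝ +
      ContinuousLinearMap.inr ℝ E ℝ ∘L ContinuousLinearMap.snd ℝ _ ℝ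
  have hLN : ∀ y ∈ O ×ˢ Set.univ, ∀ p, annihilator u α y (N y p) = p := by
    intro y hy p
    refine (hLP y hy p.2 _).trans (Prod.ext ?_ rfl)
    ext i
    change (Complex.exp (-(y.2 : ℂ) * Complex.I) * (Complex.exp (y.2 * Complex.I) *
      (Complex.I * (p.1 i : ℂ)))).im = p.1 i
    rw [← mul_assoc, hexp, one_mul]
    simp
  have hLX : ∀ y ∈ O ×ˢ Set.univ, ∀ ξ, annihilator u α y (X y ξ) = 0 := by
    intro y hy ξ
    have h2 := hLP y hy 0 (complexSMul n (Complex.exp ((y.2 : ℂ) * Complex.I)) (realInclusion n ξ))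
    rw [Prod.mk_zero_zero, add_zero] at h2
    refine h2.trans (Prod.ext ?_ rfl)
    ext i
    rw [imPart_apply, complexSMul_apply, complexSMul_apply, ← mul_assoc, hexp, one_mul]
    simp
  -- Starting at angle `0` loses nothing: every plane of the circle bundle is `u⁻¹(ℝⁿ)` for a
  -- suitable coframe of the structure.
  obtain ⟨g, B, hBo, h0, hg, hgS, hg0, hgd, hgB⟩ := _root_.exists_integral_manifold
    (h.isOpen.prod isOpen_univ) (X := X) (L := annihilator u α) (N := N)
    (hP.clm_comp (he.clm_comp contDiffOn_const)) h.contDiffOn_annihilator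
    ((hP.continuousOn.clm_comp (he.continuousOn.clm_comp continuousOn_const)).add
      continuousOn_const) hLN hLX
    (fun y hy ξ w hw => h.fderiv_annihilator_comm hα hy.1 (hLX y hy ξ) hw)
    (y₀ := (x₀, 0)) ⟨hx₀, trivial⟩
  refine ⟨fun ξ => (g ξ).1, B, hBo, h0, contDiff_fst.comp_contDiffOn hg,
    fun ξ hξ => (hgS hξ).1, congrArg Prod.fst hg0, ?_, ?_⟩
  · intro ξ
    have hgda : DifferentiableAt ℝ g 0 :=
      (hg.differentiableOn (by simp)).differentiableAt (hBo.mem_nhds h0)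
    rw [hgda.hasFDerivAt.fst.fderiv, hgd]
    simp only [ContinuousLinearMap.comp_apply, P, X]
    simp only [ContinuousLinearMap.prod_apply, ContinuousLinearMap.coe_fst', hui _ hx₀]
    ext i
    simp
  · intro ξ hξ
    have hgda : DifferentiableAt ℝ g ξ :=
      (hg.differentiableOn (by simp)).differentiableAt (hBo.mem_nhds hξ)
    refine ⟨(g ξ).2, fun η => ?_⟩
    rw [hgda.hasFDerivAt.fst.fderiv]
    exact (annihilator_eq_zero_iff.1 (hgB ξ hξ η)).1

end IsTorsionFreeCoframe
end LocalModel

/-! ### Closedness of `α` along integral submanifolds. -/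

section Pullback

variable {n : ℕ} {E : Type} [NormedAddCommGroup E] [NormedSpace ℝ E]

/-- A linear form `β` with `β(x) y = β(y) x` vanishes in dimension at least two. -/
lemma eq_zero_of_smul_comm {V : Type*} [AddCommGroup V] [Module ℝ V] (hV : 1 < Module.finrank ℝ V)
    {β : V → ℝ} (h : ∀ x y, β x • y = β y • x) (x : V) : β x = 0 := by
  by_contra hx
  refine absurd (finrank_le_one x fun y => ⟨(β x)⁻¹ * β y, ?_⟩) (not_le.2 hV)
  rw [mul_smul, ← h x y, smul_smul, inv_mul_cancel₀ hx, one_smul]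

lemma HasDerivAt.complex_im {f : ℝ → ℂ} {f' : ℂ} {t : ℝ} (h : HasDerivAt f f' t) :
    HasDerivAt (fun t => (f t).im) f'.im t :=
  Complex.imCLM.hasFDerivAt.comp_hasDerivAt t h

lemma HasFDerivAt.hasDerivAt_line {V F : Type*} [NormedAddCommGroup V] [NormedSpace ℝ V]
    [NormedAddCommGroup F] [NormedSpace ℝ F]
    {f : V → F} {f' : V →L[ℝ] F} {y : V} (hf : HasFDerivAt f f' y) (p : V) :
    HasDerivAt (fun t : ℝ => f (y + t • p)) (f' p) 0 := by
  have hl : HasDerivAt (fun t : ℝ => y + t • p) p 0 := by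
    have := ((hasDerivAt_id (0 : ℝ)).smul_const p).const_add y
    rwa [one_smul] at this
  have h1 : HasFDerivAt f f' (y + (0 : ℝ) • p) := by rwa [zero_smul, add_zero]
  exact HasFDerivAt.comp_hasDerivAt (l := f) (0 : ℝ) h1 hl

lemma eventually_line_mem {V : Type*} [NormedAddCommGroup V] [NormedSpace ℝ V] {B : Set V}
    (hB : IsOpen B) {y : V} (hy : y ∈ B) (p : V) : ∀ᶠ t : ℝ in 𝓝 0, y + t • p ∈ B := by
  have hc : ContinuousAt (fun t : ℝ => y + t • p) 0 := by fun_prop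
  exact hc.eventually_mem (by rw [zero_smul, add_zero]; exact hB.mem_nhds hy)

lemma ContDiffAt.fderiv_fderiv_comm {V F : Type*} [NormedAddCommGroup V] [NormedSpace ℝ V]
    [NormedAddCommGroup F] [NormedSpace ℝ F] {f : V → F} {x : V} (hf : ContDiffAt ℝ ∞ f x)
    (v w : V) : fderiv ℝ (fderiv ℝ f) x v w = fderiv ℝ (fderiv ℝ f) x w v :=
  (hf.isSymmSndFDerivAt (by
    rw [minSmoothness_of_isRCLikeNormedField]
    exact WithTop.coe_le_coe.2 (le_top : (2 : ℕ∞) ≤ ⊤))) v w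

/-- The second derivative of a logarithm is symmetric. -/
lemma symm_fderiv_of_eq_im_div {V : Type*} [NormedAddCommGroup V] [NormedSpace ℝ V]
    {B : Set V} (hB : IsOpen B) {m : V → ℂ} (hm : ContDiffOn ℝ ∞ m B) (hm0 : ∀ x ∈ B, m x ≠ 0)
    {γ : V → V →L[ℝ] ℝ} (hγd : ContDiffOn ℝ ∞ γ B)
    (hγ : ∀ x ∈ B, ∀ v, γ x v = -(fderiv ℝ m x v / m x).im) {x : V} (hx : x ∈ B) (v w : V) :
    fderiv ℝ γ x v w = fderiv ℝ γ x w v := by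
  have hmd : HasFDerivAt m (fderiv ℝ m x) x := ((hm.differentiableOn
    (by simp)).differentiableAt (hB.mem_nhds hx)).hasFDerivAt
  have hm1 : ContDiffOn ℝ ∞ (fderiv ℝ m) B := hm.fderiv_of_isOpen hB (by simp)
  have hmd2 : HasFDerivAt (fderiv ℝ m) (fderiv ℝ (fderiv ℝ m) x) x := ((hm1.differentiableOn
    (by simp)).differentiableAt (hB.mem_nhds hx)).hasFDerivAt
  have hγd1 : HasFDerivAt γ (fderiv ℝ γ x) x := ((hγd.differentiableOn
    (by simp)).differentiableAt (hB.mem_nhds hx)).hasFDerivAt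
  have hsymm : fderiv ℝ (fderiv ℝ m) x v w = fderiv ℝ (fderiv ℝ m) x w v :=
    (hm.contDiffAt (hB.mem_nhds hx)).fderiv_fderiv_comm v w
  -- Differentiating the quotient avoids choosing a branch of the logarithm: the right-hand side is
  -- visibly symmetric in `v` and `w`.
  have key : ∀ v w, fderiv ℝ γ x v w = -((fderiv ℝ (fderiv ℝ m) x v w * m x -
      fderiv ℝ m x w * fderiv ℝ m x v) / m x ^ 2).im := by
    intro v w
    have h1 := (hmd2.hasDerivAt_line_apply v w).div (hmd.hasDerivAt_line v)
      (by simpa using hm0 x hx)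
    simp only [zero_smul, add_zero] at h1
    refine (hγd1.hasDerivAt_line_apply v w).unique (h1.complex_im.neg.congr_of_eventuallyEq ?_)
    filter_upwards [eventually_line_mem hB hx v] with t ht
    exact hγ _ ht w
  rw [key, key, hsymm, mul_comm (fderiv ℝ m x w)]

namespace IsTorsionFreeCoframe

variable {O : Set E} {u : E → E →L[ℝ] (Fin n → ℂ)} {α : E → E →L[ℝ] ℝ}
  {φ : Fin n → Fin n → E → E →L[ℝ] ℝ}

/-- The exterior derivative of `α` vanishes on the tangent planes of an immersion whose tangent
planes are of the form `u⁻¹(e^{iθ} ℝⁿ)`. -/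
theorem fderiv_comm_of_immersion (h : IsTorsionFreeCoframe O u α φ) (hn : 1 < n)
    {g : EuclideanSpace ℝ (Fin n) → E} {B : Set (EuclideanSpace ℝ (Fin n))} (hB : IsOpen B)
    (hg : ContDiffOn ℝ ∞ g B) (hgO : Set.MapsTo g B O)
    (hgi : ∀ ξ ∈ B, Function.Injective (fderiv ℝ g ξ))
    (hgu : ∀ ξ ∈ B, ∃ θ, ∀ η, u (g ξ) (fderiv ℝ g ξ η) ∈ rotatedRealPlane n θ)
    {ξ : EuclideanSpace ℝ (Fin n)} (hξ : ξ ∈ B) (v w : EuclideanSpace ℝ (Fin n)) :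
    fderiv ℝ α (g ξ) (fderiv ℝ g ξ v) (fderiv ℝ g ξ w) =
      fderiv ℝ α (g ξ) (fderiv ℝ g ξ w) (fderiv ℝ g ξ v) := by
  have hg1 : ContDiffOn ℝ ∞ (fderiv ℝ g) B := hg.fderiv_of_isOpen hB (by simp)
  let M : EuclideanSpace ℝ (Fin n) → EuclideanSpace ℝ (Fin n) →L[ℝ] (Fin n → ℂ) := fun ξ =>
    u (g ξ) ∘L fderiv ℝ g ξ
  have hM : ContDiffOn ℝ ∞ M B := (h.contDiffOn_u.comp hg hgO).clm_comp hg1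
  have hMi : ∀ ξ ∈ B, Function.Injective (M ξ) := fun ξ hξ => by
    obtain ⟨e, he⟩ := h.isInvertible _ (hgO hξ)
    have hu : Function.Injective (u (g ξ)) := by rw [← he]; exact e.injective
    exact hu.comp (hgi ξ hξ)
  have hgd : ∀ ξ ∈ B, HasFDerivAt g (fderiv ℝ g ξ) ξ := fun ξ hξ => ((hg.differentiableOn
    (by simp)).differentiableAt (hB.mem_nhds hξ)).hasFDerivAt
  have hgd2 : ∀ ξ ∈ B, HasFDerivAt (fderiv ℝ g) (fderiv ℝ (fderiv ℝ g) ξ) ξ := fun ξ hξ =>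
    ((hg1.differentiableOn (by simp)).differentiableAt (hB.mem_nhds hξ)).hasFDerivAt
  have hMd : ∀ ξ ∈ B, HasFDerivAt M (fderiv ℝ M ξ) ξ := fun ξ hξ => ((hM.differentiableOn
    (by simp)).differentiableAt (hB.mem_nhds hξ)).hasFDerivAt
  have hsymm : ∀ ξ ∈ B, ∀ v w, fderiv ℝ (fderiv ℝ g) ξ v w = fderiv ℝ (fderiv ℝ g) ξ w v :=
    fun ξ hξ v w => (hg.contDiffAt (hB.mem_nhds hξ)).fderiv_fderiv_comm v w
  have hud : ∀ x ∈ O, HasFDerivAt u (fderiv ℝ u x) x := fun x hx => ((h.contDiffOn_u.differentiableOn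
    (by simp)).differentiableAt (h.isOpen.mem_nhds hx)).hasFDerivAt
  have hαd : ∀ x ∈ O, HasFDerivAt α (fderiv ℝ α x) x := fun x hx => ((h.contDiffOn_α.differentiableOn
    (by simp)).differentiableAt (h.isOpen.mem_nhds hx)).hasFDerivAt
  have hMder : ∀ ξ ∈ B, ∀ v w, fderiv ℝ M ξ v w =
      fderiv ℝ u (g ξ) (fderiv ℝ g ξ v) (fderiv ℝ g ξ w) +
        u (g ξ) (fderiv ℝ (fderiv ℝ g) ξ v w) := by
    intro ξ hξ v w
    have h1 := (((hud _ (hgO hξ)).comp ξ (hgd ξ hξ)).clm_comp (hgd2 ξ hξ))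
    rw [show fderiv ℝ M ξ = _ from h1.fderiv]
    simp [add_comm]
  -- a nonvanishing entry of `M`
  have : Nontrivial (EuclideanSpace ℝ (Fin n)) :=
    Module.nontrivial_of_finrank_pos (R := ℝ) (by simp; omega)
  obtain ⟨η₀, hη₀⟩ := exists_ne (0 : EuclideanSpace ℝ (Fin n))
  obtain ⟨i, hi⟩ : ∃ i, M ξ η₀ i ≠ 0 := by
    by_contra! hc
    exact hη₀ (hMi ξ hξ (by rw [map_zero]; exact funext hc))
  let m : EuclideanSpace ℝ (Fin n) → ℂ := fun ξ => M ξ η₀ i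
  have hm : ContDiffOn ℝ ∞ m B :=
    (ContinuousLinearMap.proj (R := ℝ) (φ := fun _ : Fin n => ℂ) i).contDiff.comp_contDiffOn
      (hM.clm_apply contDiffOn_const)
  let B' := B ∩ m ⁻¹' {0}ᶜ
  have hB' : IsOpen B' := hm.continuousOn.isOpen_inter_preimage hB isOpen_compl_singleton
  -- The angle `θ` exists pointwise, with no smoothness known. Dividing by the smooth function `m`,
  -- whose phase is `θ` modulo `π`, removes it.
  have hreal : ∀ ξ ∈ B', ∀ v j, (M ξ v j / m ξ).im = 0 := by
    intro ξ hξ v j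
    obtain ⟨θ, hθ⟩ := hgu ξ hξ.1
    obtain ⟨x, hx⟩ := hθ v
    obtain ⟨y, hy⟩ := hθ η₀
    have h1 : M ξ v j = Complex.exp (θ * Complex.I) * (x j : ℂ) := hx j
    have h2 : m ξ = Complex.exp (θ * Complex.I) * (y i : ℂ) := hy i
    rw [h1, h2, mul_div_mul_left _ _ (Complex.exp_ne_zero _), ← Complex.ofReal_div,
      Complex.ofReal_im]
  -- The derivative of a real quotient is real; this is its imaginary part, rearranged.
  have hmM : ∀ ξ ∈ B', ∀ v w j, (fderiv ℝ M ξ v w j / m ξ).im =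
      (M ξ w j / m ξ).re * (fderiv ℝ m ξ v / m ξ).im := by
    intro ξ hξ v w j
    have hne : m ξ ≠ 0 := hξ.2
    have hmd : HasFDerivAt m (fderiv ℝ m ξ) ξ := ((hm.differentiableOn
      (by simp)).differentiableAt (hB.mem_nhds hξ.1)).hasFDerivAt
    have h1 := hasDerivAt_pi.1 ((hMd ξ hξ.1).hasDerivAt_line_apply v w) j
    have h2 := (h1.div (hmd.hasDerivAt_line v) (by simpa using hne)).complex_im
    have h3 := h2.unique ((hasDerivAt_const (0 : ℝ) (0 : ℝ)).congr_of_eventuallyEq (by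
      filter_upwards [eventually_line_mem hB' hξ v] with t ht using hreal _ ht w j))
    simp only [zero_smul, add_zero] at h3
    have h4 : (fderiv ℝ M ξ v w j * m ξ - M ξ w j * fderiv ℝ m ξ v) / m ξ ^ 2 =
      fderiv ℝ M ξ v w j / m ξ - M ξ w j / m ξ * (fderiv ℝ m ξ v / m ξ) := by
      field_simp
    rw [h4, Complex.sub_im, Complex.mul_im, hreal ξ hξ w j, zero_mul, add_zero, sub_eq_zero] at h3
    exact h3
  -- The equation `α = -dθ` on the submanifold. Call the left side `β(v)`. The imaginary part of the
  -- structure equation divided by `m` is `β(v) M(w) = β(w) M(v)`; since `M` is injective, `β(v) w =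
  -- β(w) v`, and `β = 0` because the dimension exceeds one.
  have hα0 : ∀ ξ ∈ B', ∀ v, α (g ξ) (fderiv ℝ g ξ v) + (fderiv ℝ m ξ v / m ξ).im = 0 := by
    intro ξ hξ v
    refine eq_zero_of_smul_comm (V := EuclideanSpace ℝ (Fin n)) (by simpa using hn)
      (β := fun v => α (g ξ) (fderiv ℝ g ξ v) + (fderiv ℝ m ξ v / m ξ).im) (fun v w => ?_) v
    refine hMi ξ hξ.1 (funext fun j => ?_)
    have hne : m ξ ≠ 0 := hξ.2
    obtain ⟨b, hb⟩ : ∃ b : EuclideanSpace ℝ (Fin n) → Fin n → ℝ, ∀ v j, M ξ v j / m ξ = b v j :=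
      ⟨fun v j => (M ξ v j / m ξ).re, fun v j =>
        Complex.ext (by simp) (by simp [hreal ξ hξ v j])⟩
    have ht := h.torsion _ (hgO hξ.1) (fderiv ℝ g ξ v) (fderiv ℝ g ξ w) j
    have ht2 : fderiv ℝ M ξ v w j / m ξ - fderiv ℝ M ξ w v j / m ξ +
        ((α (g ξ) (fderiv ℝ g ξ v) * Complex.I) * (M ξ w j / m ξ) +
          ∑ k, (φ j k (g ξ) (fderiv ℝ g ξ v) : ℂ) * (M ξ w k / m ξ)) -
        ((α (g ξ) (fderiv ℝ g ξ w) * Complex.I) * (M ξ v j / m ξ) +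
          ∑ k, (φ j k (g ξ) (fderiv ℝ g ξ w) : ℂ) * (M ξ v k / m ξ)) = 0 := by
      simp only [← mul_div_assoc, ← Finset.sum_div, ← add_div, ← sub_div]
      rw [div_eq_zero_iff]
      left
      rw [hMder ξ hξ.1, hMder ξ hξ.1, hsymm ξ hξ.1 w v]
      simp only [Pi.add_apply]
      rw [← ht]
      simp only [M, ContinuousLinearMap.comp_apply]
      ring
    have him := congrArg Complex.im ht2
    simp only [hb, ← Complex.ofReal_mul, ← Complex.ofReal_sum, Complex.sub_im, Complex.add_im,
      Complex.ofReal_im, hmM ξ hξ, mul_right_comm _ Complex.I, Complex.zero_im, add_zero,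
      Complex.im_ofReal_mul, Complex.I_im, mul_one, Complex.ofReal_re] at him
    have hMb : ∀ v j, M ξ v j = b v j * m ξ := fun v j => by rw [← hb, div_mul_cancel₀ _ hne]
    rw [map_smul, map_smul]
    simp only [Pi.smul_apply, Complex.real_smul, hMb, ← mul_assoc, ← Complex.ofReal_mul]
    congr 2
    linarith
  have hξ' : ξ ∈ B' := ⟨hξ, hi⟩
  have hγ : ContDiffOn ℝ ∞ (fun ξ => α (g ξ) ∘L fderiv ℝ g ξ) B :=
    (h.contDiffOn_α.comp hg hgO).clm_comp hg1
  have key := symm_fderiv_of_eq_im_div hB' (hm.mono Set.inter_subset_left) (fun ξ hξ => hξ.2)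
    (hγ.mono Set.inter_subset_left) (fun ξ hξ v => eq_neg_of_add_eq_zero_left (hα0 ξ hξ v)) hξ' v w
  have hder : fderiv ℝ (fun ξ => α (g ξ) ∘L fderiv ℝ g ξ) ξ = _ :=
    (((hαd _ (hgO hξ)).comp ξ (hgd ξ hξ)).clm_comp (hgd2 ξ hξ)).fderiv
  rw [hder] at key
  simpa [hsymm ξ hξ w v] using key

end IsTorsionFreeCoframe
end Pullback

/-! ### The linear algebra of the first Bianchi identity in dimension two. -/

section CurvatureAlgebra

namespace CurvatureCoefficients

/-- The real coordinates `(Re z₁, Im z₁, Re z₂, Im z₂)` of `ℂ²`. -/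
def coord (z : Fin 2 → ℂ) : Fin 4 → ℝ := ![(z 0).re, (z 0).im, (z 1).re, (z 1).im]

/-- The Plücker coordinates of a pair of vectors in `ℂ² = ℝ⁴`. -/
def minor (X Y : Fin 2 → ℂ) (a b : Fin 4) : ℝ := coord X a * coord Y b - coord X b * coord Y a

/-- The form is real although it is written in complex terms. In Plücker coordinates its six real
coefficients can be compared one at a time; `phi_eq` serves the same purpose for `Φ`. -/
lemma omega0_eq (c : CurvatureCoefficients) (X Y : Fin 2 → ℂ) :
    c.Omega0 (fun i z => z i) X Y = ((-2 * c.b 0 0 * minor X Y 0 1 +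
      (c.A.im + 6 * c.a) * minor X Y 0 2 + (c.A.re - 2 * c.b 0 1) * minor X Y 0 3 +
      (c.A.re + 2 * c.b 0 1) * minor X Y 1 2 + (6 * c.a - c.A.im) * minor X Y 1 3 -
      2 * c.b 1 1 * minor X Y 2 3 : ℝ) : ℂ) := by
  have hb := c.b_symm 1 0
  apply Complex.ext
  · simp [Omega0, wedge, Fin.sum_univ_two, minor, coord, hb]
    ring
  · simp [Omega0, wedge, Fin.sum_univ_two, minor, coord, hb]
    ring

lemma phi_eq (c : CurvatureCoefficients) (X Y : Fin 2 → ℂ) (i j : Fin 2) :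
    c.Phi (fun i z => z i) X Y i j = (((if i = j then
      c.A.re * minor X Y 0 2 - c.A.im * minor X Y 0 3 - c.A.im * minor X Y 1 2 -
        c.A.re * minor X Y 1 3 else 0) + 
      (if i = 0 then 2 * c.b j 1 * (minor X Y 0 2 + minor X Y 1 3) else
        -2 * c.b j 0 * (minor X Y 0 2 + minor X Y 1 3)) +
      2 * (c.r i j 0 0 * minor X Y 0 1 + c.r i j 1 1 * minor X Y 2 3 +
        c.r i j 0 1 * (minor X Y 0 3 - minor X Y 1 2)) +
      (if i = 0 then (if j = 0 then 2 * c.a * (minor X Y 0 3 - minor X Y 1 2) else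
        - 4 * c.a * minor X Y 0 1) else
        (if j = 0 then 4 * c.a * minor X Y 2 3 else
        -2 * c.a * (minor X Y 0 3 - minor X Y 1 2))) : ℝ) : ℂ) := by
  have hb := c.b_symm 1 0
  have hr := c.r_symm₂₃ i j 1 0
  apply Complex.ext
  · fin_cases i <;> fin_cases j <;>
    · simp [Phi, wedge, Fin.sum_univ_two, minor, coord, hb, epsilonSymbol] at hr ⊢
      rw [hr]
      ring
  · fin_cases i <;> fin_cases j <;>
    · simp [Phi, wedge, Fin.sum_univ_two, minor, coord, hb, epsilonSymbol] at hr ⊢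
      rw [hr]
      ring

/-- The real basis `(1, 0), (i, 0), (0, 1), (0, i)` of `ℂ²`. -/
def realBasis : Fin 4 → Fin 2 → ℂ := ![![1, 0], ![Complex.I, 0], ![0, 1], ![0, Complex.I]]

lemma sum_coord_smul_realBasis (X : Fin 2 → ℂ) : ∑ a, coord X a • realBasis a = X := by
  ext i
  fin_cases i <;> simp [Fin.sum_univ_four, coord, realBasis, Complex.re_add_im]

lemma alternating_eq (B : (Fin 2 → ℂ) →ₗ[ℝ] (Fin 2 → ℂ) →ₗ[ℝ] ℝ) (hB : ∀ X Y, B X Y = -B Y X)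
    (X Y : Fin 2 → ℂ) : B X Y =
      B (realBasis 0) (realBasis 1) * minor X Y 0 1 +
      B (realBasis 0) (realBasis 2) * minor X Y 0 2 +
      B (realBasis 0) (realBasis 3) * minor X Y 0 3 +
      B (realBasis 1) (realBasis 2) * minor X Y 1 2 +
      B (realBasis 1) (realBasis 3) * minor X Y 1 3 +
      B (realBasis 2) (realBasis 3) * minor X Y 2 3 := by
  have hB0 : ∀ X, B X X = 0 := fun X => by linarith [hB X X]
  conv_lhs => rw [← sum_coord_smul_realBasis X, ← sum_coord_smul_realBasis Y]
  simp only [Fin.sum_univ_four, map_add, map_smul, LinearMap.add_apply, LinearMap.smul_apply,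
    smul_eq_mul, hB0, hB (realBasis 1) (realBasis 0), hB (realBasis 2) (realBasis 0),
    hB (realBasis 3) (realBasis 0), hB (realBasis 2) (realBasis 1),
    hB (realBasis 3) (realBasis 1), hB (realBasis 3) (realBasis 2), minor]
  ring

/-- The solutions of the first Bianchi identity with values in `iℝ ⊕ 𝔤𝔩(2, ℝ)`. -/
theorem exists_of_bianchi (Ω : (Fin 2 → ℂ) →ₗ[ℝ] (Fin 2 → ℂ) →ₗ[ℝ] ℝ)
    (Φ : Fin 2 → Fin 2 → (Fin 2 → ℂ) →ₗ[ℝ] (Fin 2 → ℂ) →ₗ[ℝ] ℝ)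
    (hΩ : ∀ X Y, Ω X Y = -Ω Y X) (hΦ : ∀ i j X Y, Φ i j X Y = -Φ i j Y X)
    (hB : ∀ X Y Z i,
      (Complex.I * Ω X Y * Z i + ∑ j, (Φ i j X Y : ℂ) * Z j) +
      (Complex.I * Ω Y Z * X i + ∑ j, (Φ i j Y Z : ℂ) * X j) +
      (Complex.I * Ω Z X * Y i + ∑ j, (Φ i j Z X : ℂ) * Y j) = 0) :
    ∃ c : CurvatureCoefficients, ∀ X Y, c.Omega0 (fun i z => z i) X Y = Ω X Y ∧
      ∀ i j, c.Phi (fun i z => z i) X Y i j = Φ i j X Y := by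
  -- Four triples of basis vectors, two complex components each, give sixteen real equations for the
  -- thirty values of `Ω` and `Φ`. They determine sixteen entries of `P`, leaving the fourteen
  -- parameters of `A`, `a`, `b` and `r`.
  have H : ∀ a b d : Fin 4, ∀ i, _ := fun a b d i =>
    Complex.ext_iff.1 (hB (realBasis a) (realBasis b) (realBasis d) i)
  have h1 := H 0 1 2 0
  have h2 := H 0 1 2 1
  have h3 := H 0 1 3 0
  have h4 := H 0 1 3 1
  have h5 := H 0 2 3 0
  have h6 := H 0 2 3 1
  have h7 := H 1 2 3 0
  have h8 := H 1 2 3 1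
  clear H
  rw [hΩ (realBasis 2) (realBasis 0)] at h1 h2
  rw [hΩ (realBasis 3) (realBasis 0)] at h3 h4 h5 h6
  rw [hΩ (realBasis 3) (realBasis 1)] at h7 h8
  simp only [Fin.sum_univ_two, hΦ _ _ (realBasis 2) (realBasis 0),
    hΦ _ _ (realBasis 3) (realBasis 0), hΦ _ _ (realBasis 3) (realBasis 1)]
    at h1 h2 h3 h4 h5 h6 h7 h8
  have hΩe := alternating_eq Ω hΩ
  have hΦe := fun i j => alternating_eq (Φ i j) (hΦ i j)
  obtain ⟨O, hO⟩ : ∃ O : Fin 4 → Fin 4 → ℝ, ∀ a b, Ω (realBasis a) (realBasis b) = O a b :=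
    ⟨_, fun _ _ => rfl⟩
  obtain ⟨P, hP⟩ : ∃ P : Fin 2 → Fin 2 → Fin 4 → Fin 4 → ℝ, ∀ i j a b,
    Φ i j (realBasis a) (realBasis b) = P i j a b := ⟨_, fun _ _ _ _ => rfl⟩
  simp only [hO, hP] at hΩe hΦe h1 h2 h3 h4 h5 h6 h7 h8
  simp [realBasis] at h1 h2 h3 h4 h5 h6 h7 h8
  -- A tensor symmetric in lower indices with values in `{0, 1}` depends only on their sum, so `r`
  -- and `b` are functions of that sum. The shifts by `(O 0 2 + O 1 3) / 6`, which is `2a`,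
  -- compensate the `∓4a` coefficients in `phi_eq`.
  let ρ : Fin 2 → ℕ → ℝ := fun i s =>
    if i = 0 then
      if s = 0 then P 0 0 0 1 / 2 else if s = 1 then P 0 1 0 1 / 2 + (O 0 2 + O 1 3) / 6 else
      if s = 2 then P 0 0 2 3 / 2 else P 0 1 2 3 / 2
    else
      if s = 0 then P 1 0 0 1 / 2 else if s = 1 then P 1 1 0 1 / 2 else
      if s = 2 then P 1 0 2 3 / 2 - (O 0 2 + O 1 3) / 6 else P 1 1 2 3 / 2
  let β : ℕ → ℝ := fun s =>
    if s = 0 then -O 0 1 / 2 else if s = 1 then (O 1 2 - O 0 3) / 4 else -O 2 3 / 2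
  let c : CurvatureCoefficients :=
    { A := ⟨(O 0 3 + O 1 2) / 2, (O 0 2 - O 1 3) / 2⟩
      a := (O 0 2 + O 1 3) / 12
      b := fun i j => β (i + j)
      r := fun i j k l => ρ i (j + k + l)
      b_symm := fun i j => by rw [add_comm]
      r_symm₁₂ := fun i j k l => by rw [add_comm (j : ℕ)]
      r_symm₂₃ := fun i j k l => by rw [add_right_comm] }
  refine ⟨c, fun X Y => ⟨?_, fun i j => ?_⟩⟩
  · rw [omega0_eq, hΩe]
    congr 1
    simp [c, β]
    ring
  · rw [phi_eq, hΦe]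
    congr 1
    have e1 : P 0 0 0 2 = O 1 2 := by linarith [h1.2]
    have e2 : P 0 0 1 2 = -O 0 2 - P 0 1 0 1 := by linarith [h1.1]
    have e3 : P 1 0 0 2 = O 0 1 := by linarith [h2.2]
    have e4 : P 1 0 1 2 = -P 1 1 0 1 := by linarith [h2.1]
    have e5 : P 0 0 1 3 = -O 0 3 := by linarith [h3.1]
    have e6 : P 0 0 0 3 = P 0 1 0 1 + O 1 3 := by linarith [h3.2]
    have e7 : P 1 0 1 3 = O 0 1 := by linarith [h4.1]
    have e8 : P 1 0 0 3 = P 1 1 0 1 := by linarith [h4.2]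
    have e9 : P 0 1 0 3 = P 0 0 2 3 := by linarith [h5.1]
    have e10 : P 0 1 0 2 = -O 2 3 := by linarith [h5.2]
    have e11 : P 1 1 0 3 = P 1 0 2 3 - O 0 2 := by linarith [h6.1]
    have e12 : P 1 1 0 2 = O 0 3 := by linarith [h6.2]
    have e13 : P 0 1 1 3 = -O 2 3 := by linarith [h7.1]
    have e14 : P 0 1 1 2 = -P 0 0 2 3 := by linarith [h7.2]
    have e15 : P 1 1 1 3 = -O 1 2 := by linarith [h8.1]
    have e16 : P 1 1 1 2 = O 1 3 - P 1 0 2 3 := by linarith [h8.2]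
    fin_cases i <;> fin_cases j <;> simp [c, β, ρ]
    · rw [e1, e2, e5, e6]
      ring
    · rw [e9, e10, e13, e14]
      ring
    · rw [e3, e4, e7, e8]
      ring
    · rw [e11, e12, e15, e16]
      ring

end CurvatureCoefficients

end CurvatureAlgebra

/-! ### Curvature of the connection form and the first Bianchi identity. -/

section LocalCurvature

variable {n : ℕ} {E : Type} [NormedAddCommGroup E] [NormedSpace ℝ E]

/-- The operator-valued connection form `i α + φ`. -/
def connectionForm (α : E → E →L[ℝ] ℝ) (φ : Fin n → Fin n → E → E →L[ℝ] ℝ) (x : E) :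
    E →L[ℝ] (Fin n → ℂ) →L[ℝ] (Fin n → ℂ) :=
  (α x).smulRight (complexSMul n Complex.I) + ∑ i, ∑ j, (φ i j x).smulRight
    (ContinuousLinearMap.single ℝ (fun _ => ℂ) i ∘L ContinuousLinearMap.proj j)

lemma connectionForm_apply (α : E → E →L[ℝ] ℝ) (φ : Fin n → Fin n → E → E →L[ℝ] ℝ) (x v : E)
    (z : Fin n → ℂ) (i : Fin n) : connectionForm α φ x v z i =
      (α x v * Complex.I) * z i + ∑ j, (φ i j x v : ℂ) * z j := by
  have h : ∀ k j, (if i = k then (φ k j x v : ℂ) * z j else 0) =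
      if k = i then (φ i j x v : ℂ) * z j else 0 := fun k j => by
    by_cases hk : k = i
    · subst hk; simp
    · rw [if_neg hk, if_neg (Ne.symm hk)]
  simp [connectionForm, Finset.sum_apply, Pi.single_apply, mul_assoc, h]

/-- The curvature `dΓ + Γ ∧ Γ` of an operator-valued connection form. -/
def operatorCurvature {C : Type*} [NormedAddCommGroup C] [NormedSpace ℝ C]
    (Γ : E → E →L[ℝ] C →L[ℝ] C) (x v w : E) : C →L[ℝ] C :=
  fderiv ℝ Γ x v w - fderiv ℝ Γ x w v + Γ x v ∘L Γ x w - Γ x w ∘L Γ x v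

/-- The first Bianchi identity. -/
lemma operatorCurvature_bianchi {C : Type*} [NormedAddCommGroup C] [NormedSpace ℝ C] {O : Set E}
    (hO : IsOpen O) {u : E → E →L[ℝ] C} {Γ : E → E →L[ℝ] C →L[ℝ] C} (hu : ContDiffOn ℝ ∞ u O)
    (hΓ : ContDiffOn ℝ ∞ Γ O) (ht : ∀ x ∈ O, ∀ v w, fderiv ℝ u x v w - fderiv ℝ u x w v +
      Γ x v (u x w) - Γ x w (u x v) = 0) {x : E} (hx : x ∈ O) (s v w : E) :
    operatorCurvature Γ x s v (u x w) + operatorCurvature Γ x v w (u x s) +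
      operatorCurvature Γ x w s (u x v) = 0 := by
  have hux : ContDiffAt ℝ ∞ u x := hu.contDiffAt (hO.mem_nhds hx)
  have hud : HasFDerivAt u (fderiv ℝ u x) x := (hux.differentiableAt (by simp)).hasFDerivAt
  have hudd : HasFDerivAt (fderiv ℝ u) (fderiv ℝ (fderiv ℝ u) x) x :=
    ((hux.fderiv_right (m := ∞) (by simp)).differentiableAt (by simp)).hasFDerivAt
  have hΓd : HasFDerivAt Γ (fderiv ℝ Γ x) x :=
    ((hΓ.contDiffAt (hO.mem_nhds hx)).differentiableAt (by simp)).hasFDerivAt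
  -- The derivative of the structure equation in the direction `s`. In the cyclic sum the second
  -- derivatives of `u` cancel by symmetry.
  have key : ∀ s v w, fderiv ℝ (fderiv ℝ u) x s v w - fderiv ℝ (fderiv ℝ u) x s w v +
      (fderiv ℝ Γ x s v (u x w) + Γ x v (fderiv ℝ u x s w)) -
      (fderiv ℝ Γ x s w (u x v) + Γ x w (fderiv ℝ u x s v)) = 0 := by
    intro s v w
    have h1 : ∀ v w, HasDerivAt (fun t : ℝ => fderiv ℝ u (x + t • s) v w)
        (fderiv ℝ (fderiv ℝ u) x s v w) 0 := fun v w =>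
      ((hudd.hasDerivAt_line_apply s v).clm_apply (hasDerivAt_const (0 : ℝ) w)).congr_deriv
        (by rw [map_zero, add_zero])
    have h2 : ∀ v w, HasDerivAt (fun t : ℝ => Γ (x + t • s) v (u (x + t • s) w))
        (fderiv ℝ Γ x s v (u x w) + Γ x v (fderiv ℝ u x s w)) 0 := fun v w =>
      ((hΓd.hasDerivAt_line_apply s v).clm_apply (hud.hasDerivAt_line_apply s w)).congr_deriv
        (by rw [zero_smul, add_zero])
    have h3 := (((h1 v w).sub (h1 w v)).add (h2 v w)).sub (h2 w v)
    refine h3.unique ((hasDerivAt_const (0 : ℝ) (0 : C)).congr_of_eventuallyEq ?_)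
    filter_upwards [eventually_line_mem hO hx s] with t ht'
    exact ht _ ht' v w
  have k1 := key s v w
  have k2 := key v w s
  have k3 := key w s v
  rw [hux.fderiv_fderiv_comm v s] at k2
  rw [hux.fderiv_fderiv_comm w v, hux.fderiv_fderiv_comm w s] at k3
  -- Applying the connection form to the structure equation replaces the first derivatives of `u`
  -- that remain by the quadratic part of the curvature.
  have t1 := congrArg (Γ x v) (ht x hx s w)
  have t2 := congrArg (Γ x s) (ht x hx w v)
  have t3 := congrArg (Γ x w) (ht x hx v s)
  simp only [map_add, map_sub, map_zero] at t1 t2 t3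
  simp only [operatorCurvature, add_apply, sub_apply, ContinuousLinearMap.comp_apply]
  have := congrArg₂ (· - ·) (congrArg₂ (· + ·) (congrArg₂ (· + ·) k1 k2) k3)
    (congrArg₂ (· + ·) (congrArg₂ (· + ·) t1 t2) t3)
  simp only [add_zero, sub_zero] at this
  rw [← this]
  abel

namespace IsTorsionFreeCoframe

variable {O : Set E} {u : E → E →L[ℝ] (Fin n → ℂ)} {α : E → E →L[ℝ] ℝ}
  {φ : Fin n → Fin n → E → E →L[ℝ] ℝ}

lemma contDiffOn_connectionForm (h : IsTorsionFreeCoframe O u α φ) :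
    ContDiffOn ℝ ∞ (connectionForm α φ) O :=
  (h.contDiffOn_α.smulRight contDiffOn_const).add (ContDiffOn.sum fun i _ =>
    ContDiffOn.sum fun j _ => (h.contDiffOn_φ i j).smulRight contDiffOn_const)

lemma torsion_connectionForm (h : IsTorsionFreeCoframe O u α φ) {x : E} (hx : x ∈ O) (v w : E) :
    fderiv ℝ u x v w - fderiv ℝ u x w v + connectionForm α φ x v (u x w) -
      connectionForm α φ x w (u x v) = 0 := by
  ext i
  have := h.torsion x hx v w i
  simpa only [Pi.add_apply, Pi.sub_apply, Pi.zero_apply, connectionForm_apply] using this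

lemma bianchi (h : IsTorsionFreeCoframe O u α φ) {x : E} (hx : x ∈ O) (s v w : E) :
    operatorCurvature (connectionForm α φ) x s v (u x w) +
      operatorCurvature (connectionForm α φ) x v w (u x s) +
      operatorCurvature (connectionForm α φ) x w s (u x v) = 0 :=
  operatorCurvature_bianchi h.isOpen h.contDiffOn_u h.contDiffOn_connectionForm
    (fun _ hx => h.torsion_connectionForm hx) hx s v w

end IsTorsionFreeCoframe

/-- The exterior derivative of a `1`-form on a vector space. -/
def extDeriv₁ (α : E → E →L[ℝ] ℝ) (x v w : E) : ℝ := fderiv ℝ α x v w - fderiv ℝ α x w v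

/-- The components of the real part of the curvature. -/
def matrixCurvature (φ : Fin n → Fin n → E → E →L[ℝ] ℝ) (x : E) (i j : Fin n) (v w : E) : ℝ :=
  extDeriv₁ (φ i j) x v w + ∑ k, (φ i k x v * φ k j x w - φ i k x w * φ k j x v)

/-- The scalar part `iα` commutes with `φ`, so the products involving `α` cancel in `Γ ∧ Γ`. The
curvature splits into `i dα` and the real matrix `dφ + φ ∧ φ`. -/
lemma IsTorsionFreeCoframe.operatorCurvature_apply {O : Set E} {u : E → E →L[ℝ] (Fin n → ℂ)}
    {α : E → E →L[ℝ] ℝ} {φ : Fin n → Fin n → E → E →L[ℝ] ℝ} (h : IsTorsionFreeCoframe O u α φ)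
    {x : E} (hx : x ∈ O) (v w : E) (z : Fin n → ℂ) (i : Fin n) :
    operatorCurvature (connectionForm α φ) x v w z i =
      Complex.I * extDeriv₁ α x v w * z i + ∑ j, (matrixCurvature φ x i j v w : ℂ) * z j := by
  have hα : HasFDerivAt α (fderiv ℝ α x) x :=
    ((h.contDiffOn_α.contDiffAt (h.isOpen.mem_nhds hx)).differentiableAt (by simp)).hasFDerivAt
  have hφ : ∀ i j, HasFDerivAt (φ i j) (fderiv ℝ (φ i j) x) x := fun i j =>
    (((h.contDiffOn_φ i j).contDiffAt (h.isOpen.mem_nhds hx)).differentiableAt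
      (by simp)).hasFDerivAt
  have hΓ : HasFDerivAt (connectionForm α φ) (fderiv ℝ (connectionForm α φ) x) x :=
    ((h.contDiffOn_connectionForm.contDiffAt (h.isOpen.mem_nhds hx)).differentiableAt
      (by simp)).hasFDerivAt
  have key : ∀ v w, fderiv ℝ (connectionForm α φ) x v w z i =
      (fderiv ℝ α x v w * Complex.I) * z i + ∑ j, (fderiv ℝ (φ i j) x v w : ℂ) * z j := by
    intro v w
    have h1 := (hΓ.hasDerivAt_line_apply v w).clm_apply (hasDerivAt_const (0 : ℝ) z)
    have h2 := (hasDerivAt_pi.1 h1 i)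
    have h3 : HasDerivAt (fun t : ℝ => ((α (x + t • v) w : ℂ) * Complex.I) * z i +
        ∑ j, (φ i j (x + t • v) w : ℂ) * z j) ((fderiv ℝ α x v w * Complex.I) * z i +
          ∑ j, (fderiv ℝ (φ i j) x v w : ℂ) * z j) 0 :=
      ((((hα.hasDerivAt_line_apply v w).ofReal_comp.mul_const _).mul_const _)).add
        (HasDerivAt.fun_sum fun j _ =>
          ((hφ i j).hasDerivAt_line_apply v w).ofReal_comp.mul_const _)
    have h4 := h2.unique (h3.congr_of_eventuallyEq (Filter.Eventually.of_forall fun t =>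
      connectionForm_apply α φ _ _ z i))
    rw [← h4, map_zero, add_zero]
  have hc : ∀ v w, connectionForm α φ x v (connectionForm α φ x w z) i =
      (α x v * Complex.I) * ((α x w * Complex.I) * z i + ∑ j, (φ i j x w : ℂ) * z j) +
      (α x w * Complex.I) * (∑ j, (φ i j x v : ℂ) * z j) +
      ∑ j, (∑ k, (φ i k x v : ℂ) * φ k j x w) * z j := by
    intro v w
    rw [connectionForm_apply]
    simp only [connectionForm_apply, mul_add, Finset.sum_add_distrib, Finset.mul_sum,
      Finset.sum_mul]
    rw [Finset.sum_comm (γ := Fin n)]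
    rw [add_assoc, add_assoc, add_assoc]
    congr 2
    congr 1
    · exact Finset.sum_congr rfl fun j _ => by ring
    · exact Finset.sum_congr rfl fun j _ => Finset.sum_congr rfl fun k _ => by ring
  simp only [operatorCurvature, add_apply, sub_apply, ContinuousLinearMap.comp_apply, Pi.add_apply,
    Pi.sub_apply, key, hc, matrixCurvature, extDeriv₁]
  push_cast
  simp only [add_mul, sub_mul, Finset.sum_add_distrib, Finset.sum_sub_distrib, mul_add]
  ring

end LocalCurvature

/-! ### Uniqueness of the coefficients and the test on rotated planes. -/

namespace CurvatureCoefficients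

@[ext]
lemma ext_of_fields {c c' : CurvatureCoefficients} (hA : c.A = c'.A) (ha : c.a = c'.a)
    (hb : c.b = c'.b) (hr : c.r = c'.r) : c = c' := by
  cases c; cases c'; subst hA ha hb hr; rfl

/-- The curvature form `i Ω₀ + Φ`. -/
def curvatureMatrix (c : CurvatureCoefficients) (X Y : Fin 2 → ℂ) : Matrix (Fin 2) (Fin 2) ℂ :=
  (Complex.I * c.Omega0 (fun i z => z i) X Y) • (1 : Matrix (Fin 2) (Fin 2) ℂ) +
    c.Phi (fun i z => z i) X Y

/-- Since `Ω₀` and `Φ` are real, imaginary and real parts separate them. Values on pairs of real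
basis vectors then isolate each coefficient: `Ω₀` gives `A`, `a`, `b`, after which `Φ` gives `r`. -/
lemma eq_of_curvatureMatrix_eq {c c' : CurvatureCoefficients}
    (h : ∀ X Y, c.curvatureMatrix X Y = c'.curvatureMatrix X Y) : c = c' := by
  have hΩ : ∀ X Y : Fin 2 → ℂ, c.Omega0 (fun i z => z i) X Y = c'.Omega0 (fun i z => z i) X Y := by
    intro X Y
    have := congrFun (congrFun (h X Y) 0) 0
    simp only [curvatureMatrix, Matrix.add_apply, Matrix.smul_apply, omega0_eq, phi_eq] at this
    rw [omega0_eq, omega0_eq, Complex.ofReal_inj]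
    have := congrArg Complex.im this
    simpa using this
  have hΦ : ∀ (X Y : Fin 2 → ℂ) i j, c.Phi (fun i z => z i) X Y i j = c'.Phi (fun i z => z i) X Y i j := by
    intro X Y i j
    have := congrFun (congrFun (h X Y) i) j
    simp only [curvatureMatrix, Matrix.add_apply, Matrix.smul_apply, hΩ] at this
    exact add_left_cancel this
  simp only [omega0_eq, phi_eq, Complex.ofReal_inj] at hΩ hΦ
  have o01 := hΩ (realBasis 0) (realBasis 1)
  have o02 := hΩ (realBasis 0) (realBasis 2)
  have o03 := hΩ (realBasis 0) (realBasis 3)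
  have o12 := hΩ (realBasis 1) (realBasis 2)
  have o13 := hΩ (realBasis 1) (realBasis 3)
  have o23 := hΩ (realBasis 2) (realBasis 3)
  have p01 := hΦ (realBasis 0) (realBasis 1)
  have p03 := hΦ (realBasis 0) (realBasis 3)
  have p23 := hΦ (realBasis 2) (realBasis 3)
  simp [minor, coord, realBasis] at o01 o02 o03 o12 o13 o23 p01 p03 p23
  have ha : c.a = c'.a := by linarith
  have hA : c.A = c'.A := Complex.ext (by linarith) (by linarith)
  have hb : c.b = c'.b := by
    funext i j
    fin_cases i <;> fin_cases j <;>
      simp only [Fin.zero_eta, Fin.mk_one, c.b_symm 1 0, c'.b_symm 1 0] <;> linarith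
  have hr : c.r = c'.r := by
    funext i j k l
    simp only [hA, ha] at p01 p03 p23
    obtain ⟨⟨a1, a2⟩, a3, a4⟩ := p01
    obtain ⟨⟨b1, b2⟩, b3, b4⟩ := p03
    obtain ⟨⟨d1, d2⟩, d3, d4⟩ := p23
    fin_cases i <;> fin_cases j <;> fin_cases k <;> fin_cases l <;>
      simp only [Fin.zero_eta, Fin.mk_one, c.r_symm₂₃ _ _ 1 0, c'.r_symm₂₃ _ _ 1 0] <;>
      simp only [hb] at * <;> linarith
  exact ext_of_fields hA ha hb hr

/-- On `e^{iθ}ℝ²` the `b` terms cancel by symmetry, leaving `Im(A e^{2iθ}) + 6a` times the area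
form. The angles `0`, `π/2` and `π/4` give `Im A + 6a`, `-Im A + 6a` and `Re A + 6a`, which suffice.
-/
lemma omega0_eq_zero_iff (c : CurvatureCoefficients) :
    (∀ θ, ∀ X ∈ rotatedRealPlane 2 θ, ∀ Y ∈ rotatedRealPlane 2 θ,
      c.Omega0 (fun i z => z i) X Y = 0) ↔ c.A = 0 ∧ c.a = 0 := by
  constructor
  · intro h
    have e1 := h 0 ![1, 0] (mem_rotatedRealPlane_iff.2 fun i => by fin_cases i <;> simp)
      ![0, 1] (mem_rotatedRealPlane_iff.2 fun i => by fin_cases i <;> simp)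
    have e2 := h (Real.pi / 2) ![Complex.I, 0]
      (mem_rotatedRealPlane_iff.2 fun i => by
        fin_cases i <;> simp [Complex.exp_neg])
      ![0, Complex.I] (mem_rotatedRealPlane_iff.2 fun i => by
        fin_cases i <;> simp [Complex.exp_neg])
    have h4 : (Complex.exp (-(Real.pi / 4 : ℝ) * Complex.I) * (1 + Complex.I)).im = 0 := by
      rw [← Complex.ofReal_neg, Complex.exp_mul_I, ← Complex.ofReal_cos, ← Complex.ofReal_sin]
      simp
    have e3 := h (Real.pi / 4) ![1 + Complex.I, 0]
      (mem_rotatedRealPlane_iff.2 fun i => by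
        fin_cases i
        · exact h4
        · simp)
      ![0, 1 + Complex.I] (mem_rotatedRealPlane_iff.2 fun i => by
        fin_cases i
        · simp
        · exact h4)
    rw [omega0_eq, Complex.ofReal_eq_zero] at e1 e2 e3
    simp [minor, coord] at e1 e2 e3
    exact ⟨Complex.ext (by simp; linarith) (by simp; linarith), by linarith⟩
  · rintro ⟨hA, ha⟩ θ X ⟨x, hx⟩ Y ⟨y, hy⟩
    rw [omega0_eq, Complex.ofReal_eq_zero]
    simp [minor, coord, hx, hy, hA, ha]
    ring

end CurvatureCoefficients

/-! ### What the Bianchi identity says about the curvature of a coframe. -/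

namespace IsTorsionFreeCoframe

variable {n : ℕ} {E : Type} [NormedAddCommGroup E] [NormedSpace ℝ E] {O : Set E} {x : E}
  {α : E → E →L[ℝ] ℝ}

/-- The existence of the curvature coefficients of a torsion-free coframe in dimension two. -/
lemma exists_curvatureCoefficients {u : E → E →L[ℝ] (Fin 2 → ℂ)}
    {φ : Fin 2 → Fin 2 → E → E →L[ℝ] ℝ} (h : IsTorsionFreeCoframe O u α φ) (hx : x ∈ O) :
    ∃ c : CurvatureCoefficients, ∀ v w,
      c.Omega0 (fun i z => z i) (u x v) (u x w) = extDeriv₁ α x v w ∧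
      ∀ z, operatorCurvature (connectionForm α φ) x v w z =
        (c.curvatureMatrix (u x v) (u x w)).mulVec z := by
  obtain ⟨e, he⟩ := h.isInvertible x hx
  let Ω : (Fin 2 → ℂ) →ₗ[ℝ] (Fin 2 → ℂ) →ₗ[ℝ] ℝ :=
    LinearMap.mk₂ ℝ (fun X Y => extDeriv₁ α x (e.symm X) (e.symm Y))
      (fun X X' Y => by simp [extDeriv₁]; ring) (fun c X Y => by simp [extDeriv₁]; ring)
      (fun X Y Y' => by simp [extDeriv₁]; ring) (fun c X Y => by simp [extDeriv₁]; ring)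
  let Φ : Fin 2 → Fin 2 → (Fin 2 → ℂ) →ₗ[ℝ] (Fin 2 → ℂ) →ₗ[ℝ] ℝ := fun i j =>
    LinearMap.mk₂ ℝ (fun X Y => matrixCurvature φ x i j (e.symm X) (e.symm Y))
      (fun X X' Y => by simp [extDeriv₁, matrixCurvature]; ring)
      (fun c X Y => by simp [extDeriv₁, matrixCurvature]; ring)
      (fun X Y Y' => by simp [extDeriv₁, matrixCurvature]; ring)
      (fun c X Y => by simp [extDeriv₁, matrixCurvature]; ring)
  have hu : ∀ v, u x v = e v := fun v => by rw [← he]; rfl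
  obtain ⟨c, hc⟩ := CurvatureCoefficients.exists_of_bianchi Ω Φ
    (fun X Y => by simp [Ω, extDeriv₁])
    (fun i j X Y => by simp [Φ, extDeriv₁, matrixCurvature]; ring)
    (fun X Y Z i => by
      have := congrFun (h.bianchi hx (e.symm X) (e.symm Y) (e.symm Z)) i
      simpa only [Pi.add_apply, Pi.zero_apply, h.operatorCurvature_apply hx, hu,
        ContinuousLinearEquiv.apply_symm_apply, Ω, Φ, LinearMap.mk₂_apply] using this)
  have hΩ : ∀ v w, Ω (u x v) (u x w) = extDeriv₁ α x v w := fun v w => by simp [Ω, hu]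
  have hΦ : ∀ i j v w, Φ i j (u x v) (u x w) = matrixCurvature φ x i j v w :=
    fun i j v w => by simp [Φ, hu]
  refine ⟨c, fun v w => ⟨by rw [(hc _ _).1, hΩ], fun z => ?_⟩⟩
  ext i
  rw [h.operatorCurvature_apply hx, CurvatureCoefficients.curvatureMatrix, Matrix.add_mulVec,
    Matrix.smul_mulVec, Matrix.one_mulVec, Pi.add_apply, Pi.smul_apply, (hc _ _).1, hΩ, smul_eq_mul]
  simp only [Matrix.mulVec, dotProduct, (hc _ _).2, hΦ]

/-- In dimension greater than two, `dα` vanishes on the planes `u⁻¹(e^{iθ} ℝⁿ)`. -/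
lemma extDeriv₁_eq_zero (hn : 2 < n) {u : E → E →L[ℝ] (Fin n → ℂ)}
    {φ : Fin n → Fin n → E → E →L[ℝ] ℝ} (h : IsTorsionFreeCoframe O u α φ) (hx : x ∈ O) {θ : ℝ}
    {v w : E} (hv : u x v ∈ rotatedRealPlane n θ) (hw : u x w ∈ rotatedRealPlane n θ) :
    extDeriv₁ α x v w = 0 := by
  obtain ⟨e, he⟩ := h.isInvertible x hx
  have hu : ∀ v, u x v = e v := fun v => by rw [← he]; rfl
  obtain ⟨a, ha⟩ := hv
  obtain ⟨b, hb⟩ := hw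
  -- This is where `n > 2` enters: the plane contains a direction independent of the two given
  -- vectors.
  obtain ⟨s, hs⟩ : ∃ s : Fin n → ℝ, s ∉ Submodule.span ℝ ({a, b} : Set (Fin n → ℝ)) := by
    by_contra! hs
    have h1 : Submodule.span ℝ ({a, b} : Set (Fin n → ℝ)) = ⊤ := Submodule.eq_top_iff'.2 hs
    have h2 := finrank_span_le_card (R := ℝ) ({a, b} : Set (Fin n → ℝ))
    rw [h1, finrank_top, Module.finrank_fin_fun] at h2
    have h3 : ({a, b} : Set (Fin n → ℝ)).toFinset.card ≤ 2 := by
      rw [Set.toFinset_insert, Set.toFinset_singleton]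
      exact Finset.card_le_two
    omega
  have hB := h.bianchi hx (e.symm fun i => Complex.exp (θ * Complex.I) * s i) v w
  set t := e.symm fun i => Complex.exp (θ * Complex.I) * s i with ht
  have hut : ∀ i, u x t i = Complex.exp (θ * Complex.I) * s i := fun i => by
    rw [hu, ht, ContinuousLinearEquiv.apply_symm_apply]
  -- The imaginary part of the Bianchi identity on `t, v, w` after division by the common phase.
  -- Independence of `s` from `a, b` forces its coefficient to vanish.
  have key : extDeriv₁ α x t v • b + extDeriv₁ α x v w • s + extDeriv₁ α x w t • a = 0 := by
    ext i
    have hBi := congrFun hB i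
    simp only [Pi.add_apply, Pi.zero_apply, h.operatorCurvature_apply hx, ha, hb, hut] at hBi
    have hf : Complex.exp (θ * Complex.I) * ((((extDeriv₁ α x t v * b i + extDeriv₁ α x v w * s i +
        extDeriv₁ α x w t * a i : ℝ) : ℂ) * Complex.I) +
        ((∑ j, (matrixCurvature φ x i j t v * b j + matrixCurvature φ x i j v w * s j +
          matrixCurvature φ x i j w t * a j) : ℝ) : ℂ)) = 0 := by
      rw [← hBi]
      push_cast
      simp only [mul_add, Finset.sum_add_distrib, Finset.mul_sum, mul_left_comm _ (Complex.exp _)]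
      ring
    have hf' := congrArg Complex.im ((mul_eq_zero.1 hf).resolve_left (Complex.exp_ne_zero _))
    simpa using hf'
  by_contra hne
  refine hs ?_
  have hse : s = (extDeriv₁ α x v w)⁻¹ • (-(extDeriv₁ α x w t) • a + -(extDeriv₁ α x t v) • b) := by
    rw [eq_inv_smul_iff₀ hne, ← sub_eq_zero, ← key]
    module
  rw [hse]
  exact Submodule.smul_mem _ _ (Submodule.mem_span_pair.2 ⟨_, _, rfl⟩)

end IsTorsionFreeCoframe

/-! ### Vector fields and Lie brackets in a chart. -/

section ChartFrame

variable {E : Type} [NormedAddCommGroup E] [NormedSpace ℝ E] {Q : Type*} [TopologicalSpace Q]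
  [ChartedSpace E Q] [IsManifold 𝓘(ℝ, E) ∞ Q]

/-- The coordinate frame of the preferred chart at `q`, at the point with coordinates `x`. -/
def chartFrame (q : Q) (x : E) :
    E →L[ℝ] TangentSpace 𝓘(ℝ, E) ((extChartAt 𝓘(ℝ, E) q).symm x) :=
  mfderiv 𝓘(ℝ, E) 𝓘(ℝ, E) (extChartAt 𝓘(ℝ, E) q).symm x

/-- The vector field on `Q` with given coordinate expression in the preferred chart at `q`. -/
def chartField (q : Q) (w : E → E) (p : Q) : TangentSpace 𝓘(ℝ, E) p :=
  VectorField.mpullback 𝓘(ℝ, E) 𝓘(ℝ, E) (extChartAt 𝓘(ℝ, E) q) w p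

lemma mfderiv_extChartAt_chartFrame {q : Q} {x : E} (hx : x ∈ (extChartAt 𝓘(ℝ, E) q).target)
    (v : E) : mfderiv 𝓘(ℝ, E) 𝓘(ℝ, E) (extChartAt 𝓘(ℝ, E) q) ((extChartAt 𝓘(ℝ, E) q).symm x)
      (chartFrame q x v) = v := by
  have h := mfderiv_extChartAt_comp_mfderivWithin_extChartAt_symm (I := 𝓘(ℝ, E)) hx
  rw [modelWithCornersSelf_coe, Set.range_id, mfderivWithin_univ] at h
  exact congrArg (fun f => f v) h

lemma chartFrame_mfderiv_extChartAt {q : Q} {x : E} (hx : x ∈ (extChartAt 𝓘(ℝ, E) q).target)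
    (X : TangentSpace 𝓘(ℝ, E) ((extChartAt 𝓘(ℝ, E) q).symm x)) :
    chartFrame q x (mfderiv 𝓘(ℝ, E) 𝓘(ℝ, E) (extChartAt 𝓘(ℝ, E) q)
      ((extChartAt 𝓘(ℝ, E) q).symm x) X) = X := by
  have h := mfderivWithin_extChartAt_symm_comp_mfderiv_extChartAt (I := 𝓘(ℝ, E)) hx
  rw [modelWithCornersSelf_coe, Set.range_id, mfderivWithin_univ] at h
  exact congrArg (fun f => f X) h

/-- The coordinate frame as a linear equivalence. -/
def chartFrameEquiv {q : Q} {x : E} (hx : x ∈ (extChartAt 𝓘(ℝ, E) q).target) :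
    E ≃L[ℝ] TangentSpace 𝓘(ℝ, E) ((extChartAt 𝓘(ℝ, E) q).symm x) :=
  ContinuousLinearEquiv.equivOfInverse (chartFrame q x)
    (mfderiv 𝓘(ℝ, E) 𝓘(ℝ, E) (extChartAt 𝓘(ℝ, E) q) ((extChartAt 𝓘(ℝ, E) q).symm x))
    (mfderiv_extChartAt_chartFrame hx) (chartFrame_mfderiv_extChartAt hx)

lemma chartField_symm {q : Q} {x : E} (hx : x ∈ (extChartAt 𝓘(ℝ, E) q).target) (w : E → E) :
    chartField q w ((extChartAt 𝓘(ℝ, E) q).symm x) = chartFrame q x (w x) := by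
  have h : mfderiv 𝓘(ℝ, E) 𝓘(ℝ, E) (extChartAt 𝓘(ℝ, E) q) ((extChartAt 𝓘(ℝ, E) q).symm x) =
    ((chartFrameEquiv hx).symm : _ →L[ℝ] E) := rfl
  have h' : chartField q w ((extChartAt 𝓘(ℝ, E) q).symm x) = ContinuousLinearMap.inverse
    (mfderiv 𝓘(ℝ, E) 𝓘(ℝ, E) (extChartAt 𝓘(ℝ, E) q) ((extChartAt 𝓘(ℝ, E) q).symm x))
    (w ((extChartAt 𝓘(ℝ, E) q) ((extChartAt 𝓘(ℝ, E) q).symm x))) := rfl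
  rw [h', (extChartAt 𝓘(ℝ, E) q).right_inv hx, h]
  exact congrArg (fun f => f (w x)) (ContinuousLinearMap.inverse_equiv (chartFrameEquiv hx).symm)

lemma contMDiffAt_chartSymm {q : Q} {x : E} (hx : x ∈ (extChartAt 𝓘(ℝ, E) q).target) :
    ContMDiffAt 𝓘(ℝ, E) 𝓘(ℝ, E) ∞ (extChartAt 𝓘(ℝ, E) q).symm x :=
  (contMDiffOn_extChartAt_symm q).contMDiffAt ((isOpen_extChartAt_target q).mem_nhds hx)

variable [CompleteSpace E]

lemma contMDiffAt_chartField {q : Q} {w : E → E} {x : E}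
    (hx : x ∈ (extChartAt 𝓘(ℝ, E) q).target) (hw : ContDiffAt ℝ ∞ w x) :
    ContMDiffAt 𝓘(ℝ, E) 𝓘(ℝ, E).tangent ∞
      (fun p => (⟨p, chartField q w p⟩ : TangentBundle 𝓘(ℝ, E) Q))
      ((extChartAt 𝓘(ℝ, E) q).symm x) := by
  have hs := (extChartAt 𝓘(ℝ, E) q).map_target hx
  refine ContMDiffAt.mpullback_vectorField_preimage (n := ∞) (V := w) ?_
    (contMDiffAt_extChartAt' (by rwa [← extChartAt_source 𝓘(ℝ, E)]))
    (isInvertible_mfderiv_extChartAt hs) (by simp)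
  rw [(extChartAt 𝓘(ℝ, E) q).right_inv hx]
  exact contMDiffAt_vectorSpace_iff_contDiffAt.2 hw

/-- Brackets are natural under pullback and constant fields commute. With coordinate fields,
vanishing torsion therefore becomes a symmetry of the covariant derivative. -/
lemma mlieBracket_chartField_const {q : Q} {x : E} (hx : x ∈ (extChartAt 𝓘(ℝ, E) q).target)
    (v w : E) : VectorField.mlieBracket 𝓘(ℝ, E) (chartField q fun _ => v)
      (chartField q fun _ => w) ((extChartAt 𝓘(ℝ, E) q).symm x) = 0 := by
  have hs := (extChartAt 𝓘(ℝ, E) q).map_target hx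
  have hd : ∀ (v : E) y, MDifferentiableAt 𝓘(ℝ, E) 𝓘(ℝ, E).tangent
      (fun p => (⟨p, v⟩ : TangentBundle 𝓘(ℝ, E) E)) y := fun v y =>
    (contMDiffAt_vectorSpace_iff_contDiffAt (n := 1) (V := fun _ => v)).2 contDiffAt_const
      |>.mdifferentiableAt (by simp)
  have : IsManifold 𝓘(ℝ, E) (minSmoothness ℝ 2) Q := by
    rw [minSmoothness_of_isRCLikeNormedField]
    exact IsManifold.of_le (n := ∞) (WithTop.coe_le_coe.2 le_top)
  have h := VectorField.mpullback_mlieBracket (I := 𝓘(ℝ, E)) (I' := 𝓘(ℝ, E)) (n := ∞)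
    (f := extChartAt 𝓘(ℝ, E) q) (V := fun _ => v) (W := fun _ => w)
    (x₀ := (extChartAt 𝓘(ℝ, E) q).symm x) (hd v _) (hd w _)
    (contMDiffAt_extChartAt' (by rwa [← extChartAt_source 𝓘(ℝ, E)]))
    (by rw [minSmoothness_of_isRCLikeNormedField]; exact WithTop.coe_le_coe.2 le_top)
  refine h.symm.trans ?_
  have h0 : VectorField.mlieBracket 𝓘(ℝ, E) (fun _ : E => v) (fun _ : E => w) = 0 := by
    refine (VectorField.mlieBracketWithin_univ (I := 𝓘(ℝ, E)) (V := fun _ : E => v)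
      (W := fun _ : E => w)).symm.trans ?_
    rw [VectorField.mlieBracketWithin_eq_lieBracketWithin (V := fun _ : E => v)
      (W := fun _ : E => w), VectorField.lieBracketWithin_univ]
    ext y
    simp [VectorField.lieBracket]
    rfl
  rw [h0, VectorField.mpullback_zero]
  rfl

/-- The Lie bracket of vector fields in coordinates. -/
lemma lieBracket_mfderiv_extChartAt {q : Q} {x : E} (hx : x ∈ (extChartAt 𝓘(ℝ, E) q).target)
    {X Y : (p : Q) → TangentSpace 𝓘(ℝ, E) p}
    (hX : ContMDiffAt 𝓘(ℝ, E) 𝓘(ℝ, E).tangent ∞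
      (fun p => (⟨p, X p⟩ : TangentBundle 𝓘(ℝ, E) Q)) ((extChartAt 𝓘(ℝ, E) q).symm x))
    (hY : ContMDiffAt 𝓘(ℝ, E) 𝓘(ℝ, E).tangent ∞
      (fun p => (⟨p, Y p⟩ : TangentBundle 𝓘(ℝ, E) Q)) ((extChartAt 𝓘(ℝ, E) q).symm x)) :
    VectorField.lieBracket ℝ
      (fun y => mfderiv 𝓘(ℝ, E) 𝓘(ℝ, E) (extChartAt 𝓘(ℝ, E) q) ((extChartAt 𝓘(ℝ, E) q).symm y)
        (X ((extChartAt 𝓘(ℝ, E) q).symm y)))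
      (fun y => mfderiv 𝓘(ℝ, E) 𝓘(ℝ, E) (extChartAt 𝓘(ℝ, E) q) ((extChartAt 𝓘(ℝ, E) q).symm y)
        (Y ((extChartAt 𝓘(ℝ, E) q).symm y))) x =
    mfderiv 𝓘(ℝ, E) 𝓘(ℝ, E) (extChartAt 𝓘(ℝ, E) q) ((extChartAt 𝓘(ℝ, E) q).symm x)
      (VectorField.mlieBracket 𝓘(ℝ, E) X Y ((extChartAt 𝓘(ℝ, E) q).symm x)) := by
  let A : ((p : Q) → TangentSpace 𝓘(ℝ, E) p) → E → E := fun X y =>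
    VectorField.mpullback 𝓘(ℝ, E) 𝓘(ℝ, E) (extChartAt 𝓘(ℝ, E) q).symm X y
  have key' : ∀ (X : (p : Q) → TangentSpace 𝓘(ℝ, E) p), ∀ y ∈ (extChartAt 𝓘(ℝ, E) q).target,
      A X y = mfderiv 𝓘(ℝ, E) 𝓘(ℝ, E) (extChartAt 𝓘(ℝ, E) q)
        ((extChartAt 𝓘(ℝ, E) q).symm y) (X ((extChartAt 𝓘(ℝ, E) q).symm y)) := fun X y hy =>
    congrArg (fun f => f (X ((extChartAt 𝓘(ℝ, E) q).symm y)))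
      (ContinuousLinearMap.inverse_equiv (chartFrameEquiv hy))
  have key : ∀ X : (p : Q) → TangentSpace 𝓘(ℝ, E) p, A X =ᶠ[𝓝 x]
      (fun y => mfderiv 𝓘(ℝ, E) 𝓘(ℝ, E) (extChartAt 𝓘(ℝ, E) q) ((extChartAt 𝓘(ℝ, E) q).symm y)
        (X ((extChartAt 𝓘(ℝ, E) q).symm y))) := fun X => by
    filter_upwards [(isOpen_extChartAt_target q).mem_nhds hx] with y hy using key' X y hy
  have h1 := Filter.EventuallyEq.lieBracket_vectorField_eq (𝕜 := ℝ) (key X) (key Y)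
  have : IsManifold 𝓘(ℝ, E) (minSmoothness ℝ 2) Q := by
    rw [minSmoothness_of_isRCLikeNormedField]
    exact IsManifold.of_le (n := ∞) (WithTop.coe_le_coe.2 le_top)
  have h2 := VectorField.mpullback_mlieBracket (I := 𝓘(ℝ, E)) (I' := 𝓘(ℝ, E)) (n := ∞)
    (f := (extChartAt 𝓘(ℝ, E) q).symm) (V := X) (W := Y) (x₀ := x)
    (hX.mdifferentiableAt (by simp)) (hY.mdifferentiableAt (by simp))
    (contMDiffAt_chartSymm hx)
    (by rw [minSmoothness_of_isRCLikeNormedField]; exact WithTop.coe_le_coe.2 le_top)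
  have h3 : VectorField.mlieBracket 𝓘(ℝ, E) (A X) (A Y) x = VectorField.lieBracket ℝ (A X) (A Y) x := by
    refine (congrArg (fun Z : E → E => Z x) (VectorField.mlieBracketWithin_univ (I := 𝓘(ℝ, E))
      (V := A X) (W := A Y)).symm).trans ?_
    rw [VectorField.mlieBracketWithin_eq_lieBracketWithin (V := A X) (W := A Y),
      VectorField.lieBracketWithin_univ]
  exact h1.symm.trans (h3.symm.trans (h2.symm.trans (key' _ x hx)))

end ChartFrame

lemma isOpen_localDomain {E : Type} [NormedAddCommGroup E] [NormedSpace ℝ E] {Q : Type*}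
    [TopologicalSpace Q] [ChartedSpace E Q] (q : Q) {U : Set Q} (hU : IsOpen U) :
    IsOpen ((extChartAt 𝓘(ℝ, E) q).target ∩ (extChartAt 𝓘(ℝ, E) q).symm ⁻¹' U) :=
  (continuousOn_extChartAt_symm q).isOpen_inter_preimage (isOpen_extChartAt_target q) hU

/-! ### Extension of local vector fields to global ones. -/

section Cutoff

variable {E : Type} [NormedAddCommGroup E] [NormedSpace ℝ E] [FiniteDimensional ℝ E] {Q : Type*}
  [TopologicalSpace Q] [T2Space Q] [ChartedSpace E Q] [IsManifold 𝓘(ℝ, E) ∞ Q]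

/-- A smooth local coordinate expression is that of a global smooth vector field near `q`. -/
lemma exists_smooth_vectorField (q : Q) {w : E → E} {O : Set E} (hO : IsOpen O)
    (hOt : O ⊆ (extChartAt 𝓘(ℝ, E) q).target) (hq : extChartAt 𝓘(ℝ, E) q q ∈ O)
    (hw : ContDiffOn ℝ ∞ w O) :
    ∃ Y : (p : Q) → TangentSpace 𝓘(ℝ, E) p,
      ContMDiff 𝓘(ℝ, E) 𝓘(ℝ, E).tangent ∞ (fun p => (⟨p, Y p⟩ : TangentBundle 𝓘(ℝ, E) Q)) ∧
      ∀ᶠ x in 𝓝 (extChartAt 𝓘(ℝ, E) q q),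
        Y ((extChartAt 𝓘(ℝ, E) q).symm x) = chartFrame q x (w x) := by
  have : CompleteSpace E := FiniteDimensional.complete ℝ E
  have hU : IsOpen ((extChartAt 𝓘(ℝ, E) q).source ∩ extChartAt 𝓘(ℝ, E) q ⁻¹' O) :=
    (continuousOn_extChartAt q).isOpen_inter_preimage (isOpen_extChartAt_source q) hO
  obtain ⟨f, -, hf⟩ := ((SmoothBumpFunction.nhds_basis_tsupport (I := 𝓘(ℝ, E)) q).mem_iff).1
    (hU.mem_nhds ⟨mem_extChartAt_source q, hq⟩)
  have hs : ContMDiffOn 𝓘(ℝ, E) 𝓘(ℝ, E).tangent ∞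
      (fun p => (⟨p, chartField q w p⟩ : TangentBundle 𝓘(ℝ, E) Q))
      ((extChartAt 𝓘(ℝ, E) q).source ∩ extChartAt 𝓘(ℝ, E) q ⁻¹' O) := by
    rintro p ⟨hp, hpO⟩
    have := contMDiffAt_chartField (hOt hpO) (hw.contDiffAt (hO.mem_nhds hpO))
    rw [(extChartAt 𝓘(ℝ, E) q).left_inv hp] at this
    exact this.contMDiffWithinAt
  refine ⟨fun p => f p • chartField q w p,
    ContMDiffOn.smul_section_of_tsupport f.contMDiff.contMDiffOn hU hf hs, ?_⟩
  have hc : Filter.Tendsto (extChartAt 𝓘(ℝ, E) q).symm (𝓝 (extChartAt 𝓘(ℝ, E) q q)) (𝓝 q) := by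
    have := continuousAt_extChartAt_symm (I := 𝓘(ℝ, E)) q
    rwa [ContinuousAt, (extChartAt 𝓘(ℝ, E) q).left_inv (mem_extChartAt_source q)] at this
  filter_upwards [hc.eventually f.eventuallyEq_one,
    (isOpen_extChartAt_target q).mem_nhds (mem_extChartAt_target q)] with x hx hxt
  rw [hx, Pi.one_apply, one_smul, chartField_symm hxt]

end Cutoff

/-! ### Coframes and compatible connections in coordinates. -/

section LocalCoframe

variable {n : ℕ} {Q : Type*} [TopologicalSpace Q]
  [ChartedSpace (EuclideanSpace ℝ (Fin (2 * n))) Q] [IsManifold (𝓡 (2 * n)) ∞ Q]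

/-- The coordinate expression of a field of coframes in the preferred chart at `q`. -/
def localCoframe (q : Q) (u : (p : Q) → CoframeAt n p) (x : EuclideanSpace ℝ (Fin (2 * n))) :
    EuclideanSpace ℝ (Fin (2 * n)) →L[ℝ] (Fin n → ℂ) :=
  (u ((extChartAt (𝓡 (2 * n)) q).symm x) : _ →L[ℝ] (Fin n → ℂ)) ∘L chartFrame q x

/-- The components of a vector field with respect to a field of coframes, in coordinates. -/
def localComponents (q : Q) (u : (p : Q) → CoframeAt n p)
    (Z : (p : Q) → TangentSpace (𝓡 (2 * n)) p) (x : EuclideanSpace ℝ (Fin (2 * n))) : Fin n → ℂ :=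
  u ((extChartAt (𝓡 (2 * n)) q).symm x) (Z ((extChartAt (𝓡 (2 * n)) q).symm x))

variable {q : Q} {u : (p : Q) → CoframeAt n p} {U : Set Q}

lemma SmoothCoframingOn.contMDiffAt_apply (hu : SmoothCoframingOn n u U) (hU : IsOpen U) {p : Q}
    (hp : p ∈ U) {Z : (p : Q) → TangentSpace (𝓡 (2 * n)) p}
    (hZ : ContMDiffAt (𝓡 (2 * n)) (𝓡 (2 * n)).tangent ∞
      (fun p => (⟨p, Z p⟩ : TangentBundle (𝓡 (2 * n)) Q)) p) :
    ContMDiffAt (𝓡 (2 * n)) 𝓘(ℝ, Fin n → ℂ) ∞ (fun p => u p (Z p)) p := by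
  have ho : IsOpen {v : TangentBundle (𝓡 (2 * n)) Q | v.1 ∈ U} :=
    hU.preimage (FiberBundle.continuous_proj _ _)
  have h1 := hu.contMDiffAt (x := (⟨p, Z p⟩ : TangentBundle (𝓡 (2 * n)) Q)) (ho.mem_nhds hp)
  exact ContMDiffAt.comp p h1 hZ

lemma SmoothCoframingOn.contDiffAt_localComponents (hu : SmoothCoframingOn n u U) (hU : IsOpen U)
    {x : EuclideanSpace ℝ (Fin (2 * n))} (hx : x ∈ (extChartAt (𝓡 (2 * n)) q).target)
    (hxU : (extChartAt (𝓡 (2 * n)) q).symm x ∈ U) {Z : (p : Q) → TangentSpace (𝓡 (2 * n)) p}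
    (hZ : ContMDiffAt (𝓡 (2 * n)) (𝓡 (2 * n)).tangent ∞
      (fun p => (⟨p, Z p⟩ : TangentBundle (𝓡 (2 * n)) Q)) ((extChartAt (𝓡 (2 * n)) q).symm x)) :
    ContDiffAt ℝ ∞ (localComponents q u Z) x :=
  ((hu.contMDiffAt_apply hU hxU hZ).comp x (contMDiffAt_chartSymm hx)).contDiffAt

lemma SmoothCoframingOn.contDiffOn_localCoframe (hu : SmoothCoframingOn n u U) (hU : IsOpen U) :
    ContDiffOn ℝ ∞ (localCoframe q u)
      ((extChartAt (𝓡 (2 * n)) q).target ∩ (extChartAt (𝓡 (2 * n)) q).symm ⁻¹' U) := by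
  refine contDiffOn_clm_apply.2 fun v x hx => ContDiffAt.contDiffWithinAt ?_
  refine (hu.contDiffAt_localComponents hU hx.1 hx.2
    (contMDiffAt_chartField (w := fun _ => v) hx.1 contDiffAt_const)).congr_of_eventuallyEq ?_
  filter_upwards [(isOpen_extChartAt_target q).mem_nhds hx.1] with y hy
  rw [localComponents, chartField_symm hy]
  rfl

lemma isInvertible_localCoframe {x : EuclideanSpace ℝ (Fin (2 * n))}
    (hx : x ∈ (extChartAt (𝓡 (2 * n)) q).target) : (localCoframe q u x).IsInvertible :=
  ⟨(chartFrameEquiv hx).trans (u ((extChartAt (𝓡 (2 * n)) q).symm x)), rfl⟩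

lemma mvfderiv_chartFrame {h : Q → (Fin n → ℂ)} {x v : EuclideanSpace ℝ (Fin (2 * n))}
    (hx : x ∈ (extChartAt (𝓡 (2 * n)) q).target)
    (hh : MDifferentiableAt (𝓡 (2 * n)) 𝓘(ℝ, Fin n → ℂ) h ((extChartAt (𝓡 (2 * n)) q).symm x)) :
    mvfderiv (𝓡 (2 * n)) h ((extChartAt (𝓡 (2 * n)) q).symm x) (chartFrame q x v) =
      fderiv ℝ (fun y => h ((extChartAt (𝓡 (2 * n)) q).symm y)) x v := by
  have h1 := mfderiv_comp x hh ((contMDiffAt_chartSymm hx).mdifferentiableAt (by simp))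
  rw [mfderiv_eq_fderiv] at h1
  exact congrArg (fun f => f v) h1.symm

namespace S1GLStructure

variable {F : S1GLStructure n Q} {nabla : CovariantDerivative (𝓡 (2 * n))
    (EuclideanSpace ℝ (Fin (2 * n))) (TangentSpace (𝓡 (2 * n)) : Q → Type _)}

/-- The scalar and the matrix depend on the vector but not on `Z`, so they can be recovered by
testing on a frame. Their smooth dependence on the point is not part of the definition and is proved
that way later. -/
lemma IsConnection.exists_local (h : F.IsConnection nabla) (hU : IsOpen U)
    (huF : ∀ p ∈ U, u p ∈ F.fibre p) (hu : SmoothCoframingOn n u U)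
    {x : EuclideanSpace ℝ (Fin (2 * n))} (hx : x ∈ (extChartAt (𝓡 (2 * n)) q).target)
    (hxU : (extChartAt (𝓡 (2 * n)) q).symm x ∈ U) (v : EuclideanSpace ℝ (Fin (2 * n))) :
    ∃ (ω₀ : ℝ) (φ : Matrix (Fin n) (Fin n) ℝ), ∀ Z : (p : Q) → TangentSpace (𝓡 (2 * n)) p,
      ContMDiffAt (𝓡 (2 * n)) (𝓡 (2 * n)).tangent ∞
        (fun p => (⟨p, Z p⟩ : TangentBundle (𝓡 (2 * n)) Q))
        ((extChartAt (𝓡 (2 * n)) q).symm x) → ∀ i,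
      u ((extChartAt (𝓡 (2 * n)) q).symm x) (nabla Z ((extChartAt (𝓡 (2 * n)) q).symm x)
        (chartFrame q x v)) i = fderiv ℝ (localComponents q u Z) x v i +
          ((ω₀ * Complex.I) * localComponents q u Z x i +
            ∑ j, (φ i j : ℂ) * localComponents q u Z x j) := by
  obtain ⟨ω₀, φ, H⟩ := h.compatible U u hU huF hu _ hxU (chartFrame q x v)
  refine ⟨ω₀, φ, fun Z hZ i => ?_⟩
  rw [H Z (hZ.mdifferentiableAt (by simp)), mvfderiv_chartFrame hx
    ((hu.contMDiffAt_apply hU hxU hZ).mdifferentiableAt (by simp)), Matrix.add_mulVec,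
    Matrix.smul_mulVec, Matrix.one_mulVec]
  rfl

/-- Smoothness of the connection is applied to the globally smooth field `Y`; this is why frame
fields are extended by cut-off functions. -/
lemma IsConnection.contMDiffAt_nabla (h : F.IsConnection nabla)
    {Y V : (p : Q) → TangentSpace (𝓡 (2 * n)) p} (hY : SmoothVectorField Y) {p : Q}
    (hV : ContMDiffAt (𝓡 (2 * n)) (𝓡 (2 * n)).tangent ∞
        (fun p => (⟨p, V p⟩ : TangentBundle (𝓡 (2 * n)) Q)) p) :
    ContMDiffAt (𝓡 (2 * n)) (𝓡 (2 * n)).tangent ∞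
      (fun p => (⟨p, nabla Y p (V p)⟩ : TangentBundle (𝓡 (2 * n)) Q)) p := by
  have h1 := h.smooth.contMDiff.contMDiff (σ := Y) (ContMDiff.contMDiffOn (by simpa [SmoothVectorField] using hY))
  exact ContMDiffAt.clm_bundle_apply (h1.contMDiffAt Filter.univ_mem) hV

end S1GLStructure

end LocalCoframe

/-! ### From a connection on the manifold to connection forms in a chart. -/

section LocalModelOfConnection

variable {n : ℕ} {Q : Type*} [TopologicalSpace Q]
  [ChartedSpace (EuclideanSpace ℝ (Fin (2 * n))) Q] [IsManifold (𝓡 (2 * n)) ∞ Q]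
  {q : Q} {u : (p : Q) → CoframeAt n p} {U : Set Q}

namespace S1GLStructure

variable {F : S1GLStructure n Q} {nabla : CovariantDerivative (𝓡 (2 * n))
    (EuclideanSpace ℝ (Fin (2 * n))) (TangentSpace (𝓡 (2 * n)) : Q → Type _)}

/-- The coordinate expression of the covariant derivative of the `k`-th frame field. -/
def localNabla (nabla : CovariantDerivative (𝓡 (2 * n))
    (EuclideanSpace ℝ (Fin (2 * n))) (TangentSpace (𝓡 (2 * n)) : Q → Type _)) (q : Q)
    (u : (p : Q) → CoframeAt n p) (Y : (p : Q) → TangentSpace (𝓡 (2 * n)) p)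
    (x : EuclideanSpace ℝ (Fin (2 * n))) :
    EuclideanSpace ℝ (Fin (2 * n)) →L[ℝ] (Fin n → ℂ) :=
  (u ((extChartAt (𝓡 (2 * n)) q).symm x) : _ →L[ℝ] (Fin n → ℂ)) ∘L
    (nabla Y ((extChartAt (𝓡 (2 * n)) q).symm x)) ∘L chartFrame q x

lemma IsConnection.contDiffOn_localNabla (h : F.IsConnection nabla) (hU : IsOpen U)
    (hu : SmoothCoframingOn n u U)
    {Y : (p : Q) → TangentSpace (𝓡 (2 * n)) p} (hY : SmoothVectorField Y) :
    ContDiffOn ℝ ∞ (localNabla nabla q u Y)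
      ((extChartAt (𝓡 (2 * n)) q).target ∩ (extChartAt (𝓡 (2 * n)) q).symm ⁻¹' U) := by
  refine contDiffOn_clm_apply.2 fun v x hx => ContDiffAt.contDiffWithinAt ?_
  refine (hu.contDiffAt_localComponents hU hx.1 hx.2 (h.contMDiffAt_nabla hY
    (contMDiffAt_chartField (w := fun _ => v) hx.1 contDiffAt_const))).congr_of_eventuallyEq ?_
  filter_upwards [(isOpen_extChartAt_target q).mem_nhds hx.1] with y hy
  rw [localComponents, chartField_symm hy]
  rfl

variable [T2Space Q]

/-- The frame dual to a field of coframes, extended to global smooth vector fields. -/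
lemma exists_smooth_dual_frame (hU : IsOpen U) (hu : SmoothCoframingOn n u U) (hq : q ∈ U) :
    ∃ Y : Fin n → (p : Q) → TangentSpace (𝓡 (2 * n)) p, (∀ k, SmoothVectorField (Y k)) ∧
      ∃ O ⊆ (extChartAt (𝓡 (2 * n)) q).target ∩ (extChartAt (𝓡 (2 * n)) q).symm ⁻¹' U,
        IsOpen O ∧ extChartAt (𝓡 (2 * n)) q q ∈ O ∧
        ∀ x ∈ O, ∀ k, localComponents q u (Y k) x = Pi.single k 1 := by
  have hO := isOpen_localDomain (E := EuclideanSpace ℝ (Fin (2 * n))) q hU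
  have hqO : extChartAt (𝓡 (2 * n)) q q ∈
      (extChartAt (𝓡 (2 * n)) q).target ∩ (extChartAt (𝓡 (2 * n)) q).symm ⁻¹' U :=
    ⟨mem_extChartAt_target q, by
      rwa [Set.mem_preimage, (extChartAt (𝓡 (2 * n)) q).left_inv (mem_extChartAt_source q)]⟩
  have hw : ∀ k, ContDiffOn ℝ ∞
      (fun x => (localCoframe q u x).inverse (Pi.single k 1 : Fin n → ℂ))
      ((extChartAt (𝓡 (2 * n)) q).target ∩ (extChartAt (𝓡 (2 * n)) q).symm ⁻¹' U) := by
    intro k x hx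
    obtain ⟨e, he⟩ := isInvertible_localCoframe (u := u) hx.1
    have h1 : ContDiffAt ℝ ∞ ContinuousLinearMap.inverse (localCoframe q u x) := by
      rw [← he]
      exact contDiffAt_map_inverse e
    exact ((h1.comp_contDiffWithinAt x (hu.contDiffOn_localCoframe hU x hx)).clm_apply
      contDiffWithinAt_const)
  choose Y hY hYe using fun k => exists_smooth_vectorField q hO Set.inter_subset_left hqO (hw k)
  obtain ⟨t, ht, hto, hqt⟩ := mem_nhds_iff.1 (Filter.eventually_all.2 hYe)
  refine ⟨Y, hY, t ∩ _, Set.inter_subset_right, hto.inter hO, ⟨hqt, hqO⟩, fun x hx k => ?_⟩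
  obtain ⟨e, he⟩ := isInvertible_localCoframe (u := u) hx.2.1
  rw [localComponents, ht hx.1 k]
  change localCoframe q u x ((localCoframe q u x).inverse (Pi.single k 1)) = _
  rw [← he, ContinuousLinearMap.inverse_equiv]
  exact e.apply_symm_apply _

/-- A torsion-free connection on `F` in the preferred chart at `q`. -/
theorem IsTorsionFreeConnection.exists_isTorsionFreeCoframe (hn : 0 < n)
    (h : F.IsTorsionFreeConnection nabla) (hU : IsOpen U) (huF : ∀ p ∈ U, u p ∈ F.fibre p)
    (hu : SmoothCoframingOn n u U) (hq : q ∈ U) :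
    ∃ O ⊆ (extChartAt (𝓡 (2 * n)) q).target ∩ (extChartAt (𝓡 (2 * n)) q).symm ⁻¹' U,
      extChartAt (𝓡 (2 * n)) q q ∈ O ∧ ∃ α φ,
        IsTorsionFreeCoframe O (localCoframe q u) α φ ∧
        ∀ x ∈ O, ∀ v, ∀ Z : (p : Q) → TangentSpace (𝓡 (2 * n)) p,
          ContMDiffAt (𝓡 (2 * n)) (𝓡 (2 * n)).tangent ∞
            (fun p => (⟨p, Z p⟩ : TangentBundle (𝓡 (2 * n)) Q))
            ((extChartAt (𝓡 (2 * n)) q).symm x) →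
          u ((extChartAt (𝓡 (2 * n)) q).symm x) (nabla Z ((extChartAt (𝓡 (2 * n)) q).symm x)
            (chartFrame q x v)) = fderiv ℝ (localComponents q u Z) x v +
              connectionForm α φ x v (localComponents q u Z x) := by
  obtain ⟨Y, hY, O, hOU, hO, hqO, hYO⟩ := exists_smooth_dual_frame hU hu hq
  let T : Fin n → EuclideanSpace ℝ (Fin (2 * n)) →
    EuclideanSpace ℝ (Fin (2 * n)) →L[ℝ] (Fin n → ℂ) := fun k => localNabla nabla q u (Y k) 
  have hTs : ∀ k, ContDiffOn ℝ ∞ (T k) O := fun k =>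
    (h.toIsConnection.contDiffOn_localNabla hU hu (hY k)).mono hOU
  -- On the fields with constant components `e_k`, covariant differentiation gives the `k`-th column
  -- of `iω₀ + φ`. Any diagonal entry has imaginary part `ω₀`, here the first, and the real parts
  -- give `φ`; both are smooth because `T` is. These `n` fields suffice since the connection matrix
  -- acts complex linearly.
  let α : EuclideanSpace ℝ (Fin (2 * n)) → EuclideanSpace ℝ (Fin (2 * n)) →L[ℝ] ℝ := fun x =>
    (Complex.imCLM ∘L ContinuousLinearMap.proj ⟨0, hn⟩) ∘L T ⟨0, hn⟩ x
  let φ : Fin n → Fin n → EuclideanSpace ℝ (Fin (2 * n)) →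
      EuclideanSpace ℝ (Fin (2 * n)) →L[ℝ] ℝ := fun i k x =>
    (Complex.reCLM ∘L ContinuousLinearMap.proj i) ∘L T k x
  have key : ∀ x ∈ O, ∀ v, ∀ Z : (p : Q) → TangentSpace (𝓡 (2 * n)) p,
      ContMDiffAt (𝓡 (2 * n)) (𝓡 (2 * n)).tangent ∞
        (fun p => (⟨p, Z p⟩ : TangentBundle (𝓡 (2 * n)) Q))
        ((extChartAt (𝓡 (2 * n)) q).symm x) →
      u ((extChartAt (𝓡 (2 * n)) q).symm x) (nabla Z ((extChartAt (𝓡 (2 * n)) q).symm x)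
        (chartFrame q x v)) = fderiv ℝ (localComponents q u Z) x v +
          connectionForm α φ x v (localComponents q u Z x) := by
    intro x hx v Z hZ
    obtain ⟨ω₀, φ₀, H⟩ := h.toIsConnection.exists_local hU huF hu (hOU hx).1 (hOU hx).2 v
    have hTx : ∀ k i, T k x v i = (if i = k then ω₀ * Complex.I else 0) + φ₀ i k := by
      intro k i
      have h1 := H (Y k) ((hY k).contMDiffAt) i
      have h2 : localComponents q u (Y k) =ᶠ[𝓝 x] fun _ => Pi.single k 1 := by
        filter_upwards [hO.mem_nhds hx] with y hy using hYO y hy k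
      rw [h2.fderiv_eq, fderiv_fun_const, hYO x hx k] at h1
      refine h1.trans ?_
      simp [Pi.single_apply]
    have hα : α x v = ω₀ := by
      have := hTx ⟨0, hn⟩ ⟨0, hn⟩
      simp [α, this]
    have hφ : ∀ i k, φ i k x v = φ₀ i k := by
      intro i k
      have : (T k x v i).re = φ₀ i k := by
        rw [hTx]
        split_ifs <;> simp
      exact this
    ext i
    rw [H Z hZ i, Pi.add_apply, connectionForm_apply, hα]
    simp only [hφ]
  refine ⟨O, hOU, hqO, α, φ, ⟨hO, (hu.contDiffOn_localCoframe hU).mono hOU,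
    contDiffOn_const.clm_comp (hTs _), fun i k => contDiffOn_const.clm_comp (hTs _),
    fun x hx => isInvertible_localCoframe (hOU hx).1, fun x hx v w i => ?_⟩, key⟩
  have hxt := (hOU hx).1
  have hc : ∀ v : EuclideanSpace ℝ (Fin (2 * n)),
      ContMDiffAt (𝓡 (2 * n)) (𝓡 (2 * n)).tangent ∞
      (fun p => (⟨p, chartField q (fun _ => v) p⟩ : TangentBundle (𝓡 (2 * n)) Q))
      ((extChartAt (𝓡 (2 * n)) q).symm x) := fun v =>
    contMDiffAt_chartField (w := fun _ => v) hxt contDiffAt_const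
  -- Torsion evaluated on two coordinate fields, whose bracket is zero, yields the first structure
  -- equation.
  have ht := CovariantDerivative.torsion_eq_zero_iff nabla |>.1 h.torsion_eq_zero
    ((hc v).mdifferentiableAt (by simp)) ((hc w).mdifferentiableAt (by simp))
  rw [mlieBracket_chartField_const hxt, chartField_symm hxt, chartField_symm hxt] at ht
  have ht' := congrArg (u ((extChartAt (𝓡 (2 * n)) q).symm x)) ht
  have hl : ∀ w, localComponents q u (chartField q fun _ => w) =ᶠ[𝓝 x]
      fun y => localCoframe q u y w := fun w => by
    filter_upwards [(isOpen_extChartAt_target q).mem_nhds hxt] with y hy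
    rw [localComponents, chartField_symm hy]
    rfl
  have hud : HasFDerivAt (localCoframe q u) (fderiv ℝ (localCoframe q u) x) x :=
    ((((hu.contDiffOn_localCoframe hU).mono hOU).contDiffAt (hO.mem_nhds hx)).differentiableAt
      (by simp)).hasFDerivAt
  have hd : ∀ v w, fderiv ℝ (localComponents q u (chartField q fun _ => w)) x v =
      fderiv ℝ (localCoframe q u) x v w := fun v w => by
    rw [(hl w).fderiv_eq, (hud.clm_apply (hasFDerivAt_const w x)).fderiv]
    simp
  rw [map_sub, map_zero, key x hx v _ (hc w), key x hx w _ (hc v), hd, hd, (hl w).eq_of_nhds,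
    (hl v).eq_of_nhds] at ht'
  have := congrFun ht' i
  simp only [Pi.sub_apply, Pi.add_apply, connectionForm_apply, Pi.zero_apply] at this
  rw [← this]
  ring

end S1GLStructure

end LocalModelOfConnection

/-! ### The affine curvature as the curvature of the connection form. -/

section CurvatureInCoordinates

/-- The curvature of the covariant derivative `∇_A z = dz(A) + Γ(A) z` on a vector space. -/
lemma covariant_commutator_eq_operatorCurvature {E : Type} [NormedAddCommGroup E]
    [NormedSpace ℝ E] {C : Type*} [NormedAddCommGroup C] [NormedSpace ℝ C]
    {Γ : E → E →L[ℝ] C →L[ℝ] C} {z : E → C} {A B : E → E} {x : E} (hΓ : DifferentiableAt ℝ Γ x)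
    (hz : ContDiffAt ℝ ∞ z x) (hA : DifferentiableAt ℝ A x) (hB : DifferentiableAt ℝ B x) :
    (fderiv ℝ (fun y => fderiv ℝ z y (B y) + Γ y (B y) (z y)) x (A x) +
        Γ x (A x) (fderiv ℝ z x (B x) + Γ x (B x) (z x))) -
      (fderiv ℝ (fun y => fderiv ℝ z y (A y) + Γ y (A y) (z y)) x (B x) +
        Γ x (B x) (fderiv ℝ z x (A x) + Γ x (A x) (z x))) -
      (fderiv ℝ z x (VectorField.lieBracket ℝ A B x) +
        Γ x (VectorField.lieBracket ℝ A B x) (z x)) =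
      operatorCurvature Γ x (A x) (B x) (z x) := by
  have hzd : HasFDerivAt z (fderiv ℝ z x) x := (hz.differentiableAt (by simp)).hasFDerivAt
  have hzdd : HasFDerivAt (fderiv ℝ z) (fderiv ℝ (fderiv ℝ z) x) x :=
    ((hz.fderiv_right (m := ∞) (by simp)).differentiableAt (by simp)).hasFDerivAt
  have key : ∀ {B : E → E}, DifferentiableAt ℝ B x → ∀ v,
      fderiv ℝ (fun y => fderiv ℝ z y (B y) + Γ y (B y) (z y)) x v =
        fderiv ℝ (fderiv ℝ z) x v (B x) + fderiv ℝ z x (fderiv ℝ B x v) +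
          (fderiv ℝ Γ x v (B x) (z x) + Γ x (fderiv ℝ B x v) (z x) +
            Γ x (B x) (fderiv ℝ z x v)) := by
    intro B hB v
    have h1 := (hzdd.clm_apply hB.hasFDerivAt).fun_add
      ((hΓ.hasFDerivAt.clm_apply hB.hasFDerivAt).clm_apply hzd)
    rw [h1.fderiv]
    simp only [add_apply, ContinuousLinearMap.comp_apply, ContinuousLinearMap.flip_apply]
    abel
  rw [key hB, key hA, hz.fderiv_fderiv_comm (A x) (B x)]
  simp only [VectorField.lieBracket, operatorCurvature, map_add, map_sub, add_apply, sub_apply,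
    ContinuousLinearMap.comp_apply]
  abel

variable {n : ℕ} {Q : Type*} [TopologicalSpace Q]
  [ChartedSpace (EuclideanSpace ℝ (Fin (2 * n))) Q] [IsManifold (𝓡 (2 * n)) ∞ Q]
  {q : Q} {u : (p : Q) → CoframeAt n p} {U : Set Q}

/-- The coordinate expression of a vector field. -/
def localField (q : Q) (X : (p : Q) → TangentSpace (𝓡 (2 * n)) p)
    (x : EuclideanSpace ℝ (Fin (2 * n))) : EuclideanSpace ℝ (Fin (2 * n)) :=
  mfderiv (𝓡 (2 * n)) (𝓡 (2 * n)) (extChartAt (𝓡 (2 * n)) q)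
    ((extChartAt (𝓡 (2 * n)) q).symm x) (X ((extChartAt (𝓡 (2 * n)) q).symm x))

lemma chartFrame_localField {x : EuclideanSpace ℝ (Fin (2 * n))}
    (hx : x ∈ (extChartAt (𝓡 (2 * n)) q).target) (X : (p : Q) → TangentSpace (𝓡 (2 * n)) p) :
    chartFrame q x (localField q X x) = X ((extChartAt (𝓡 (2 * n)) q).symm x) :=
  chartFrame_mfderiv_extChartAt hx _

/-- The differential of the preferred chart at `q` is the identity at `q`, so coordinate vectors
there are tangent vectors. -/
lemma localCoframe_self (v : EuclideanSpace ℝ (Fin (2 * n))) :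
    localCoframe q u (extChartAt (𝓡 (2 * n)) q q) v = u q v := by
  have hx := mem_extChartAt_target (I := 𝓡 (2 * n)) q
  have hq := (extChartAt (𝓡 (2 * n)) q).left_inv (mem_extChartAt_source q)
  obtain ⟨w, hw⟩ := (chartFrameEquiv hx).symm.surjective v
  have h : ∀ p, p = q → ∀ w : EuclideanSpace ℝ (Fin (2 * n)), (u p w : Fin n → ℂ) =
      u q (mfderiv (𝓡 (2 * n)) (𝓡 (2 * n)) (extChartAt (𝓡 (2 * n)) q) p w :) := by
    rintro _ rfl w
    rw [mfderiv_extChartAt_self]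
    rfl
  have h2 : chartFrame q (extChartAt (𝓡 (2 * n)) q q) v = w := by
    rw [← hw]
    exact (chartFrameEquiv hx).apply_symm_apply w
  refine (congrArg (u _) h2).trans ((h _ hq w).trans ?_)
  exact congrArg (u q) hw

/-- The field is the inverse of the local coframe applied to its components, and both depend
smoothly on the point. -/
lemma SmoothCoframingOn.differentiableAt_localField (hu : SmoothCoframingOn n u U) (hU : IsOpen U)
    {x : EuclideanSpace ℝ (Fin (2 * n))} (hx : x ∈ (extChartAt (𝓡 (2 * n)) q).target)
    (hxU : (extChartAt (𝓡 (2 * n)) q).symm x ∈ U) {X : (p : Q) → TangentSpace (𝓡 (2 * n)) p}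
    (hX : SmoothVectorField X) : DifferentiableAt ℝ (localField q X) x := by
  have h1 := hu.contDiffAt_localComponents hU hx hxU hX.contMDiffAt
  obtain ⟨e, he⟩ := isInvertible_localCoframe (u := u) hx
  have h2 : ContDiffAt ℝ ∞ ContinuousLinearMap.inverse (localCoframe q u x) := by
    rw [← he]
    exact contDiffAt_map_inverse e
  have hO := isOpen_localDomain (E := EuclideanSpace ℝ (Fin (2 * n))) q hU
  have h3 := (h2.comp x ((hu.contDiffOn_localCoframe hU).contDiffAt
    (hO.mem_nhds ⟨hx, hxU⟩))).clm_apply h1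
  refine (h3.congr_of_eventuallyEq ?_).differentiableAt (by simp)
  filter_upwards [hO.mem_nhds ⟨hx, hxU⟩] with y hy
  obtain ⟨e, he⟩ := isInvertible_localCoframe (u := u) hy.1
  have h4 : localComponents q u X y = localCoframe q u y (localField q X y) :=
    (congrArg (u _) (chartFrame_localField hy.1 X)).symm
  rw [Function.comp_apply, h4, ← he, ContinuousLinearMap.inverse_equiv]
  exact (e.symm_apply_apply _).symm

lemma chartFrame_lieBracket_localField {x : EuclideanSpace ℝ (Fin (2 * n))}
    (hx : x ∈ (extChartAt (𝓡 (2 * n)) q).target) {X Y : (p : Q) → TangentSpace (𝓡 (2 * n)) p}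
    (hX : SmoothVectorField X) (hY : SmoothVectorField Y) :
    chartFrame q x (VectorField.lieBracket ℝ (localField q X) (localField q Y) x) =
    VectorField.mlieBracket (𝓡 (2 * n)) X Y ((extChartAt (𝓡 (2 * n)) q).symm x) :=
  (congrArg (chartFrame q x) (lieBracket_mfderiv_extChartAt hx hX.contMDiffAt
    hY.contMDiffAt)).trans (chartFrame_mfderiv_extChartAt hx _)

namespace S1GLStructure

variable {F : S1GLStructure n Q} {nabla : CovariantDerivative (𝓡 (2 * n))
    (EuclideanSpace ℝ (Fin (2 * n))) (TangentSpace (𝓡 (2 * n)) : Q → Type _)}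

/-- The affine curvature in coordinates. -/
theorem IsConnection.affineCurvature_eq (h : F.IsConnection nabla) (hU : IsOpen U)
    (hu : SmoothCoframingOn n u U)
    {O : Set (EuclideanSpace ℝ (Fin (2 * n)))} (hO : IsOpen O)
    (hOU : O ⊆ (extChartAt (𝓡 (2 * n)) q).target ∩ (extChartAt (𝓡 (2 * n)) q).symm ⁻¹' U)
    {x : EuclideanSpace ℝ (Fin (2 * n))} (hx : x ∈ O)
    {Γ : EuclideanSpace ℝ (Fin (2 * n)) → EuclideanSpace ℝ (Fin (2 * n)) →L[ℝ]
      (Fin n → ℂ) →L[ℝ] (Fin n → ℂ)}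
    (hΓ : DifferentiableAt ℝ Γ x)
    (key : ∀ x ∈ O, ∀ v, ∀ Z : (p : Q) → TangentSpace (𝓡 (2 * n)) p,
      ContMDiffAt (𝓡 (2 * n)) (𝓡 (2 * n)).tangent ∞
        (fun p => (⟨p, Z p⟩ : TangentBundle (𝓡 (2 * n)) Q))
        ((extChartAt (𝓡 (2 * n)) q).symm x) →
      u ((extChartAt (𝓡 (2 * n)) q).symm x) (nabla Z ((extChartAt (𝓡 (2 * n)) q).symm x)
        (chartFrame q x v)) = fderiv ℝ (localComponents q u Z) x v +
          Γ x v (localComponents q u Z x))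
    {X Y Z : (p : Q) → TangentSpace (𝓡 (2 * n)) p} (hX : SmoothVectorField X)
    (hY : SmoothVectorField Y) (hZ : SmoothVectorField Z) :
    u ((extChartAt (𝓡 (2 * n)) q).symm x)
        (affineCurvature nabla X Y Z ((extChartAt (𝓡 (2 * n)) q).symm x)) =
      operatorCurvature Γ x (localField q X x) (localField q Y x) (localComponents q u Z x) := by
  have hxt : x ∈ (extChartAt (𝓡 (2 * n)) q).target := (hOU hx).1
  have key2 : ∀ Y : (p : Q) → TangentSpace (𝓡 (2 * n)) p, ∀ y ∈ O,
      localComponents q u (fun p => nabla Z p (Y p)) y =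
        fderiv ℝ (localComponents q u Z) y (localField q Y y) +
          Γ y (localField q Y y) (localComponents q u Z y) := by
    intro Y y hy
    rw [← key y hy _ Z hZ.contMDiffAt, chartFrame_localField (hOU hy).1]
    rfl
  have key3 : ∀ {X Y : (p : Q) → TangentSpace (𝓡 (2 * n)) p}, SmoothVectorField Y →
      u ((extChartAt (𝓡 (2 * n)) q).symm x) (nabla (fun p => nabla Z p (Y p))
        ((extChartAt (𝓡 (2 * n)) q).symm x) (X ((extChartAt (𝓡 (2 * n)) q).symm x))) =
      fderiv ℝ (fun y => fderiv ℝ (localComponents q u Z) y (localField q Y y) +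
          Γ y (localField q Y y) (localComponents q u Z y)) x (localField q X x) +
        Γ x (localField q X x) (fderiv ℝ (localComponents q u Z) x (localField q Y x) +
          Γ x (localField q Y x) (localComponents q u Z x)) := by
    intro X Y hY
    have h1 : localComponents q u (fun p => nabla Z p (Y p)) =ᶠ[𝓝 x] fun y =>
        fderiv ℝ (localComponents q u Z) y (localField q Y y) +
          Γ y (localField q Y y) (localComponents q u Z y) := by
      filter_upwards [hO.mem_nhds hx] with y hy using key2 Y y hy
    rw [← chartFrame_localField hxt X, key x hx _ _ (h.contMDiffAt_nabla hZ hY.contMDiffAt),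
      h1.fderiv_eq, h1.eq_of_nhds]
  have hc := covariant_commutator_eq_operatorCurvature hΓ
    (hu.contDiffAt_localComponents hU hxt (hOU hx).2 hZ.contMDiffAt)
    (hu.differentiableAt_localField hU hxt (hOU hx).2 hX)
    (hu.differentiableAt_localField hU hxt (hOU hx).2 hY)
  rw [← key3 hY, ← key3 hX, ← key x hx _ Z hZ.contMDiffAt,
    chartFrame_lieBracket_localField hxt hX hY, ← map_sub, ← map_sub] at hc
  exact hc

end S1GLStructure

end CurvatureInCoordinates

/-! ### Slices of charts as embedded submanifolds. -/

section SliceSubmanifold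

variable {E N N' : Type} [NormedAddCommGroup E] [NormedSpace ℝ E] [NormedAddCommGroup N]
  [NormedSpace ℝ N] [NormedAddCommGroup N'] [NormedSpace ℝ N'] {Q : Type*} [TopologicalSpace Q]

/-- The slice `{pr₂ (κ⁻¹ ∘ Θ) = 0}` of a chart `Θ`. -/
def slice (Θ : OpenPartialHomeomorph Q E) (κ : (N × N') ≃L[ℝ] E) : Set Q :=
  {p | p ∈ Θ.source ∧ (κ.symm (Θ p)).2 = 0}

lemma apply_eq_of_mem_slice {Θ : OpenPartialHomeomorph Q E} {κ : (N × N') ≃L[ℝ] E} {p : Q}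
    (hp : p ∈ slice Θ κ) : κ ((κ.symm (Θ p)).1, 0) = Θ p := by
  rw [← hp.2, Prod.mk.eta, κ.apply_symm_apply]

open Classical in
/-- The chart of a slice. -/
def sliceChart (Θ : OpenPartialHomeomorph Q E) (κ : (N × N') ≃L[ℝ] E) (p₀ : slice Θ κ) :
    OpenPartialHomeomorph (slice Θ κ) N where
  toFun p := (κ.symm (Θ p)).1
  -- The base point `p₀` is only a default value outside the target.
  invFun ξ := if h : κ (ξ, 0) ∈ Θ.target then ⟨Θ.symm (κ (ξ, 0)), Θ.map_target h, by
    rw [Θ.right_inv h, κ.symm_apply_apply]⟩ else p₀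
  source := Set.univ
  target := {ξ | κ (ξ, 0) ∈ Θ.target}
  map_source' p _ := by
    rw [Set.mem_ofPred_eq, apply_eq_of_mem_slice p.2]
    exact Θ.map_source p.2.1
  map_target' _ _ := Set.mem_univ _
  left_inv' p _ := by
    have h := apply_eq_of_mem_slice p.2
    rw [dif_pos (by rw [h]; exact Θ.map_source p.2.1)]
    apply Subtype.ext
    simp only [h]
    exact Θ.left_inv p.2.1
  right_inv' ξ (h : κ (ξ, 0) ∈ Θ.target) := by
    rw [dif_pos h]
    simp only [Θ.right_inv h, κ.symm_apply_apply]
  open_source := isOpen_univ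
  open_target := Θ.open_target.preimage (by fun_prop)
  continuousOn_toFun := by
    refine Continuous.continuousOn (continuous_fst.comp (κ.symm.continuous.comp ?_))
    exact Θ.continuousOn.comp_continuous continuous_subtype_val fun p => p.2.1
  continuousOn_invFun := by
    refine Topology.IsInducing.subtypeVal.continuousOn_iff.2 ?_
    have h : ContinuousOn (fun ξ : N => Θ.symm (κ (ξ, 0))) {ξ | κ (ξ, 0) ∈ Θ.target} :=
      Θ.continuousOn_symm.comp (by fun_prop) fun ξ hξ => hξ
    refine h.congr fun ξ (hξ : κ (ξ, 0) ∈ Θ.target) => ?_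
    simp [hξ]

variable [ChartedSpace E Q] [IsManifold 𝓘(ℝ, E) ∞ Q]

/-- The slice carries one global chart. In this chart and `Θ` the inclusion is `η ↦ κ (η, 0)`, the
normal form of an immersion with complement `N'`. -/
lemma exists_slice_isSmoothEmbedding {Θ : OpenPartialHomeomorph Q E}
    (hΘ : Θ ∈ IsManifold.maximalAtlas 𝓘(ℝ, E) ∞ Q) (κ : (N × N') ≃L[ℝ] E)
    (hne : (slice Θ κ).Nonempty) :
    ∃ (_ : ChartedSpace N (slice Θ κ)) (_ : IsManifold 𝓘(ℝ, N) ∞ (slice Θ κ)),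
      Manifold.IsSmoothEmbedding 𝓘(ℝ, N) 𝓘(ℝ, E) ∞ (Subtype.val : slice Θ κ → Q) ∧
      ∀ (p : slice Θ κ) (η : N), mfderiv 𝓘(ℝ, E) 𝓘(ℝ, E) Θ (p : Q)
        (mfderiv 𝓘(ℝ, N) 𝓘(ℝ, E) (Subtype.val : slice Θ κ → Q) p η) = κ (η, 0) := by
  obtain ⟨p₀, hp₀⟩ := hne
  let χ := sliceChart Θ κ ⟨p₀, hp₀⟩
  have hχ : χ.source = Set.univ := rfl
  let : ChartedSpace N (slice Θ κ) := χ.singletonChartedSpace hχ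
  have hM : IsManifold 𝓘(ℝ, N) ∞ (slice Θ κ) := χ.isManifold_singleton hχ
  have hi : Manifold.IsSmoothEmbedding 𝓘(ℝ, N) 𝓘(ℝ, E) ∞ (Subtype.val : slice Θ κ → Q) := by
    refine ⟨⟨N', inferInstance, inferInstance, fun p => ?_⟩, Topology.IsEmbedding.subtypeVal⟩
    refine Manifold.IsImmersionAtOfComplement.mk_of_continuousAt continuousAt_subtype_val κ
      (chartAt N p) Θ (mem_chart_source N p) p.2.1 (IsManifold.chart_mem_maximalAtlas p) hΘ ?_
    intro ξ hξ
    have hξ' : κ (ξ, 0) ∈ Θ.target := by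
      have : ξ ∈ χ.target := by simpa using hξ
      exact this
    have h1 : ((chartAt N p).extend 𝓘(ℝ, N)).symm ξ = χ.symm ξ := rfl
    have h2 : ((χ.symm ξ : slice Θ κ) : Q) = Θ.symm (κ (ξ, 0)) :=
      congrArg Subtype.val (dif_pos hξ')
    rw [Function.comp_apply, Function.comp_apply, h1, h2]
    exact Θ.right_inv hξ'
  refine ⟨inferInstance, hM, hi, fun p η => ?_⟩
  have hv : MDifferentiableAt 𝓘(ℝ, N) 𝓘(ℝ, E) (Subtype.val : slice Θ κ → Q) p :=
    hi.contMDiff.contMDiffAt.mdifferentiableAt (by simp)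
  have hΘd : MDifferentiableAt 𝓘(ℝ, E) 𝓘(ℝ, E) Θ (p : Q) :=
    (contMDiffAt_of_mem_maximalAtlas hΘ p.2.1).mdifferentiableAt (by simp)
  have hc := mfderiv_comp p hΘd hv
  let κ₁ : N →L[ℝ] E := κ.toContinuousLinearMap ∘L ContinuousLinearMap.inl ℝ N N'
  have he : (Θ ∘ (Subtype.val : slice Θ κ → Q)) = κ₁ ∘ extChartAt 𝓘(ℝ, N) p := by
    funext p'
    exact (apply_eq_of_mem_slice p'.2).symm
  have hd : MDifferentiableAt 𝓘(ℝ, N) 𝓘(ℝ, E) κ₁ (extChartAt 𝓘(ℝ, N) p p) :=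
    κ₁.differentiableAt.mdifferentiableAt
  rw [he, mfderiv_comp p hd (mdifferentiableAt_extChartAt (mem_chart_source N p)),
    mfderiv_extChartAt_self, mfderiv_eq_fderiv, κ₁.fderiv] at hc
  exact (congrArg (fun f => f η) hc).symm

end SliceSubmanifold

/-! ### Submanifolds parametrized by an immersion. -/

section GraphSubmanifold

variable {E N N' : Type} [NormedAddCommGroup E] [NormedSpace ℝ E] [CompleteSpace E]
  [NormedAddCommGroup N] [NormedSpace ℝ N] [NormedAddCommGroup N'] [NormedSpace ℝ N']
  {Q : Type*} [TopologicalSpace Q] [ChartedSpace E Q] [IsManifold 𝓘(ℝ, E) ∞ Q]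

/-- A map into the domain of a chart that is an immersion at one point parametrizes a submanifold
near that point. -/
theorem exists_submanifold_of_immersion (q : Q) (κ : (N × N') ≃L[ℝ] E) {g : N → E} {B : Set N}
    (hB : IsOpen B) (h0 : 0 ∈ B) (hg : ContDiffOn ℝ ∞ g B)
    (hg0 : g 0 = extChartAt 𝓘(ℝ, E) q q)
    (hgκ : ∀ η, fderiv ℝ g 0 η = κ (η, 0)) :
    ∃ (P : Set Q) (_ : ChartedSpace N P) (_ : IsManifold 𝓘(ℝ, N) ∞ P) (_ : q ∈ P),
      Manifold.IsSmoothEmbedding 𝓘(ℝ, N) 𝓘(ℝ, E) ∞ (Subtype.val : P → Q) ∧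
      ∀ p : P, (p : Q) ∈ (extChartAt 𝓘(ℝ, E) q).source ∧
        Function.Injective (mfderiv 𝓘(ℝ, N) 𝓘(ℝ, E) (Subtype.val : P → Q) p) ∧
        ∃ ξ ∈ B, g ξ = extChartAt 𝓘(ℝ, E) q p ∧ ((p : Q) = q → ξ = 0) ∧
          ∀ η, mfderiv 𝓘(ℝ, E) 𝓘(ℝ, E) (extChartAt 𝓘(ℝ, E) q) (p : Q)
            (mfderiv 𝓘(ℝ, N) 𝓘(ℝ, E) (Subtype.val : P → Q) p η) = fderiv ℝ g ξ η := by
  let π₁ : E →L[ℝ] N := ContinuousLinearMap.fst ℝ N N' ∘L κ.symm.toContinuousLinearMap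
  let π₂ : E →L[ℝ] E := κ.toContinuousLinearMap ∘L ContinuousLinearMap.inr ℝ N N' ∘L
    ContinuousLinearMap.snd ℝ N N' ∘L κ.symm.toContinuousLinearMap
  -- `G` extends the parametrization to a full neighbourhood and has derivative the identity at `0`.
  -- Composing the chart with its local inverse straightens the image of `g` to a slice.
  let G : E → E := fun y => g (π₁ y) + π₂ y
  have hGs : ContDiffOn ℝ ∞ G (π₁ ⁻¹' B) :=
    (hg.comp π₁.contDiff.contDiffOn fun _ h => h).add π₂.contDiff.contDiffOn
  have hGd : ∀ y ∈ π₁ ⁻¹' B, HasFDerivAt G (fderiv ℝ g (π₁ y) ∘L π₁ + π₂) y := fun y hy =>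
    (((hg.contDiffAt (hB.mem_nhds hy)).differentiableAt (by simp)).hasFDerivAt.comp y
      π₁.hasFDerivAt).add π₂.hasFDerivAt
  have hOo : IsOpen (π₁ ⁻¹' B ∩ G ⁻¹' (extChartAt 𝓘(ℝ, E) q).target) :=
    hGs.continuousOn.isOpen_inter_preimage (hB.preimage π₁.continuous) (isOpen_extChartAt_target q)
  have hG0 : G 0 = extChartAt 𝓘(ℝ, E) q q := by simp [G, hg0]
  have h0O : (0 : E) ∈ π₁ ⁻¹' B ∩ G ⁻¹' (extChartAt 𝓘(ℝ, E) q).target := by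
    refine ⟨by simpa using h0, ?_⟩
    rw [Set.mem_preimage, hG0]
    exact mem_extChartAt_target q
  have hG0d : HasFDerivAt G ((ContinuousLinearEquiv.refl ℝ E : E ≃L[ℝ] E) : E →L[ℝ] E) 0 := by
    refine (hGd 0 h0O.1).congr_fderiv ?_
    ext y
    rw [add_apply, ContinuousLinearMap.comp_apply, map_zero, hgκ]
    change κ ((κ.symm y).1, 0) + κ (0, (κ.symm y).2) = y
    rw [← map_add, Prod.mk_add_mk, add_zero, zero_add, Prod.mk.eta, κ.apply_symm_apply]
  obtain ⟨Ψ, hΨ0, hΨs, hΨG, hΨsymm⟩ := exists_openPartialHomeomorph_of_contDiffOn hOo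
    (hGs.mono Set.inter_subset_left) h0O hG0d
  let Θ : OpenPartialHomeomorph Q E := (chartAt E q).trans Ψ.symm
  have hΘs : Θ.source = (extChartAt 𝓘(ℝ, E) q).source ∩ extChartAt 𝓘(ℝ, E) q ⁻¹' Ψ.target := by
    simp [Θ]
  have hΘ : Θ ∈ IsManifold.maximalAtlas 𝓘(ℝ, E) ∞ Q := by
    refine OpenPartialHomeomorph.mem_maximalAtlas_of_contMDiffOn Θ ?_ ?_
    · exact hΨsymm.contMDiffOn.comp (contMDiffOn_chart.mono fun p hp => hp.1) fun p hp => hp.2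
    · have h1 : ContMDiffOn 𝓘(ℝ, E) 𝓘(ℝ, E) ∞ Ψ Ψ.source :=
        ((hGs.mono fun y hy => (hΨs hy).1).congr fun y _ => hΨG y).contMDiffOn
      exact contMDiffOn_chart_symm.comp (h1.mono fun p hp => hp.1) fun p hp => hp.2
  have hqs : q ∈ Θ.source := by
    rw [hΘs]
    refine ⟨mem_extChartAt_source q, ?_⟩
    rw [Set.mem_preimage, ← hG0, ← hΨG]
    exact Ψ.map_source hΨ0
  have hΘe : ∀ p, Θ p = Ψ.symm (extChartAt 𝓘(ℝ, E) q p) := fun p => rfl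
  have hq : q ∈ slice Θ κ := by
    refine ⟨hqs, ?_⟩
    rw [hΘe, ← hG0, ← hΨG, Ψ.left_inv hΨ0, map_zero]
    rfl
  obtain ⟨hC, hM, hi, hd⟩ := exists_slice_isSmoothEmbedding hΘ κ ⟨q, hq⟩
  refine ⟨slice Θ κ, hC, hM, hq, hi, fun p => ?_⟩
  have hps := p.2.1
  rw [hΘs] at hps
  have hy : Θ p ∈ Ψ.source := Ψ.map_target hps.2
  have hκ := apply_eq_of_mem_slice p.2
  have hπ : π₂ (Θ p) = 0 := by
    change κ (0, (κ.symm (Θ p)).2) = 0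
    rw [p.2.2]
    exact map_zero κ
  have hGp : G (Θ p) = extChartAt 𝓘(ℝ, E) q p := by
    rw [← hΨG, hΘe, Ψ.right_inv hps.2]
  refine ⟨hps.1, fun η η' h => ?_, π₁ (Θ p), (hΨs hy).1, ?_, fun hpq => ?_, fun η => ?_⟩
  · have h1 := (hd p η).symm.trans ((congrArg _ h).trans (hd p η'))
    exact (Prod.ext_iff.1 (κ.injective h1)).1
  · rw [← hGp]
    simp only [G, hπ, add_zero]
  · rw [hΘe, hpq, ← hG0, ← hΨG, Ψ.left_inv hΨ0, map_zero]
  · have hΘd : MDifferentiableAt 𝓘(ℝ, E) 𝓘(ℝ, E) Θ (p : Q) :=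
      (contMDiffAt_of_mem_maximalAtlas hΘ p.2.1).mdifferentiableAt (by simp)
    have he : extChartAt 𝓘(ℝ, E) q =ᶠ[𝓝 (p : Q)] G ∘ Θ := by
      filter_upwards [Θ.open_source.mem_nhds p.2.1] with p' hp'
      rw [hΘs] at hp'
      rw [Function.comp_apply, ← hΨG, hΘe, Ψ.right_inv hp'.2]
    have hG := hGd (Θ p) (hΨs hy).1
    rw [he.mfderiv_eq, mfderiv_comp (p : Q) hG.differentiableAt.mdifferentiableAt hΘd,
      mfderiv_eq_fderiv, hG.fderiv]
    refine (congrArg (fderiv ℝ g (π₁ (Θ p)) ∘L π₁ + π₂) (hd p η)).trans ?_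
    have h1 : π₁ (κ (η, 0)) = η := by
      change (κ.symm (κ (η, 0))).1 = η
      rw [κ.symm_apply_apply]
    have h2 : π₂ (κ (η, 0)) = 0 := by
      change κ (0, (κ.symm (κ (η, 0))).2) = 0
      rw [κ.symm_apply_apply]
      exact map_zero κ
    rw [add_apply, ContinuousLinearMap.comp_apply, h1, h2, add_zero]

end GraphSubmanifold

/-! ### Linear algebra of the planes `e^{iθ}ℝⁿ`. -/

section RotatedPlanes

variable {n : ℕ}

/-- The decomposition of `ℂⁿ` into real and imaginary parts. -/
def realImagEquiv (n : ℕ) :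
    (EuclideanSpace ℝ (Fin n) × EuclideanSpace ℝ (Fin n)) ≃L[ℝ] (Fin n → ℂ) :=
  ContinuousLinearEquiv.equivOfInverse
    ((realInclusion n).coprod (complexSMul n Complex.I ∘L realInclusion n))
    ((imPart n ∘L complexSMul n Complex.I).prod (imPart n))
    (fun z => by ext i <;> simp) (fun z => by
      ext i
      simp [mul_comm Complex.I, Complex.re_add_im])

lemma finrank_rotatedRealPlane (θ : ℝ) : Module.finrank ℝ (rotatedRealPlane n θ) = n := by
  let L : (Fin n → ℝ) →ₗ[ℝ] (Fin n → ℂ) :=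
    { toFun := fun x i => Complex.exp (θ * Complex.I) * (x i : ℂ)
      map_add' := fun x y => by ext i; simp [mul_add]
      map_smul' := fun c x => by ext i; simp; ring }
  have hL : Function.Injective L := fun x y h => by
    ext i
    simpa [L, Complex.exp_ne_zero] using congrFun h i
  have hr : L.range = rotatedRealPlane n θ := by
    ext z
    exact ⟨fun ⟨x, hx⟩ => ⟨x, fun i => congrFun hx.symm i⟩,
      fun ⟨x, hx⟩ => ⟨x, funext fun i => (hx i).symm⟩⟩
  rw [← hr, LinearMap.finrank_range_of_inj hL, Module.finrank_fin_fun]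

variable {V : Type*} [AddCommGroup V] [Module ℝ V] [TopologicalSpace V]

lemma finrank_comap_rotatedRealPlane (f : V ≃L[ℝ] (Fin n → ℂ)) (θ : ℝ) :
    Module.finrank ℝ ((rotatedRealPlane n θ).comap (f : V →ₗ[ℝ] (Fin n → ℂ))) = n := by
  refine ((f.toLinearEquiv.submoduleMap _).finrank_eq.trans ?_).trans
    (finrank_rotatedRealPlane (n := n) θ)
  exact congrArg (fun S : Submodule ℝ (Fin n → ℂ) => Module.finrank ℝ S)
    (Submodule.map_comap_eq_of_surjective f.surjective _)

/-- By equality of dimensions an inclusion suffices, so tangent planes only have to be tested vector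
by vector. -/
lemma eq_comap_rotatedRealPlane (f : V ≃L[ℝ] (Fin n → ℂ)) {θ : ℝ} {S : Submodule ℝ V}
    (hS : Module.finrank ℝ S = n) (h : ∀ v ∈ S, f v ∈ rotatedRealPlane n θ) :
    S = (rotatedRealPlane n θ).comap (f : V →ₗ[ℝ] (Fin n → ℂ)) := by
  have : FiniteDimensional ℝ V := f.symm.toLinearEquiv.finiteDimensional
  exact Submodule.eq_of_le_of_finrank_eq h (hS.trans (finrank_comap_rotatedRealPlane f θ).symm)

/-- The real factor preserves `ℝⁿ` and the phases add, so the group permutes the rotated planes by a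
shift of the angle. -/
lemma mulVec_mem_rotatedRealPlane {g : Matrix.GeneralLinearGroup (Fin n) ℂ} (hg : g ∈ S1GL n) :
    ∃ η : ℝ, ∀ θ, ∀ z ∈ rotatedRealPlane n θ,
      (g : Matrix (Fin n) (Fin n) ℂ).mulVec z ∈ rotatedRealPlane n (η + θ) := by
  obtain ⟨η, A, hA⟩ := hg
  refine ⟨η, fun θ z ⟨x, hx⟩ => ⟨(A : Matrix (Fin n) (Fin n) ℝ).mulVec x, fun i => ?_⟩⟩
  rw [hA]
  simp only [Matrix.mulVec, dotProduct, Matrix.smul_apply, Matrix.map_apply, smul_eq_mul, hx,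
    Complex.ofReal_add, Complex.ofReal_sum, Complex.ofReal_mul, Finset.mul_sum, add_mul,
    Complex.exp_add]
  exact Finset.sum_congr rfl fun j _ => by ring

end RotatedPlanes

/-! ### Dependence on the coframe within a fibre. -/

section Fibres

variable {n : ℕ} {Q : Type*} [TopologicalSpace Q]
  [ChartedSpace (EuclideanSpace ℝ (Fin (2 * n))) Q] [IsManifold (𝓡 (2 * n)) ∞ Q]
  {F : S1GLStructure n Q} {q : Q}

namespace S1GLStructure

/-- Two coframes of a fibre differ by a group element, which only shifts the angle. Hence one fixed
coframe describes the whole circle. -/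
lemma eq_comap_of_mem_circle {f : CoframeAt n q} (hf : f ∈ F.fibre q)
    {S : Submodule ℝ (TangentSpace (𝓡 (2 * n)) q)} (hS : S ∈ F.circle q) :
    ∃ θ : ℝ, S = (rotatedRealPlane n θ).comap
      (f : TangentSpace (𝓡 (2 * n)) q →ₗ[ℝ] (Fin n → ℂ)) := by
  obtain ⟨f', hf', θ', rfl⟩ := hS
  obtain ⟨g, hg, hgf⟩ := (F.mem_fibre_iff q f' f hf').1 hf
  obtain ⟨η, hη⟩ := mulVec_mem_rotatedRealPlane hg
  refine ⟨η + θ', eq_comap_rotatedRealPlane f (finrank_comap_rotatedRealPlane f' θ')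
    fun v hv => ?_⟩
  rw [hgf]
  exact hη _ _ hv

/-- The action of a complex matrix on `ℂⁿ`, as a real linear equivalence. -/
def mulVecEquiv (g : Matrix.GeneralLinearGroup (Fin n) ℂ) : (Fin n → ℂ) ≃L[ℝ] (Fin n → ℂ) :=
  ContinuousLinearEquiv.equivOfInverse
    (LinearMap.toContinuousLinearMap
      ((g : Matrix (Fin n) (Fin n) ℂ).mulVecLin.restrictScalars ℝ))
    (LinearMap.toContinuousLinearMap
      (((g⁻¹ : Matrix.GeneralLinearGroup (Fin n) ℂ) :
        Matrix (Fin n) (Fin n) ℂ).mulVecLin.restrictScalars ℝ))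
    (fun z => by
      change Matrix.mulVec (g⁻¹ : Matrix.GeneralLinearGroup (Fin n) ℂ).val
        (Matrix.mulVec g.val z) = z
      rw [Matrix.mulVec_mulVec, ← Units.val_mul, inv_mul_cancel, Units.val_one, Matrix.one_mulVec])
    (fun z => by
      change Matrix.mulVec g.val
        (Matrix.mulVec (g⁻¹ : Matrix.GeneralLinearGroup (Fin n) ℂ).val z) = z
      rw [Matrix.mulVec_mulVec, ← Units.val_mul, mul_inv_cancel, Units.val_one, Matrix.one_mulVec])

/-- A given local section is multiplied by the constant group element carrying its value at `q` to
`f`. -/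
lemma exists_section_through {f : CoframeAt n q} (hf : f ∈ F.fibre q) :
    ∃ (U : Set Q) (u : (p : Q) → CoframeAt n p), IsOpen U ∧ q ∈ U ∧ (∀ p ∈ U, u p ∈ F.fibre p) ∧
      SmoothCoframingOn n u U ∧ u q = f := by
  obtain ⟨U, u, hU, hq, huF, hu⟩ := F.exists_smooth_section q
  obtain ⟨g, hg, hgf⟩ := (F.mem_fibre_iff q (u q) f (huF q hq)).1 hf
  refine ⟨U, fun p => (u p).trans (mulVecEquiv g), hU, hq, fun p hp =>
    (F.mem_fibre_iff p (u p) _ (huF p hp)).2 ⟨g, hg, fun X => rfl⟩, ?_, ?_⟩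
  · exact (mulVecEquiv g).contDiff.contMDiff.comp_contMDiffOn hu
  · exact ContinuousLinearEquiv.ext (funext fun X => (hgf X).symm)

end S1GLStructure

lemma localCoframe_mfderiv_extChartAt {u : (p : Q) → CoframeAt n p} {p : Q}
    (hp : p ∈ (extChartAt (𝓡 (2 * n)) q).source) (X : TangentSpace (𝓡 (2 * n)) p) :
    localCoframe q u (extChartAt (𝓡 (2 * n)) q p)
      (mfderiv (𝓡 (2 * n)) (𝓡 (2 * n)) (extChartAt (𝓡 (2 * n)) q) p X) = u p X := by
  obtain ⟨x, hx, rfl⟩ : ∃ x ∈ (extChartAt (𝓡 (2 * n)) q).target,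
      (extChartAt (𝓡 (2 * n)) q).symm x = p :=
    ⟨_, (extChartAt (𝓡 (2 * n)) q).map_source hp, (extChartAt (𝓡 (2 * n)) q).left_inv hp⟩
  have h1 : ∀ v : EuclideanSpace ℝ (Fin (2 * n)), localCoframe q u (extChartAt (𝓡 (2 * n)) q
      ((extChartAt (𝓡 (2 * n)) q).symm x)) v = localCoframe q u x v := fun v => by
    rw [(extChartAt (𝓡 (2 * n)) q).right_inv hx]
  exact (h1 _).trans (congrArg (u _) (chartFrame_mfderiv_extChartAt hx X))

end Fibres

/-! ### Construction of submanifolds belonging to the circle bundle. -/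

section Planes

variable {n : ℕ} {Q : Type*} [TopologicalSpace Q]
  [ChartedSpace (EuclideanSpace ℝ (Fin (2 * n))) Q] [IsManifold (𝓡 (2 * n)) ∞ Q]
  {F : S1GLStructure n Q} {q : Q} {u : (p : Q) → CoframeAt n p} {U : Set Q}

namespace S1GLStructure

lemma exists_mem_S1GL_rotation (θ : ℝ) : ∃ g ∈ S1GL n, ∀ z : Fin n → ℂ,
    (g : Matrix (Fin n) (Fin n) ℂ).mulVec z = Complex.exp (θ * Complex.I) • z := by
  have h1 : Complex.exp (θ * Complex.I) * Complex.exp (-θ * Complex.I) = 1 := by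
    rw [← Complex.exp_add]
    simp
  refine ⟨⟨Complex.exp (θ * Complex.I) • 1, Complex.exp (-θ * Complex.I) • 1, ?_, ?_⟩,
    ⟨θ, 1, ?_⟩, fun z => ?_⟩
  · rw [Matrix.smul_mul, Matrix.mul_smul, smul_smul, h1, one_smul, one_mul]
  · rw [Matrix.smul_mul, Matrix.mul_smul, smul_smul, mul_comm, h1, one_smul, one_mul]
  · ext i j
    by_cases h : i = j <;> simp [h]
  · rw [Matrix.smul_mulVec, Matrix.one_mulVec]

/-- Every plane of the circle bundle is the preimage of `ℝⁿ` under a coframe of the structure. -/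
lemma exists_eq_comap_zero_of_mem_circle {S : Submodule ℝ (TangentSpace (𝓡 (2 * n)) q)}
    (hS : S ∈ F.circle q) : ∃ f ∈ F.fibre q, S = (rotatedRealPlane n 0).comap
      (f : TangentSpace (𝓡 (2 * n)) q →ₗ[ℝ] (Fin n → ℂ)) := by
  obtain ⟨f, hf, θ, rfl⟩ := hS
  -- Rotating the coframe by `-θ` absorbs the angle.
  obtain ⟨g, hg, hgz⟩ := exists_mem_S1GL_rotation (n := n) (-θ)
  refine ⟨f.trans (mulVecEquiv g),
    (F.mem_fibre_iff q f _ hf).2 ⟨g, hg, fun X => rfl⟩,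
    eq_comap_rotatedRealPlane _ (finrank_comap_rotatedRealPlane f θ) ?_⟩
  rintro v ⟨x, hx⟩
  refine ⟨x, fun i => ?_⟩
  have h1 : (f.trans (mulVecEquiv g)) v = Complex.exp ((-θ : ℝ) * Complex.I) • f v := hgz (f v)
  rw [h1, Pi.smul_apply, smul_eq_mul, show f v i = _ from hx i, ← mul_assoc, ← Complex.exp_add]
  simp

lemma _root_.realInclusion_mem_rotatedRealPlane (x : EuclideanSpace ℝ (Fin n)) :
    realInclusion n x ∈ rotatedRealPlane n 0 :=
  ⟨fun i => x i, fun i => by simp⟩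

/-- If the imaginary part of the connection form is closed on the planes `e^{iθ}ℝⁿ`, there are
submanifolds with tangent planes in the circle bundle. -/
theorem exists_submanifold (huF : ∀ p ∈ U, u p ∈ F.fibre p)
    {O : Set (EuclideanSpace ℝ (Fin (2 * n)))}
    (hOU : O ⊆ (extChartAt (𝓡 (2 * n)) q).target ∩ (extChartAt (𝓡 (2 * n)) q).symm ⁻¹' U)
    (hqO : extChartAt (𝓡 (2 * n)) q q ∈ O)
    {α : EuclideanSpace ℝ (Fin (2 * n)) → EuclideanSpace ℝ (Fin (2 * n)) →L[ℝ] ℝ}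
    {φ : Fin n → Fin n → EuclideanSpace ℝ (Fin (2 * n)) → EuclideanSpace ℝ (Fin (2 * n)) →L[ℝ] ℝ}
    (h : IsTorsionFreeCoframe O (localCoframe q u) α φ)
    (hα : ∀ x ∈ O, ∀ θ v w, localCoframe q u x v ∈ rotatedRealPlane n θ →
      localCoframe q u x w ∈ rotatedRealPlane n θ → fderiv ℝ α x v w = fderiv ℝ α x w v) :
    ∃ (P : Set Q) (_ : ChartedSpace (EuclideanSpace ℝ (Fin n)) P) (_ : IsManifold (𝓡 n) ∞ P)
      (hq : q ∈ P), F.Belongs P ∧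
        (mfderiv (𝓡 n) (𝓡 (2 * n)) (Subtype.val : P → Q) ⟨q, hq⟩).range =
          (rotatedRealPlane n 0).comap
            (u q : TangentSpace (𝓡 (2 * n)) q →ₗ[ℝ] (Fin n → ℂ)) := by
  obtain ⟨g, B, hB, h0, hg, hgO, hg0, hgu, hgB⟩ := h.exists_integral_manifold hα hqO
  obtain ⟨e, he⟩ := isInvertible_localCoframe (u := u) (mem_extChartAt_target (I := 𝓡 (2 * n)) q)
  obtain ⟨P, hC, hM, hq, hi, hP⟩ := exists_submanifold_of_immersion q
    ((realImagEquiv n).trans e.symm) hB h0 hg hg0 (fun η => by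
      have h1 := hgu η
      rw [← he] at h1
      have h2 : realImagEquiv n (η, 0) = realInclusion n η := by
        change realInclusion n η + complexSMul n Complex.I (realInclusion n 0) = _
        rw [map_zero, map_zero, add_zero]
      change _ = e.symm (realImagEquiv n (η, 0))
      rw [h2, ← h1]
      exact (e.symm_apply_apply _).symm)
  have hfin : ∀ p : P, Module.finrank ℝ
      (mfderiv (𝓡 n) (𝓡 (2 * n)) (Subtype.val : P → Q) p).range = n := fun p =>
    (LinearMap.finrank_range_of_inj (hP p).2.1).trans (finrank_euclideanSpace_fin (𝕜 := ℝ))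
  have hu : ∀ p : P, ∀ ξ, g ξ = extChartAt (𝓡 (2 * n)) q p →
      (∀ η, mfderiv (𝓡 (2 * n)) (𝓡 (2 * n)) (extChartAt (𝓡 (2 * n)) q) (p : Q)
        (mfderiv (𝓡 n) (𝓡 (2 * n)) (Subtype.val : P → Q) p η) = fderiv ℝ g ξ η) →
      ∀ η, u p (mfderiv (𝓡 n) (𝓡 (2 * n)) (Subtype.val : P → Q) p η) =
        localCoframe q u (g ξ) (fderiv ℝ g ξ η) := by
    intro p ξ hξ hd η
    rw [hξ, ← hd]
    exact (localCoframe_mfderiv_extChartAt (hP p).1 _).symm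
  refine ⟨P, hC, hM, hq, ⟨hi, fun p => ?_⟩, ?_⟩
  · obtain ⟨hps, -, ξ, hξ, hgξ, -, hd⟩ := hP p
    obtain ⟨θ, hθ⟩ := hgB ξ hξ
    have hpU : (p : Q) ∈ U := by
      have := (hOU (hgO hξ)).2
      rwa [hgξ, Set.mem_preimage, (extChartAt (𝓡 (2 * n)) q).left_inv hps] at this
    refine ⟨u p, huF p hpU, θ, eq_comap_rotatedRealPlane _ (hfin p) ?_⟩
    rintro _ ⟨η, rfl⟩
    exact (congrArg (· ∈ rotatedRealPlane n θ) (hu p ξ hgξ hd η)).mpr (hθ η)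
  · obtain ⟨-, -, ξ, -, hgξ, hξ0, hd⟩ := hP ⟨q, hq⟩
    obtain rfl := hξ0 rfl
    refine eq_comap_rotatedRealPlane _ (hfin ⟨q, hq⟩) ?_
    rintro _ ⟨η, rfl⟩
    have h1 := hu ⟨q, hq⟩ 0 hgξ hd η
    rw [hg0] at h1
    replace h1 := h1.trans (hgu η)
    exact (congrArg (· ∈ rotatedRealPlane n 0) h1).mpr
      (realInclusion_mem_rotatedRealPlane _)

end S1GLStructure
end Planes

/-! ### The obstruction on submanifolds belonging to the circle bundle. -/

section IntegrableStructures

variable {n : ℕ} {Q : Type*} [TopologicalSpace Q]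
  [ChartedSpace (EuclideanSpace ℝ (Fin (2 * n))) Q] [IsManifold (𝓡 (2 * n)) ∞ Q]
  {F : S1GLStructure n Q} {q : Q} {u : (p : Q) → CoframeAt n p} {U : Set Q}

namespace S1GLStructure

/-- Planes of the circle have dimension `n`, so rank-nullity leaves no kernel. -/
lemma injective_of_range_mem_circle {V : Type} [AddCommGroup V] [Module ℝ V]
    [FiniteDimensional ℝ V] (hV : Module.finrank ℝ V = n)
    {f : V →ₗ[ℝ] TangentSpace (𝓡 (2 * n)) q} (hf : f.range ∈ F.circle q) :
    Function.Injective f := by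
  obtain ⟨u, -, θ, hθ⟩ := hf
  have h1 : Module.finrank ℝ f.range = n := by
    rw [hθ]
    exact finrank_comap_rotatedRealPlane u θ
  have h2 := f.finrank_range_add_finrank_ker
  rw [← LinearMap.ker_eq_bot]
  exact Submodule.finrank_eq_zero.1 (by omega)

/-- The imaginary part of the connection form is closed on the tangent planes of submanifolds that
belong to the circle bundle. -/
theorem Belongs.fderiv_comm (hn : 1 < n) (huF : ∀ p ∈ U, u p ∈ F.fibre p)
    {O : Set (EuclideanSpace ℝ (Fin (2 * n)))}
    (hOU : O ⊆ (extChartAt (𝓡 (2 * n)) q).target ∩ (extChartAt (𝓡 (2 * n)) q).symm ⁻¹' U)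
    (hqO : extChartAt (𝓡 (2 * n)) q q ∈ O)
    {α : EuclideanSpace ℝ (Fin (2 * n)) → EuclideanSpace ℝ (Fin (2 * n)) →L[ℝ] ℝ}
    {φ : Fin n → Fin n → EuclideanSpace ℝ (Fin (2 * n)) → EuclideanSpace ℝ (Fin (2 * n)) →L[ℝ] ℝ}
    (h : IsTorsionFreeCoframe O (localCoframe q u) α φ)
    {P : Set Q} [ChartedSpace (EuclideanSpace ℝ (Fin n)) P] [IsManifold (𝓡 n) ∞ P]
    (hP : F.Belongs P) (hq : q ∈ P) {v w : EuclideanSpace ℝ (Fin (2 * n))}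
    (hv : v ∈ (mfderiv (𝓡 n) (𝓡 (2 * n)) (Subtype.val : P → Q) ⟨q, hq⟩).range)
    (hw : w ∈ (mfderiv (𝓡 n) (𝓡 (2 * n)) (Subtype.val : P → Q) ⟨q, hq⟩).range) :
    fderiv ℝ α (extChartAt (𝓡 (2 * n)) q q) v w =
      fderiv ℝ α (extChartAt (𝓡 (2 * n)) q q) w v := by
  set p₀ : P := ⟨q, hq⟩ with hp₀
  have hval : ∀ p : P, ContMDiffAt (𝓡 n) (𝓡 (2 * n)) ∞ (Subtype.val : P → Q) p := fun p =>
    hP.1.contMDiff.contMDiffAt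
  let W : Set P := Subtype.val ⁻¹' ((extChartAt (𝓡 (2 * n)) q).source ∩
    extChartAt (𝓡 (2 * n)) q ⁻¹' O)
  have hW : IsOpen W := ((continuousOn_extChartAt q).isOpen_inter_preimage
    (isOpen_extChartAt_source q) h.isOpen).preimage continuous_subtype_val
  let B := (extChartAt (𝓡 n) p₀).target ∩ (extChartAt (𝓡 n) p₀).symm ⁻¹' W
  have hB : IsOpen B := isOpen_localDomain (E := EuclideanSpace ℝ (Fin n)) p₀ hW
  let j : EuclideanSpace ℝ (Fin n) → EuclideanSpace ℝ (Fin (2 * n)) := fun ξ =>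
    extChartAt (𝓡 (2 * n)) q ((extChartAt (𝓡 n) p₀).symm ξ : P)
  have he : ∀ p ∈ W, ContMDiffAt (𝓡 (2 * n)) (𝓡 (2 * n)) ∞ (extChartAt (𝓡 (2 * n)) q)
      ((p : P) : Q) := fun p hp =>
    contMDiffAt_extChartAt' (by rw [← extChartAt_source (𝓡 (2 * n))]; exact hp.1)
  have hjs : ContDiffOn ℝ ∞ j B := by
    rintro ξ hξ
    exact ((he _ hξ.2).comp ξ ((hval _).comp ξ
      (contMDiffAt_chartSymm hξ.1))).contDiffAt.contDiffWithinAt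
  have hjd : ∀ ξ ∈ B, ∀ η, fderiv ℝ j ξ η = mfderiv (𝓡 (2 * n)) (𝓡 (2 * n))
      (extChartAt (𝓡 (2 * n)) q) ((extChartAt (𝓡 n) p₀).symm ξ : P)
      (mfderiv (𝓡 n) (𝓡 (2 * n)) (Subtype.val : P → Q) ((extChartAt (𝓡 n) p₀).symm ξ)
        (chartFrame p₀ ξ η)) := by
    intro ξ hξ η
    have h1 := mfderiv_comp ξ ((hval ((extChartAt (𝓡 n) p₀).symm ξ)).mdifferentiableAt (by simp))
      ((contMDiffAt_chartSymm hξ.1).mdifferentiableAt (by simp))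
    have h2 := mfderiv_comp ξ (g := extChartAt (𝓡 (2 * n)) q)
      (f := (Subtype.val : P → Q) ∘ (extChartAt (𝓡 n) p₀).symm)
      ((he _ hξ.2).mdifferentiableAt (by simp))
      (((hval _).comp ξ (contMDiffAt_chartSymm hξ.1)).mdifferentiableAt (by simp))
    rw [h1, mfderiv_eq_fderiv] at h2
    exact congrArg (fun f => f η) h2
  have hju : ∀ ξ ∈ B, ∀ η, localCoframe q u (j ξ) (fderiv ℝ j ξ η) =
      u ((extChartAt (𝓡 n) p₀).symm ξ : P)
        (mfderiv (𝓡 n) (𝓡 (2 * n)) (Subtype.val : P → Q) ((extChartAt (𝓡 n) p₀).symm ξ)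
          (chartFrame p₀ ξ η)) := by
    intro ξ hξ η
    rw [hjd ξ hξ]
    exact localCoframe_mfderiv_extChartAt hξ.2.1 _
  have hi : ∀ p : P, Function.Injective (mfderiv (𝓡 n) (𝓡 (2 * n)) (Subtype.val : P → Q) p) :=
    fun p => injective_of_range_mem_circle (V := EuclideanSpace ℝ (Fin n))
      finrank_euclideanSpace_fin (hP.2 p)
  have hji : ∀ ξ ∈ B, Function.Injective (fderiv ℝ j ξ) := fun ξ hξ η η' hη =>
    (chartFrameEquiv hξ.1).injective (hi _ ((u _).injective
      ((hju ξ hξ η).symm.trans ((congrArg _ hη).trans (hju ξ hξ η')))))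
  have hξ₀ : extChartAt (𝓡 n) p₀ p₀ ∈ B := by
    refine ⟨mem_extChartAt_target p₀, ?_⟩
    rw [Set.mem_preimage, (extChartAt (𝓡 n) p₀).left_inv (mem_extChartAt_source p₀)]
    exact ⟨mem_extChartAt_source q, hqO⟩
  have hj₀ : j (extChartAt (𝓡 n) p₀ p₀) = extChartAt (𝓡 (2 * n)) q q := by
    change extChartAt (𝓡 (2 * n)) q
      ((extChartAt (𝓡 n) p₀).symm (extChartAt (𝓡 n) p₀ p₀) : P) = _
    rw [(extChartAt (𝓡 n) p₀).left_inv (mem_extChartAt_source p₀)]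
  -- The preferred chart at `q` has identity differential at `q`, so tangent vectors of `P` at `q`
  -- are values of the derivative of its coordinate parametrization `j`.
  have hsurj : ∀ v ∈ (mfderiv (𝓡 n) (𝓡 (2 * n)) (Subtype.val : P → Q) p₀).range,
      ∃ η, fderiv ℝ j (extChartAt (𝓡 n) p₀ p₀) η = v := by
    rintro _ ⟨η', rfl⟩
    have h1 : ∀ p : P, p = p₀ → ∃ η : TangentSpace (𝓡 n) p,
        (mfderiv (𝓡 (2 * n)) (𝓡 (2 * n)) (extChartAt (𝓡 (2 * n)) q) (p : Q)
          (mfderiv (𝓡 n) (𝓡 (2 * n)) (Subtype.val : P → Q) p η) :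
            EuclideanSpace ℝ (Fin (2 * n))) =
          mfderiv (𝓡 n) (𝓡 (2 * n)) (Subtype.val : P → Q) p₀ η' := by
      rintro _ rfl
      refine ⟨η', ?_⟩
      exact congrArg (fun f => f (mfderiv (𝓡 n) (𝓡 (2 * n)) (Subtype.val : P → Q) p₀ η'))
        (mfderiv_extChartAt_self (I := 𝓡 (2 * n)) (x := q))
    obtain ⟨η, hη⟩ := h1 _ ((extChartAt (𝓡 n) p₀).left_inv (mem_extChartAt_source p₀))
    obtain ⟨η₁, rfl⟩ := (chartFrameEquiv hξ₀.1).surjective η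
    exact ⟨η₁, (hjd _ hξ₀ η₁).trans hη⟩
  obtain ⟨η, rfl⟩ := hsurj v hv
  obtain ⟨η', rfl⟩ := hsurj w hw
  rw [← hj₀]
  refine h.fderiv_comm_of_immersion hn hB hjs (fun ξ hξ => hξ.2.2) hji (fun ξ hξ => ?_) hξ₀ η η'
  have hU : (((extChartAt (𝓡 n) p₀).symm ξ : P) : Q) ∈ U := by
    have := (hOU hξ.2.2).2
    rwa [Set.mem_preimage, (extChartAt (𝓡 (2 * n)) q).left_inv hξ.2.1] at this
  obtain ⟨θ, hθ⟩ := eq_comap_of_mem_circle (huF _ hU) (hP.2 ((extChartAt (𝓡 n) p₀).symm ξ))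
  refine ⟨θ, fun η => ?_⟩
  rw [hju ξ hξ]
  exact hθ.le ⟨_, rfl⟩

end S1GLStructure
end IntegrableStructures

/-! ### The curvature functions and the integrability criterion. -/

section CurvatureFunctions

lemma exists_smoothVectorField_eq {m : ℕ} {Q : Type*} [TopologicalSpace Q] [T2Space Q]
    [ChartedSpace (EuclideanSpace ℝ (Fin m)) Q] [IsManifold (𝓡 m) ∞ Q] (q : Q)
    (v : TangentSpace (𝓡 m) q) :
    ∃ X : (p : Q) → TangentSpace (𝓡 m) p, SmoothVectorField X ∧ X q = v := by
  have hq := mem_extChartAt_target (I := 𝓡 m) q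
  obtain ⟨X, hX, hXv⟩ := exists_smooth_vectorField (E := EuclideanSpace ℝ (Fin m)) q
    (w := fun _ => v) (isOpen_extChartAt_target q) subset_rfl hq contDiffOn_const
  refine ⟨X, hX, ?_⟩
  have h1 : ∀ p, p = q → (X q : EuclideanSpace ℝ (Fin m)) =
      mfderiv (𝓡 m) (𝓡 m) (extChartAt (𝓡 m) q) p (X p) := by
    rintro _ rfl
    exact (congrArg (fun f : EuclideanSpace ℝ (Fin m) →L[ℝ] EuclideanSpace ℝ (Fin m) => f (X _))
      (mfderiv_extChartAt_self (I := 𝓡 m))).symm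
  exact (h1 _ ((extChartAt (𝓡 m) q).left_inv (mem_extChartAt_source q))).trans
    ((congrArg _ hXv.self_of_nhds).trans (mfderiv_extChartAt_chartFrame hq v))

variable {Q : Type*} [TopologicalSpace Q] [ChartedSpace (EuclideanSpace ℝ (Fin (2 * 2))) Q]
  [IsManifold (𝓡 (2 * 2)) ∞ Q] {F : S1GLStructure 2 Q}
  {nabla : CovariantDerivative (𝓡 (2 * 2)) (EuclideanSpace ℝ (Fin (2 * 2)))
    (TangentSpace (𝓡 (2 * 2)) : Q → Type _)}

/-- The coefficients `c` describe the curvature of the connection with respect to one coframe. -/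
def CurvatureCoefficients.DescribesCurvature (c : CurvatureCoefficients)
    (nabla : CovariantDerivative (𝓡 (2 * 2)) (EuclideanSpace ℝ (Fin (2 * 2)))
      (TangentSpace (𝓡 (2 * 2)) : Q → Type _)) {q : Q} (f : CoframeAt 2 q) : Prop :=
  ∀ X Y Z : (p : Q) → TangentSpace (𝓡 (2 * 2)) p,
    SmoothVectorField X → SmoothVectorField Y → SmoothVectorField Z →
    f (affineCurvature nabla X Y Z q) = (c.curvatureMatrix (f (X q)) (f (Y q))).mulVec (f (Z q))

/-- Every tangent vector at `q` extends to a smooth vector field, so the curvature identity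
determines the curvature matrix on all arguments, and with it the coefficients. -/
lemma CurvatureCoefficients.DescribesCurvature.unique [T2Space Q] {c c' : CurvatureCoefficients}
    {q : Q} {f : CoframeAt 2 q} (h : c.DescribesCurvature nabla f)
    (h' : c'.DescribesCurvature nabla f) : c = c' := by
  refine CurvatureCoefficients.eq_of_curvatureMatrix_eq fun x y => ?_
  refine Matrix.ext_of_mulVec_single fun i => ?_
  obtain ⟨X, hX, hXq⟩ := exists_smoothVectorField_eq q (f.symm x)
  obtain ⟨Y, hY, hYq⟩ := exists_smoothVectorField_eq q (f.symm y)
  obtain ⟨Z, hZ, hZq⟩ := exists_smoothVectorField_eq q (f.symm (Pi.single i 1))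
  have h1 := (h X Y Z hX hY hZ).symm.trans (h' X Y Z hX hY hZ)
  rw [hXq, hYq, hZq] at h1
  simpa only [f.apply_symm_apply] using h1

namespace S1GLStructure

lemma isCurvatureFunctions_iff {c : F.Total → CurvatureCoefficients} :
    F.IsCurvatureFunctions nabla c ↔ ∀ f : F.Total, (c f).DescribesCurvature nabla f.2.1 :=
  ⟨fun h f X Y Z hX hY hZ => h f.1 f.2 X Y Z hX hY hZ,
    fun h q u X Y Z hX hY hZ => h ⟨q, u⟩ X Y Z hX hY hZ⟩

variable {q : Q} {u : (p : Q) → CoframeAt 2 p} {U : Set Q}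

/-- A coframing of the structure in the preferred chart at `q`, with the curvature of the
connection. -/
theorem IsTorsionFreeConnection.exists_local_curvature [T2Space Q]
    (h : F.IsTorsionFreeConnection nabla) (hU : IsOpen U) (huF : ∀ p ∈ U, u p ∈ F.fibre p)
    (hu : SmoothCoframingOn 2 u U) (hq : q ∈ U) :
    ∃ O ⊆ (extChartAt (𝓡 (2 * 2)) q).target ∩ (extChartAt (𝓡 (2 * 2)) q).symm ⁻¹' U,
      extChartAt (𝓡 (2 * 2)) q q ∈ O ∧ ∃ α φ,
        IsTorsionFreeCoframe O (localCoframe q u) α φ ∧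
        ∀ x ∈ O, ∃ c : CurvatureCoefficients,
          c.DescribesCurvature nabla (u ((extChartAt (𝓡 (2 * 2)) q).symm x)) ∧
          ∀ v w, c.Omega0 (fun i z => z i) (localCoframe q u x v) (localCoframe q u x w) =
            extDeriv₁ α x v w := by
  obtain ⟨O, hOU, hqO, α, φ, hO, key⟩ := h.exists_isTorsionFreeCoframe two_pos hU huF hu hq
  refine ⟨O, hOU, hqO, α, φ, hO, fun x hx => ?_⟩
  obtain ⟨c, hc⟩ := hO.exists_curvatureCoefficients hx
  refine ⟨c, fun X Y Z hX hY hZ => ?_, fun v w => (hc v w).1⟩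
  have h1 : ∀ X : (p : Q) → TangentSpace (𝓡 (2 * 2)) p,
      localCoframe q u x (localField q X x) = u _ (X ((extChartAt (𝓡 (2 * 2)) q).symm x)) :=
    fun X => congrArg (u _) (chartFrame_localField (hOU hx).1 X)
  rw [h.toIsConnection.affineCurvature_eq hU hu hO.isOpen hOU hx
    ((hO.contDiffOn_connectionForm.contDiffAt (hO.isOpen.mem_nhds hx)).differentiableAt (by simp))
    key hX hY hZ, (hc _ _).2, h1, h1]
  rfl

/-- The condition is imposed at each coframe separately, so both claims are pointwise. Existence at
a coframe comes from a local section through it. -/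
lemma IsTorsionFreeConnection.existsUnique_isCurvatureFunctions [T2Space Q]
    (h : F.IsTorsionFreeConnection nabla) :
    ∃! c : F.Total → CurvatureCoefficients, F.IsCurvatureFunctions nabla c := by
  have key : ∀ f : F.Total, ∃ c : CurvatureCoefficients, c.DescribesCurvature nabla f.2.1 := by
    rintro ⟨q, f, hf⟩
    obtain ⟨U, u, hU, hq, huF, hu, rfl⟩ := exists_section_through hf
    obtain ⟨O, -, hqO, _, _, -, hc⟩ := h.exists_local_curvature hU huF hu hq
    obtain ⟨c, hc, -⟩ := hc _ hqO
    rw [(extChartAt (𝓡 (2 * 2)) q).left_inv (mem_extChartAt_source q)] at hc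
    exact ⟨c, hc⟩
  choose c hc using key
  exact ⟨c, isCurvatureFunctions_iff.2 hc, fun c' hc' =>
    funext fun f => (isCurvatureFunctions_iff.1 hc' f).unique (hc f)⟩

theorem TorsionFree.integrable_of_two_lt {n : ℕ} {Q : Type*} [TopologicalSpace Q] [T2Space Q]
    [ChartedSpace (EuclideanSpace ℝ (Fin (2 * n))) Q] [IsManifold (𝓡 (2 * n)) ∞ Q]
    {F : S1GLStructure n Q} (hn : 2 < n) (hF : F.TorsionFree) : F.Integrable := by
  obtain ⟨nabla, h⟩ := hF
  intro q S hS
  obtain ⟨f, hf, rfl⟩ := exists_eq_comap_zero_of_mem_circle hS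
  obtain ⟨U, u, hU, hq, huF, hu, rfl⟩ := exists_section_through hf
  obtain ⟨O, hOU, hqO, α, φ, hO, -⟩ := h.exists_isTorsionFreeCoframe (by omega) hU huF hu hq
  exact exists_submanifold huF hOU hqO hO fun x hx θ v w hv hw =>
    sub_eq_zero.1 (hO.extDeriv₁_eq_zero hn hx hv hw)

/-- Both sides say that `dα`, which is `Ω₀` in a local coframe, vanishes on all planes of the circle
bundle. -/
theorem IsTorsionFreeConnection.integrable_iff [T2Space Q] (h : F.IsTorsionFreeConnection nabla)
    {c : F.Total → CurvatureCoefficients} (hc : F.IsCurvatureFunctions nabla c) :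
    F.Integrable ↔ ∀ f : F.Total, (c f).A = 0 ∧ (c f).a = 0 := by
  rw [isCurvatureFunctions_iff] at hc
  constructor
  · rintro hF ⟨q, f, hf⟩
    obtain ⟨U, u, hU, hq, huF, hu, rfl⟩ := exists_section_through hf
    obtain ⟨O, hOU, hqO, α, φ, hO, hcO⟩ := h.exists_local_curvature hU huF hu hq
    obtain ⟨c', hc', hc'α⟩ := hcO _ hqO
    rw [(extChartAt (𝓡 (2 * 2)) q).left_inv (mem_extChartAt_source q)] at hc'
    rw [(hc ⟨q, u q, hf⟩).unique hc', ← CurvatureCoefficients.omega0_eq_zero_iff]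
    intro θ x hx y hy
    obtain ⟨v, rfl⟩ := (u q).surjective x
    obtain ⟨w, rfl⟩ := (u q).surjective y
    -- Integrability is used for every angle `θ` at the point `q`, since one plane alone does not
    -- determine both `A` and `a`.
    obtain ⟨P, _, _, hqP, hP, hPS⟩ := hF q ((rotatedRealPlane 2 θ).comap
      (u q : TangentSpace (𝓡 (2 * 2)) q →ₗ[ℝ] (Fin 2 → ℂ))) ⟨u q, hf, θ, rfl⟩
    have h1 := hP.fderiv_comm one_lt_two huF hOU hqO hO hqP (v := v) (w := w)
      (hPS.ge hx) (hPS.ge hy)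
    have h2 : ∀ a b : Fin 2 → ℂ, localCoframe q u (extChartAt (𝓡 (2 * 2)) q q) v = a →
        localCoframe q u (extChartAt (𝓡 (2 * 2)) q q) w = b →
        c'.Omega0 (fun i z => z i) a b = extDeriv₁ α (extChartAt (𝓡 (2 * 2)) q q) v w := by
      rintro _ _ rfl rfl
      exact hc'α v w
    have h3 : extDeriv₁ α (extChartAt (𝓡 (2 * 2)) q q) v w = 0 := sub_eq_zero.2 h1
    rw [h3, Complex.ofReal_zero] at h2
    exact h2 _ _ (localCoframe_self v) (localCoframe_self w)
  · intro hA q S hS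
    obtain ⟨f, hf, rfl⟩ := exists_eq_comap_zero_of_mem_circle hS
    obtain ⟨U, u, hU, hq, huF, hu, rfl⟩ := exists_section_through hf
    obtain ⟨O, hOU, hqO, α, φ, hO, hcO⟩ := h.exists_local_curvature hU huF hu hq
    refine exists_submanifold huF hOU hqO hO fun x hx θ v w hv hw => ?_
    obtain ⟨c', hc', hc'α⟩ := hcO x hx
    have h1 := hA ⟨_, u _, huF _ (hOU hx).2⟩
    rw [(hc ⟨_, u _, huF _ (hOU hx).2⟩).unique hc', ← CurvatureCoefficients.omega0_eq_zero_iff]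
      at h1
    have h2 := (hc'α v w).symm.trans (h1 θ _ hv _ hw)
    exact sub_eq_zero.1 (Complex.ofReal_eq_zero.1 h2)

end S1GLStructure
end CurvatureFunctions

end

theorem mainTheorem11 :
    (∀ (n : ℕ) (Q : Type*) [TopologicalSpace Q] [T2Space Q]
      [ChartedSpace (EuclideanSpace ℝ (Fin (2 * n))) Q] [IsManifold (𝓡 (2 * n)) ∞ Q]
      (F : S1GLStructure n Q), 2 < n → F.TorsionFree → F.Integrable) ∧
    (∀ (Q : Type*) [TopologicalSpace Q] [T2Space Q]
      [ChartedSpace (EuclideanSpace ℝ (Fin (2 * 2))) Q] [IsManifold (𝓡 (2 * 2)) ∞ Q]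
      (F : S1GLStructure 2 Q)
      (nabla : CovariantDerivative (𝓡 (2 * 2)) (EuclideanSpace ℝ (Fin (2 * 2)))
        (TangentSpace (𝓡 (2 * 2)) : Q → Type _)),
      F.IsTorsionFreeConnection nabla →
      (∃! c : F.Total → CurvatureCoefficients, F.IsCurvatureFunctions nabla c) ∧
      ∀ c : F.Total → CurvatureCoefficients, F.IsCurvatureFunctions nabla c →
        (F.Integrable ↔ ∀ f : F.Total, (c f).A = 0 ∧ (c f).a = 0)) := by
  exact ⟨fun _ _ _ _ _ _ _ hn hF => hF.integrable_of_two_lt hn, fun _ _ _ _ _ _ _ h =>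
    ⟨h.existsUnique_isCurvatureFunctions, fun _ hc => h.integrable_iff hc⟩⟩
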